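/- Let $H=(V,E,w)$ be a weighted undirected hypergraph: $V$ is a finite vertex set, $E$ a finite family of $m$ non-empty subsets of $V$ (hyperedges), and $w:E\to[0,\infty]$; a listed hyperedge of weight $\infty$ is regarded as absent. A hyperpath between $u$ and $v$ is a sequence of hyperedges $e_0,\dots,e_k$ with $u\in e_0$, $v\in e_k$, $e_i\cap e_{i+1}\ne\emptyset$; its weight is $\sum_i w(e_i)$. Fix a source $s\in V$ and let $d(v)$ be the least weight of a hyperpath between $s$ and $v$ ($d(s)=0$; $d(v)=\infty$ if there is none). Initially the arrays $D,P,E$ hold correct shortest-path data: $D[v]=d(v)$, the parent $P[v]$ of $v$ in a relationship tree rooted at $s$, and a hyperedge $E[v]$ containing $P[v]$ and $v$ with $d(P[v])+w(E[v])=d(v)$ ($P[v]=E[v]=\mathrm{Null}$ if $v=s$ or $d(v)=\infty$). The weight of a single hyperedge $e$ changes to $w_{new}\in[0,\infty]$, $w_{new}\neq w(e)$ (insertion and deletion of $e$ are changes from and to $\infty$). Let $w'$, $d'$ be the new weights and distances. A vertex $v$ is affected unless $d'(v)=d(v)$ and its current parent data stay valid, i.e. $P[v]=E[v]=\mathrm{Null}$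 or $d'(P[v])+w'(E[v])=d'(v)$. A hyperedge, or an edge of the underlying graph $G$ ($uv$ is an edge of $G$ iff $u\ne v$ lie in a common hyperedge), is affected if it contains an affected vertex. Let $|\delta|$ be the number of affected vertices, $|\delta_\Phi|=\sum_{f\text{ affected hyperedge}}|f|^2$, and $\|\tilde\delta\|$ the number of affected edges of $G$ plus $|\delta|$. HE-DSP is the following algorithm, where scanning $z$ means visiting all $v\in f$ for all hyperedges $f\ni z$, with $\omega=w'(f)$. Decrease: (0) set $w(e)\leftarrow w_{new}$; (1) let $x\in e$ minimize $D$; for all $v\in e$ with $D[x]+w_{new}<D[v]$ put $D[v]\leftarrow D[x]+w_{new}$, $P[v]\leftarrow x$, $E[v]\leftarrow e$ and enqueue $v$ in a priority queue $Q$ with key $D[v]$; (2) while $Q$ is non-empty, dequeue a vertex $z$ of least key and scan it: whenever $D[z]+\omega<D[v]$, put $D[v]\leftarrow D[z]+\omega$, $P[v]\leftarrow z$, $E[v]\leftarrow f$ and enqueue $v$ or update its key. Increase: (0) set $w(e)\leftarrow w_{new}$; (1) enqueue all $v\in e$ with $E[v]=e$ in a priority queue $M$ with key $D[v]$; (2)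 while $M$ is non-empty, dequeue a vertex $z$ of least key and scan it: if some nonred $q\neq z$ and its $f$ satisfy $D[q]+\omega=D[z]$, colour $z$ pink and put $P[z]\leftarrow q$, $E[z]\leftarrow f$; otherwise colour $z$ red and enqueue in $M$ those of its children that have not been enqueued yet; (3a) give each red $z$ the least $D[q]+\omega$ over its nonred neighbours $q$, with the corresponding $P[z],E[z]$, and enqueue it in $Q$ (if there is no finite such value, $D[z]\leftarrow\infty$ and $P[z],E[z]\leftarrow\mathrm{Null}$); (3b) as step 2 of Decrease; finally reset the colours. DR-DSP is the same algorithm, except that scanning $z$ means visiting its neighbours $v$ in $G$, each once, with $\omega=w_{zv}=\min\{w'(f):f\ni z,v\}$ and $f$ a hyperedge attaining this minimum. For this purpose every pair $u\ne v$ has a priority queue $M_{uv}$ of the weights of the hyperedges containing $u,v$, and step 0 also updates $M_{uv}$ and $w_{uv}$ for all $u,v\in e$. Time is counted in elementary steps on a random access machine with unit-cost arithmetic and comparison of weights; hypergraph and underlying graph are given by vertex, incidence and adjacency lists; $Q$ and $M$ are Fibonacci heaps and the $M_{uv}$ are tournament trees. Theorem (dynamic time complexity). There is an absolute constant $C>0$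 such that for every such hypergraph, source, correct initial data and single hyperedge change, both algorithms terminate with their working storage reset, and: 1. if some vertex is affected, HE-DSP takes at most $C\,(|\delta|\log|\delta|+|\delta_\Phi|)$ steps; if no vertex is affected, it takes at most $C\,|e|$ steps; 2. DR-DSP takes at most $C\,(|\delta|\log|\delta|+\|\tilde\delta\|+|e|^2\log(m+1))$ steps. -/

import Mathlib

open scoped ENNReal

/-! # Programs with a step count -/

/-- A (possibly diverging) program on a random access memory of type `σ` with a result in `α`:
it maps the initial memory to the result, the final memory and the number of elementary steps;
`none` stands for divergence. -/
def Prog (σ α : Type) : Type := σ → Option (α × σ × ℕ)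

namespace Prog

variable {σ α β : Type}

/-- Results are kept in registers; sequential composition adds the numbers of steps. -/
instance : Monad (Prog σ) where
  pure a := fun s => some (a, s, 0)
  bind p f := fun s => (p s).bind fun r => (f r.1 r.2.1).map fun q =>
    (q.1, q.2.1, r.2.2 + q.2.2)

/-- One elementary step. It is only used below for steps that read and write a bounded number of
memory cells and make a bounded number of additions and comparisons of numbers, vertices and
hyperedges. -/
def step (f : σ → α × σ) : Prog σ α := fun s => some ((f s).1, (f s).2, 1)

/-- An elementary step that only reads. -/
def read (f : σ → α) : Prog σ α := step fun s => (f s, s)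

/-- An elementary step that only writes. -/
def write (f : σ → σ) : Prog σ Unit := step fun s => ((), f s)

/-- At most `k` rounds of the loop below; `none` if it has not ended by then. -/
def loopUpTo (body : β → Prog σ (Option β)) : ℕ → β → Prog σ Unit
  | 0, _ => fun _ => none
  | k + 1, b => do
      write id
      let b? ← body b
      match b? with
      | none => pure ()
      | some b' => loopUpTo body k b'

open Classical in
/-- Run `body` on the register value `b`, and again on the value that it returns, until it returns
`none`. Each round costs one step besides the steps of `body`. The loop diverges if it does not
end after any number of rounds. -/
noncomputable def repeatUntilNone (body : β → Prog σ (Option β)) (b : β) : Prog σ Unit := fun s =>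
  if h : ∃ k, (loopUpTo body k b s).isSome then loopUpTo body (Nat.find h) b s else none

/-- Traverse a linked list with an accumulator in a register. Each list cell, and the end of the
list, costs one step besides the steps of `f`. -/
def foldEach (f : β → α → Prog σ β) : List α → β → Prog σ β
  | [], b => do
      write id
      pure b
  | a :: l, b => do
      write id
      let b' ← f b a
      foldEach f l b'

/-- Traverse a linked list. -/
def forEach (l : List α) (f : α → Prog σ Unit) : Prog σ Unit :=
  foldEach (fun _ a => f a) l ()

end Prog

open Prog (read write step repeatUntilNone foldEach forEach)

/-! # Fibonacci heaps -/

/-- The memory of a Fibonacci heap whose items are the vertices `0, …, n - 1`. The root list and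
the child lists are doubly linked lists, each item knowing its place: putting an item in front and
unlinking an item are elementary. -/
structure FibHeap (n : ℕ) where
  roots : List (Fin n)
  minRoot : Option (Fin n)
  /-- Is the item in the queue? -/
  mem : Fin n → Bool
  key : Fin n → ℝ≥0∞
  parent : Fin n → Option (Fin n)
  children : Fin n → List (Fin n)
  /-- The number of children. -/
  rank : Fin n → ℕ
  mark : Fin n → Bool
  /-- Auxiliary array for consolidation, all `none` between two operations. -/
  slot : ℕ → Option (Fin n)

namespace FibHeap

variable {n : ℕ}

/-- The queue is empty and its memory is ready for use. -/
def Clean (h : FibHeap n) : Prop :=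
  h.roots = [] ∧ h.minRoot = none ∧ (∀ v, h.mem v = false) ∧ ∀ i, h.slot i = none

/-- Compare the root `v` with the current minimum. -/
noncomputable def updateMin (v : Fin n) : Prog (FibHeap n) Unit :=
  write fun h =>
    match h.minRoot with
    | none => { h with minRoot := some v }
    | some u => if h.key v < h.key u then { h with minRoot := some v } else h

/-- Enqueue an item that is not in the queue, as a new root. -/
noncomputable def insert (v : Fin n) (k : ℝ≥0∞) : Prog (FibHeap n) Unit := do
  write fun h => { h with
    roots := v :: h.roots
    mem := Function.update h.mem v true
    key := Function.update h.key v k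
    parent := Function.update h.parent v none
    children := Function.update h.children v []
    rank := Function.update h.rank v 0
    mark := Function.update h.mark v false }
  updateMin v

/-- Cut `v` off its parent `p` and make it an unmarked root. -/
def cut (v p : Fin n) : Prog (FibHeap n) Unit :=
  write fun h => { h with
    roots := v :: h.roots
    parent := Function.update h.parent v none
    children := Function.update h.children p ((h.children p).erase v)
    rank := Function.update h.rank p (h.rank p - 1)
    mark := Function.update h.mark v false }

/-- Cascading cut: a non-root that loses a first child gets marked, one that loses a second child
is cut off its parent, which has then lost a child itself. -/
noncomputable def cascade (p : Fin n) : Prog (FibHeap n) Unit :=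
  repeatUntilNone (fun p => do
    let g? ← read fun h => h.parent p
    match g? with
    | none => pure none
    | some g => do
      let marked ← read fun h => h.mark p
      if marked then
        cut p g
        pure (some g)
      else
        write fun h => { h with mark := Function.update h.mark p true }
        pure none) p

/-- Decrease the key of an item of the queue to `k`. -/
noncomputable def decreaseKey (v : Fin n) (k : ℝ≥0∞) : Prog (FibHeap n) Unit := do
  write fun h => { h with key := Function.update h.key v k }
  let p? ← read fun h => h.parent v
  match p? with
  | none => pure ()
  | some p => do
    let violated ← read fun h => decide (k < h.key p)
    if violated then
      cut v p
      cascade p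
    else
      pure ()
  updateMin v

/-- Make the one of the two roots `x`, `y` with the larger key a child of the other one, and return
the latter. -/
noncomputable def link (x y : Fin n) : Prog (FibHeap n) (Fin n) :=
  step fun h =>
    let win := if h.key y < h.key x then y else x
    let los := if h.key y < h.key x then x else y
    (win, { h with
      parent := Function.update h.parent los (some win)
      children := Function.update h.children win (los :: h.children win)
      rank := Function.update h.rank win (h.rank win + 1)
      mark := Function.update h.mark los false })

/-- Link roots of equal rank until all ranks are different, then rebuild the root list and find the
minimum. -/
noncomputable def consolidate : Prog (FibHeap n) Unit := do
  let rs ← step fun h => (h.roots, { h with roots := [] })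
  forEach rs fun r =>
    repeatUntilNone (fun x => do
      let y? ← read fun h => h.slot (h.rank x)
      match y? with
      | none => do
        write fun h => { h with slot := Function.update h.slot (h.rank x) (some x) }
        pure none
      | some y => do
        write fun h => { h with slot := Function.update h.slot (h.rank x) none }
        let win ← link x y
        pure (some win)) r
  forEach rs fun r => do
    let isRoot ← read fun h => decide (h.slot (h.rank r) = some r)
    if isRoot then
      write fun h => { h with
        slot := Function.update h.slot (h.rank r) none
        roots := r :: h.roots }
      updateMin r
    else
      pure ()

/-- Dequeue an item of minimal key; `none` if the queue is empty. -/
noncomputable def extractMin : Prog (FibHeap n) (Option (Fin n)) := do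
  let z? ← read fun h => h.minRoot
  match z? with
  | none => pure none
  | some z => do
    let cs ← read fun h => h.children z
    forEach cs fun c =>
      write fun h => { h with
        roots := c :: h.roots
        parent := Function.update h.parent c none
        mark := Function.update h.mark c false }
    write fun h => { h with
      roots := h.roots.erase z
      minRoot := none
      mem := Function.update h.mem z false
      children := Function.update h.children z []
      rank := Function.update h.rank z 0 }
    consolidate
    pure (some z)

end FibHeap

/-! # Weighted hypergraphs and shortest hyperpaths -/

/-- A weighted undirected hypergraph with vertices `0, …, n - 1` and a list of `m` hyperedges.
A listed hyperedge of weight `∞` is one that is absent, so that inserting it is decreasing its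
weight from `∞` and deleting it is increasing its weight to `∞`. It is not required that the
hyperedges cover all vertices, which deletions can destroy. -/
structure WeightedHypergraph (n m : ℕ) where
  edge : Fin m → Finset (Fin n)
  weight : Fin m → ℝ≥0∞
  edge_nonempty : ∀ e, (edge e).Nonempty

namespace WeightedHypergraph

variable {n m : ℕ} (H : WeightedHypergraph n m)

/-- The same hypergraph with the weight of the hyperedge `c` changed to `x`. -/
def setWeight (c : Fin m) (x : ℝ≥0∞) : WeightedHypergraph n m :=
  { H with weight := Function.update H.weight c x }

/-- `L = e₀, …, eₖ` is a hyperpath between `u` and `v`. -/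
def IsHyperpath (u v : Fin n) (L : List (Fin m)) : Prop :=
  (∃ h : L ≠ [], u ∈ H.edge (L.head h) ∧ v ∈ H.edge (L.getLast h)) ∧
    L.IsChain fun e f => (H.edge e ∩ H.edge f).Nonempty

/-- The weight of a hyperpath. -/
noncomputable def pathWeight (L : List (Fin m)) : ℝ≥0∞ := (L.map H.weight).sum

/-- The distance of `v` to the source `s`: the weight of a shortest hyperpath, `∞` if there is no
hyperpath, and `0` for the source itself. -/
noncomputable def dist (s v : Fin n) : ℝ≥0∞ :=
  if v = s then 0 else ⨅ (L : List (Fin m)) (_ : H.IsHyperpath s v L), H.pathWeight L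

/-- The underlying graph: two different vertices are adjacent iff some hyperedge contains both. -/
def underlyingGraph : SimpleGraph (Fin n) where
  Adj u v := u ≠ v ∧ ∃ e, u ∈ H.edge e ∧ v ∈ H.edge e
  symm := ⟨fun _ _ h => ⟨h.1.symm, h.2.imp fun _ he => ⟨he.2, he.1⟩⟩⟩
  loopless := ⟨fun _ h => h.1 rfl⟩

/-- `D`, `P`, `E` hold correct distances to `s` and a correct relationship tree: the parent of `v`
is `P v`, and `E v` is the hyperedge that leads from `P v` to `v` on a shortest hyperpath. -/
def IsShortestPathData (s : Fin n) (D : Fin n → ℝ≥0∞) (P : Fin n → Option (Fin n))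
    (E : Fin n → Option (Fin m)) : Prop :=
  (∀ v, D v = H.dist s v) ∧
  (∀ v, v = s ∨ D v = ∞ → P v = none ∧ E v = none) ∧
  (∀ v, v ≠ s → D v ≠ ∞ → ∃ p e, P v = some p ∧ E v = some e ∧ p ∈ H.edge e ∧ v ∈ H.edge e ∧
    D p + H.weight e = D v) ∧
  (∀ v, D v ≠ ∞ → Relation.ReflTransGen (fun a b => P a = some b) v s)

end WeightedHypergraph

/-! # The two dynamic algorithms -/

/-- The colours of the weight increase algorithms; `queued` is for a vertex in the queue of the
colouring process, before it is dequeued. -/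
inductive Colour
  | white
  | queued
  | pink
  | red
  deriving DecidableEq

/-- An entry of a queue `M_uv`: a hyperedge with its weight, or nothing. -/
abbrev Entry (m : ℕ) := Option (Fin m × ℝ≥0∞)

/-- The entry of smaller weight. -/
noncomputable def Entry.better {m : ℕ} : Entry m → Entry m → Entry m
  | none, b => b
  | some a, none => some a
  | some a, some b => if b.2 < a.2 then some b else some a

/-- The memory of the two algorithms. -/
structure Mem (n m : ℕ) where
  /-- The vertices of each hyperedge, as a list. -/
  verts : Fin m → List (Fin n)
  /-- The hyperedges that contain a given vertex, as a list. -/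
  inc : Fin n → List (Fin m)
  weight : Fin m → ℝ≥0∞
  /-- Distances to the source. -/
  D : Fin n → ℝ≥0∞
  /-- Parents in the relationship tree. -/
  P : Fin n → Option (Fin n)
  /-- The hyperedge that leads to a vertex from its parent. -/
  E : Fin n → Option (Fin m)
  colour : Fin n → Colour
  /-- The vertices that were put into the queue of the colouring process. -/
  seen : List (Fin n)
  /-- The priority queue (of the colouring process first, of the distance updates afterwards). -/
  queue : FibHeap n
  /-- DR-DSP only: adjacency lists of the underlying graph. -/
  adj : Fin n → List (Fin n)
  /-- DR-DSP only: the priority queues `M_uv` of the hyperedges that contain `u` and `v`, each one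
  a tournament tree, that is, a complete binary tree whose root is node `1`, where node `i` has the
  children `2 * i` and `2 * i + 1` and holds the better one of their entries. -/
  pairQueue : Fin n → Fin n → ℕ → Entry m
  /-- DR-DSP only: the weight of the edge `uv` in the underlying graph, with the hyperedge that
  lends it. -/
  edgeWeight : Fin n → Fin n → Entry m

/-- The number of leaves of the tournament trees, the smallest power of two that is at least `m`;
the leaf of the hyperedge `e` is the node `leafCount m + e`. -/
def leafCount (m : ℕ) : ℕ := 2 ^ Nat.clog 2 m

namespace Mem

variable {n m : ℕ}

/-- The working storage is ready for use. -/
def Clean (M : Mem n m) : Prop :=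
  (∀ v, M.colour v = Colour.white) ∧ M.seen = [] ∧ M.queue.Clean

/-- The memory represents the hypergraph `H` with its shortest hyperpaths from `s`. -/
def RepresentsHE (M : Mem n m) (H : WeightedHypergraph n m) (s : Fin n) : Prop :=
  (∀ e, (M.verts e).Nodup ∧ ∀ v, v ∈ M.verts e ↔ v ∈ H.edge e) ∧
  (∀ v, (M.inc v).Nodup ∧ ∀ e, e ∈ M.inc v ↔ v ∈ H.edge e) ∧
  M.weight = H.weight ∧
  H.IsShortestPathData s M.D M.P M.E ∧
  M.Clean

/-- The memory represents moreover the underlying graph of `H`. -/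
def RepresentsDR (M : Mem n m) (H : WeightedHypergraph n m) (s : Fin n) : Prop :=
  M.RepresentsHE H s ∧
  (∀ u, (M.adj u).Nodup ∧ ∀ v, v ∈ M.adj u ↔ H.underlyingGraph.Adj u v) ∧
  ∀ u v, u ≠ v →
    (∀ e : Fin m, (u ∈ H.edge e ∧ v ∈ H.edge e →
        M.pairQueue u v (leafCount m + e) = some (e, H.weight e)) ∧
      (¬ (u ∈ H.edge e ∧ v ∈ H.edge e) → M.pairQueue u v (leafCount m + e) = none)) ∧
    (∀ i, leafCount m + m ≤ i → i < 2 * leafCount m → M.pairQueue u v i = none) ∧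
    (∀ i, 1 ≤ i → i < leafCount m → M.pairQueue u v i =
      (M.pairQueue u v (2 * i)).better (M.pairQueue u v (2 * i + 1))) ∧
    M.edgeWeight u v = M.pairQueue u v 1

end Mem

namespace DSP

variable {n m : ℕ}

/-- Run an operation of the priority queue. -/
def onQueue {α : Type} (p : Prog (FibHeap n) α) : Prog (Mem n m) α := fun M =>
  (p M.queue).map fun r => (r.1, { M with queue := r.2.1 }, r.2.2)

/-- The two algorithms. -/
inductive Variant
  | HE
  | DR

/-- Visit the neighbours `v` of `z`, each with a hyperedge `e` containing both and its weight `x`: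
HE-DSP visits all vertices of all hyperedges that contain `z`, and DR-DSP visits the neighbours of
`z` in the underlying graph, `e` being the hyperedge that lends its weight to the edge `zv`. -/
def scan {β : Type} (a : Variant) (z : Fin n) (b : β)
    (f : β → Fin n → Fin m → ℝ≥0∞ → Prog (Mem n m) β) : Prog (Mem n m) β :=
  match a with
  | Variant.HE => do
    let es ← read fun M => M.inc z
    foldEach (fun b e => do
      let x ← read fun M => M.weight e
      let vs ← read fun M => M.verts e
      foldEach (fun b v => f b v e x) vs b) es b
  | Variant.DR => do
    let vs ← read fun M => M.adj z
    foldEach (fun b v => do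
      let t ← read fun M => M.edgeWeight z v
      match t with
      | none => pure b
      | some (e, x) => f b v e x) vs b

/-- `D[v] ← d`, `P[v] ← p`, `E[v] ← e`. -/
def setPath (v : Fin n) (d : ℝ≥0∞) (p : Option (Fin n)) (e : Option (Fin m)) :
    Prog (Mem n m) Unit :=
  write fun M => { M with
    D := Function.update M.D v d
    P := Function.update M.P v p
    E := Function.update M.E v e }

/-- Enqueue the vertex `v` with the priority `D[v]`, or update its priority. -/
noncomputable def enqueueOrUpdate (v : Fin n) : Prog (Mem n m) Unit := do
  let d ← read fun M => M.D v
  let present ← read fun M => M.queue.mem v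
  if present then
    onQueue (FibHeap.decreaseKey v d)
  else
    onQueue (FibHeap.insert v d)

/-- A vertex of the hyperedge `c` with smallest `D`. -/
noncomputable def argminD (c : Fin m) : Prog (Mem n m) (Option (Fin n)) := do
  let vs ← read fun M => M.verts c
  foldEach (fun x? v =>
    match x? with
    | none => pure (some v)
    | some x => do
      let smaller ← read fun M => decide (M.D v < M.D x)
      pure (some (if smaller then v else x))) vs none

/-- Weight decrease, step 1: determine the affected vertices in the changed hyperedge `c`. -/
noncomputable def decreaseStep1 (c : Fin m) (wNew : ℝ≥0∞) : Prog (Mem n m) Unit := do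
  let x? ← argminD c
  match x? with
  | none => pure ()
  | some x => do
    let vs ← read fun M => M.verts c
    forEach vs fun v => do
      let dx ← read fun M => M.D x
      let dv ← read fun M => M.D v
      if dx + wNew < dv then
        setPath v (dx + wNew) (some x) (some c)
        enqueueOrUpdate v
      else
        pure ()

/-- Weight decrease, step 2: while the queue is not empty, dequeue a vertex and update its
neighbours. -/
noncomputable def decreaseStep2 (a : Variant) : Prog (Mem n m) Unit :=
  repeatUntilNone (fun _ : Unit => do
    let z? ← onQueue FibHeap.extractMin
    match z? with
    | none => pure none
    | some z => do
      scan a z () fun _ v e x => do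
        let dz ← read fun M => M.D z
        let dv ← read fun M => M.D v
        if dz + x < dv then
          setPath v (dz + x) (some z) (some e)
          enqueueOrUpdate v
        else
          pure ()
      pure (some ())) ()

/-- Put `v` into the queue of the colouring process. -/
noncomputable def enqueueForColouring (v : Fin n) : Prog (Mem n m) Unit := do
  write fun M => { M with
    colour := Function.update M.colour v Colour.queued
    seen := v :: M.seen }
  let d ← read fun M => M.D v
  onQueue (FibHeap.insert v d)

/-- Weight increase, step 1: enqueue the vertices of `c` whose shortest hyperpath ends with `c`. -/
noncomputable def increaseStep1 (c : Fin m) : Prog (Mem n m) Unit := do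
  let vs ← read fun M => M.verts c
  forEach vs fun v => do
    let e? ← read fun M => M.E v
    if e? = some c then
      enqueueForColouring v
    else
      pure ()

/-- Weight increase, step 2 (colouring process): a dequeued vertex `z` becomes pink if some nonred
neighbour offers a path of the same length; otherwise it becomes red and its children are
enqueued. -/
noncomputable def increaseStep2 (a : Variant) : Prog (Mem n m) Unit :=
  repeatUntilNone (fun _ : Unit => do
    let z? ← onQueue FibHeap.extractMin
    match z? with
    | none => pure none
    | some z => do
      let alt ← scan a z (none : Option (Fin n × Fin m)) fun acc q e x => do
        let good ← read fun M =>
          decide (q ≠ z ∧ M.colour q ≠ Colour.red ∧ M.D q + x = M.D z)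
        pure (if good then some (q, e) else acc)
      match alt with
      | some (q, e) =>
        write fun M => { M with
          colour := Function.update M.colour z Colour.pink
          P := Function.update M.P z (some q)
          E := Function.update M.E z (some e) }
      | none => do
        write fun M => { M with colour := Function.update M.colour z Colour.red }
        scan a z () fun _ v _ _ => do
          let child ← read fun M => decide (M.P v = some z ∧ M.colour v = Colour.white)
          if child then
            enqueueForColouring v
          else
            pure ()
      pure (some ())) ()

/-- Weight increase, step 3.a: give every red vertex the distance through its best nonred
neighbour, `∞` if it has none, and enqueue it in the former case. -/
noncomputable def increaseStep3a (a : Variant) : Prog (Mem n m) Unit := do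
  let vs ← read fun M => M.seen
  forEach vs fun z => do
    let isRed ← read fun M => decide (M.colour z = Colour.red)
    if isRed then
      setPath z ∞ none none
      scan a z () fun _ q e x => do
        let cq ← read fun M => M.colour q
        let dq ← read fun M => M.D q
        let dz ← read fun M => M.D z
        if cq ≠ Colour.red ∧ dq + x < dz then
          setPath z (dq + x) (some q) (some e)
        else
          pure ()
      let dz ← read fun M => M.D z
      if dz < ∞ then
        enqueueOrUpdate z
      else
        pure ()
    else
      pure ()

/-- Restore the working storage after a weight increase. -/
def cleanUp : Prog (Mem n m) Unit := do
  let vs ← step fun M => (M.seen, { M with seen := [] })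
  forEach vs fun v =>
    write fun M => { M with colour := Function.update M.colour v Colour.white }

/-- `Update(M_uv, ⟨c, wNew⟩)`: change the leaf of `c`, then recompute the nodes on the way up to the
root. -/
noncomputable def pairQueueUpdate (u v : Fin n) (c : Fin m) (wNew : ℝ≥0∞) :
    Prog (Mem n m) Unit := do
  write fun M => { M with
    pairQueue := Function.update M.pairQueue u (Function.update (M.pairQueue u) v
      (Function.update (M.pairQueue u v) (leafCount m + c) (some (c, wNew)))) }
  repeatUntilNone (fun i =>
    if i = 0 then
      pure none
    else do
      write fun M => { M with
        pairQueue := Function.update M.pairQueue u (Function.update (M.pairQueue u) v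
          (Function.update (M.pairQueue u v) i
            ((M.pairQueue u v (2 * i)).better (M.pairQueue u v (2 * i + 1))))) }
      pure (some (i / 2))) ((leafCount m + c) / 2)

/-- Graph Update: update `M_uv` and the weight of `uv`, for all vertices `u ≠ v` of `c`. -/
noncomputable def graphUpdate (c : Fin m) (wNew : ℝ≥0∞) : Prog (Mem n m) Unit := do
  let vs ← read fun M => M.verts c
  forEach vs fun u =>
    forEach vs fun v =>
      if u = v then
        pure ()
      else do
        pairQueueUpdate u v c wNew
        write fun M => { M with
          edgeWeight := Function.update M.edgeWeight u (Function.update (M.edgeWeight u) v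
            (M.pairQueue u v 1)) }

/-- Step 0: update the hypergraph, and for DR-DSP also the underlying graph. -/
noncomputable def step0 (a : Variant) (c : Fin m) (wNew : ℝ≥0∞) : Prog (Mem n m) Unit := do
  write fun M => { M with weight := Function.update M.weight c wNew }
  match a with
  | Variant.HE => pure ()
  | Variant.DR => graphUpdate c wNew

/-- Weight Decrease. -/
noncomputable def weightDecrease (a : Variant) (c : Fin m) (wNew : ℝ≥0∞) :
    Prog (Mem n m) Unit := do
  step0 a c wNew
  decreaseStep1 c wNew
  decreaseStep2 a

/-- Weight Increase. -/
noncomputable def weightIncrease (a : Variant) (c : Fin m) (wNew : ℝ≥0∞) :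
    Prog (Mem n m) Unit := do
  step0 a c wNew
  increaseStep1 c
  increaseStep2 a
  increaseStep3a a
  decreaseStep2 a
  cleanUp

/-- The algorithm that processes the change of the weight of the hyperedge `c` to `wNew`. -/
noncomputable def run (a : Variant) (c : Fin m) (wNew : ℝ≥0∞) : Prog (Mem n m) Unit := do
  let w ← read fun M => M.weight c
  if wNew < w then
    weightDecrease a c wNew
  else
    weightIncrease a c wNew

end DSP

/-- HE-DSP: Hyperedge based Dynamic Shortest Path algorithm. -/
noncomputable def heDSP {n m : ℕ} (c : Fin m) (wNew : ℝ≥0∞) : Prog (Mem n m) Unit :=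
  DSP.run DSP.Variant.HE c wNew

/-- DR-DSP: Dimension Reduction based Dynamic Shortest Path algorithm. -/
noncomputable def drDSP {n m : ℕ} (c : Fin m) (wNew : ℝ≥0∞) : Prog (Mem n m) Unit :=
  DSP.run DSP.Variant.DR c wNew

/-! # Affected vertices, hyperedges and edges -/

namespace WeightedHypergraph

variable {n m : ℕ} (H : WeightedHypergraph n m)

open Classical in
/-- The vertices affected when `H` changes to `H'`, given the relationship tree `P`, `E` before the
change: `v` is not affected (white) iff its distance stays the same and is still realised by its
current parent `P v` and hyperedge `E v`. -/
noncomputable def affected (H' : WeightedHypergraph n m) (s : Fin n) (P : Fin n → Option (Fin n))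
    (E : Fin n → Option (Fin m)) : Finset (Fin n) :=
  Finset.univ.filter fun v => H'.dist s v ≠ H.dist s v ∨
    ∃ p e, P v = some p ∧ E v = some e ∧ H'.dist s p + H'.weight e ≠ H'.dist s v

open Classical in
/-- The sum of `|e|²` over the affected hyperedges `e`, those containing an affected vertex. -/
noncomputable def affectedPhi (A : Finset (Fin n)) : ℕ :=
  ∑ e ∈ Finset.univ.filter (fun e => ∃ v ∈ A, v ∈ H.edge e), (H.edge e).card ^ 2

/-- The number of affected edges of the underlying graph, plus the number of affected vertices. -/
noncomputable def affectedGraphSize (A : Finset (Fin n)) : ℕ :=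
  Set.ncard {a ∈ H.underlyingGraph.edgeSet | ∃ v ∈ A, v ∈ a} + A.card

end WeightedHypergraph

/-! # A program logic with time credits -/

/-! Only termination, the number of steps and the reset of the working storage are at stake; the
optimality of the final distances is never needed. Apart from the work on the changed hyperedge `c`,
the time is a sum over dequeued vertices: one extraction, of amortized cost O(log |δ|), and one or
two scans with O(1) amortized heap work per visit. It remains to see that only affected vertices are
queued, each at most once per phase, and to add up the scans.

Time is kept as credits (`Runs`). Every round of a loop consumes a credit, so a credit bound proves
termination too. The heaps are treated by the usual potential, roots plus twice the marked items;
the rank bound `Forest.rank_le` comes from Fibonacci numbers.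

Distance updates. The distance is the largest function that vanishes at `s` and satisfies d(v) ≤
d(u) + w(f) for u, v in f (`dist_le_add`, `le_dist`). Let ℓ satisfy these inequalities for the new
weights, let D ≥ ℓ everywhere and D ≤ ℓ outside a set A. Then a visit can improve D only inside A,
and since weights are nonnegative and keys leave the queue in nondecreasing order, nobody is
dequeued twice (`runs_relax`, `runs_decreaseStep2`). For a decrease, ℓ is the new distance and A the
affected set. For an increase, ℓ is the old distance, still feasible because weights have only
grown, and A is the set of red vertices, the only ones whose D was reset.

Colouring. The invariant is that a red vertex has changed its distance. Indeed, a vertex z ≠ s with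
unchanged finite distance has a neighbour q with unchanged distance that realises it under the new
weights (`exists_tight_pred`); q is not red, so the scan of z finds an alternative. Hence the
children of red vertices are affected, and so are the vertices reached through `c`; nothing else is
queued.

Summation. HE-DSP visits a hyperedge f from at most |f| affected vertices, at cost O(|f|) each. The
linear cost of `c` is absorbed because `c` contains an affected vertex as soon as there is one
(`exists_affected_mem`). For DR-DSP, the degrees of the affected vertices count every affected edge
at most twice, and O(|c|²) tournament trees are updated in O(log m + 1) steps each. -/

namespace Prog

variable {σ α β : Type}

/-- Started in the memory `s` with `N` credits, each of which pays for one elementary step, the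
program `p` terminates, and its result, its final memory and the remaining credits satisfy `Q`. -/
def Runs (p : Prog σ α) (s : σ) (N : ℕ) (Q : α → σ → ℕ → Prop) : Prop :=
  ∃ a s' t, p s = some (a, s', t) ∧ t ≤ N ∧ Q a s' (N - t)

theorem Runs.mono {p : Prog σ α} {s : σ} {N : ℕ} {Q Q' : α → σ → ℕ → Prop} (h : Runs p s N Q)
    (hQ : ∀ a s' N', Q a s' N' → Q' a s' N') : Runs p s N Q' := by
  obtain ⟨a, s', t, h1, h2, h3⟩ := h
  exact ⟨a, s', t, h1, h2, hQ _ _ _ h3⟩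

theorem runs_pure {a : α} {s : σ} {N : ℕ} {Q : α → σ → ℕ → Prop} (h : Q a s N) :
    Runs (pure a : Prog σ α) s N Q :=
  ⟨a, s, 0, rfl, Nat.zero_le _, h⟩

theorem runs_bind {p : Prog σ α} {f : α → Prog σ β} {s : σ} {N : ℕ} {Q : β → σ → ℕ → Prop}
    (h : Runs p s N fun a s' N' => Runs (f a) s' N' Q) : Runs (p >>= f) s N Q := by
  obtain ⟨a, s', t, h1, h2, b, s'', t', h3, h4, h5⟩ := h
  refine ⟨b, s'', t + t', ?_, by omega, by rwa [← Nat.sub_sub]⟩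
  change (p s).bind _ = _
  rw [h1]
  change ((f a) s').map _ = _
  rw [h3]
  rfl

theorem runs_step {f : σ → α × σ} {s : σ} {N : ℕ} {Q : α → σ → ℕ → Prop} (hN : 1 ≤ N)
    (h : Q (f s).1 (f s).2 (N - 1)) : Runs (step f) s N Q :=
  ⟨_, _, 1, rfl, hN, h⟩

theorem runs_read {f : σ → α} {s : σ} {N : ℕ} {Q : α → σ → ℕ → Prop} (hN : 1 ≤ N)
    (h : Q (f s) s (N - 1)) : Runs (read f) s N Q :=
  runs_step hN h

theorem runs_write {f : σ → σ} {s : σ} {N : ℕ} {Q : Unit → σ → ℕ → Prop} (hN : 1 ≤ N)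
    (h : Q () (f s) (N - 1)) : Runs (write f) s N Q :=
  runs_step hN h

theorem runs_read_bind {f : σ → α} {g : α → Prog σ β} {s : σ} {N : ℕ} {Q : β → σ → ℕ → Prop}
    (hN : 1 ≤ N) (h : Runs (g (f s)) s (N - 1) Q) : Runs (read f >>= g) s N Q :=
  runs_bind (runs_read hN h)

theorem runs_write_bind {f : σ → σ} {g : Unit → Prog σ β} {s : σ} {N : ℕ}
    {Q : β → σ → ℕ → Prop} (hN : 1 ≤ N) (h : Runs (g ()) (f s) (N - 1) Q) :
    Runs (write f >>= g) s N Q :=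
  runs_bind (runs_write hN h)

/-- The rule for loops: the credits bound the number of rounds. -/
theorem runs_repeatUntilNone {body : β → Prog σ (Option β)} {Q : Unit → σ → ℕ → Prop}
    (I : β → σ → ℕ → Prop)
    (hI : ∀ b s N, I b s N → 1 ≤ N ∧ Runs (body b) s (N - 1) fun r s' N' =>
      match r with
      | none => Q () s' N'
      | some b' => I b' s' N')
    {b : β} {s : σ} {N : ℕ} (h : I b s N) : Runs (repeatUntilNone body b) s N Q := by
  -- The step charged for each round makes the number of credits a termination measure.
  have key : ∀ N b s, I b s N → ∃ k, Runs (loopUpTo body k b) s N Q := by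
    intro N
    induction N using Nat.strong_induction_on with
    | _ N ih =>
      intro b s h
      obtain ⟨hN, r, s', t, h1, h2, h3⟩ := hI b s N h
      cases r with
      | none =>
        refine ⟨1, runs_write_bind hN (runs_bind ⟨none, s', t, h1, h2, ?_⟩)⟩
        exact runs_pure h3
      | some b' =>
        obtain ⟨k, hk⟩ := ih (N - 1 - t) (by omega) b' s' h3
        exact ⟨k + 1, runs_write_bind hN (runs_bind ⟨some b', s', t, h1, h2, hk⟩)⟩
  -- More fuel does not change a finished run, so the least sufficient number of rounds chosen by
  -- `repeatUntilNone` gives the same result as the one found in `key`.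
  have mono : ∀ k b s r, loopUpTo body k b s = some r → loopUpTo body (k + 1) b s = some r := by
    intro k
    induction k with
    | zero => intro b s r h; cases h
    | succ k ih =>
      intro b s r h
      rw [loopUpTo] at h ⊢
      change ((body b s).bind _).map _ = _ at h
      change ((body b s).bind _).map _ = _
      cases hb : body b s with
      | none => rw [hb] at h; cases h
      | some q =>
        rw [hb] at h
        obtain ⟨o, s', t⟩ := q
        cases o with
        | none => exact h
        | some b' =>
          change ((loopUpTo body k b' s').map _).map _ = _ at h
          change ((loopUpTo body (k + 1) b' s').map _).map _ = _
          cases hl : loopUpTo body k b' s' with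
          | none => rw [hl] at h; cases h
          | some q' =>
            rw [ih _ _ _ hl]
            rw [hl] at h
            exact h
  obtain ⟨k, a, s', t, h1, h2, h3⟩ := key N b s h
  have hex : ∃ k, (loopUpTo body k b s).isSome := ⟨k, by rw [h1]; rfl⟩
  refine ⟨a, s', t, ?_, h2, h3⟩
  classical
  have hrw : repeatUntilNone body b s = loopUpTo body (Nat.find hex) b s := by
    unfold repeatUntilNone
    rw [dif_pos hex]
  rw [hrw]
  obtain ⟨r, hr⟩ := Option.isSome_iff_exists.1 (Nat.find_spec hex)
  have hle : ∀ j, Nat.find hex ≤ j → loopUpTo body j b s = some r := by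
    intro j hj
    induction j, hj using Nat.le_induction with
    | base => exact hr
    | succ j _ ih => exact mono _ _ _ _ ih
  have := hle k (Nat.find_min' hex (by rw [h1]; rfl))
  rw [hr, ← this, h1]

/-- The rule for traversals, with an invariant that knows the remaining list and the credits. -/
theorem runs_foldEach {f : β → α → Prog σ β} (I : List α → β → σ → ℕ → Prop)
    {Q : β → σ → ℕ → Prop} {l : List α} {b : β} {s : σ} {N : ℕ} (h : I l b s N)
    (hI : ∀ a l b s N, I (a :: l) b s N → 1 ≤ N ∧ Runs (f b a) s (N - 1) (I l))
    (hQ : ∀ b s N, I [] b s N → 1 ≤ N ∧ Q b s (N - 1)) :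
    Runs (foldEach f l b) s N Q := by
  induction l generalizing b s N with
  | nil =>
    obtain ⟨h1, h2⟩ := hQ _ _ _ h
    exact runs_write_bind h1 (runs_pure h2)
  | cons a l ih =>
    obtain ⟨h1, h2⟩ := hI _ _ _ _ _ h
    exact runs_write_bind h1 (runs_bind (h2.mono fun b' s' N' h' => ih h'))

/-- The rule for traversals with a potential `φ` and an amortized cost `cost a` for each list
cell. -/
theorem runs_foldEach_cost {f : β → α → Prog σ β} (J : List α → β → σ → Prop) (φ : σ → ℕ)
    (cost : α → ℕ) {Q : β → σ → ℕ → Prop} {l : List α} {b : β} {s : σ} {N : ℕ} (R : ℕ)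
    (h : J l b s) (hN : φ s + (l.map cost).sum + l.length + 1 + R ≤ N)
    (hJ : ∀ a l b s N R, J (a :: l) b s → φ s + cost a + R ≤ N →
      Runs (f b a) s N fun b' s' N' => J l b' s' ∧ φ s' + R ≤ N')
    (hQ : ∀ b s N, J [] b s → φ s + R ≤ N → Q b s N) :
    Runs (foldEach f l b) s N Q := by
  refine runs_foldEach
    (fun l b s N => J l b s ∧ φ s + (l.map cost).sum + l.length + 1 + R ≤ N) ⟨h, hN⟩ ?_ ?_
  · rintro a l b s N ⟨h, hN⟩
    simp only [List.map_cons, List.sum_cons, List.length_cons] at hN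
    -- While one cell is processed, the credits for the remaining cells are part of the untouched
    -- reserve.
    refine ⟨by omega, (hJ a l b s (N - 1) ((l.map cost).sum + l.length + 1 + R) h
      (by omega)).mono ?_⟩
    rintro b' s' N' ⟨h1, h2⟩
    exact ⟨h1, by omega⟩
  · rintro b s N ⟨h, hN⟩
    simp only [List.map_nil, List.sum_nil, List.length_nil] at hN
    exact ⟨by omega, hQ _ _ _ h (by omega)⟩

end Prog

/-! # Analysis of Fibonacci heaps -/

namespace FibHeap

open Prog

variable {n : ℕ}

/-- Every item of a list of children had at least as many children as there are items behind it
when it was linked, and `r` bounds that number. -/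
def ChildrenOK (r : Fin n → ℕ) : List (Fin n) → Prop
  | [] => True
  | c :: l => l.length ≤ r c ∧ ChildrenOK r l

theorem ChildrenOK.mono {r r' : Fin n → ℕ} {l : List (Fin n)} (h : ChildrenOK r l)
    (hr : ∀ c ∈ l, r c ≤ r' c) : ChildrenOK r' l := by
  induction l with
  | nil => trivial
  | cons c l ih =>
    exact ⟨h.1.trans (hr c (by simp)), ih h.2 fun d hd => hr d (by simp [hd])⟩

/-- Removing a child can only shorten the tails behind the others, so the bounds survive; this is
why they refer to the current list and not to the time of linking. -/
theorem ChildrenOK.erase {r : Fin n → ℕ} {l : List (Fin n)} (h : ChildrenOK r l) (v : Fin n) :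
    ChildrenOK r (l.erase v) := by
  induction l with
  | nil => trivial
  | cons c l ih =>
    rw [List.erase_cons]
    split_ifs
    · exact h.2
    · exact ⟨List.length_erase_le.trans h.1, ih h.2⟩

/-- A child with j siblings behind it has lost at most one of its at least j children, so it
contributes at least F(j+1), and F(j+3) = F(j+1) + F(j+2). The summand 1 stands for the parent
itself. -/
theorem ChildrenOK.fib_le {r k : Fin n → ℕ} {l : List (Fin n)} (h : ChildrenOK r l)
    (hr : ∀ c ∈ l, r c ≤ k c + 1) :
    Nat.fib (l.length + 2) ≤ 1 + (l.map fun c => Nat.fib (k c + 2)).sum := by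
  induction l with
  | nil => simp
  | cons c l ih =>
    have h1 := ih h.2 fun d hd => hr d (by simp [hd])
    have h2 : Nat.fib (l.length + 1) ≤ Nat.fib (k c + 2) := by
      apply Nat.fib_mono
      have := hr c (by simp)
      have := h.1
      omega
    have h3 : Nat.fib (l.length + 1 + 2) = Nat.fib (l.length + 1) + Nat.fib (l.length + 2) :=
      Nat.fib_add_two
    simp only [List.length_cons, List.map_cons, List.sum_cons]
    omega

/-- The number of children that an item has at least had when it was linked to its parent, counted
from behind; the item `x` has lost one child more. -/
def credit (h : FibHeap n) (x : Option (Fin n)) (c : Fin n) : ℕ :=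
  h.rank c + (if h.mark c then 1 else 0) + (if x = some c then 1 else 0)

/-- The items of the queue form a heap-ordered forest in which every non-root has lost at most one
child, except that `x` may have lost one more. -/
structure Forest (h : FibHeap n) (x : Option (Fin n)) : Prop where
  mem_children : ∀ v, h.mem v → ∀ u, u ∈ h.children v ↔ h.mem u ∧ h.parent u = some v
  mem_parent : ∀ u v, h.mem u → h.parent u = some v → h.mem v
  nodup : ∀ v, h.mem v → (h.children v).Nodup
  rank_eq : ∀ v, h.mem v → h.rank v = (h.children v).length
  mark_root : ∀ v, h.mem v → h.parent v = none → h.mark v = false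
  key_le : ∀ u v, h.mem u → h.parent u = some v → h.key v ≤ h.key u
  acyclic : ∃ lev : Fin n → ℕ, ∀ u v, h.mem u → h.parent u = some v → lev u < lev v
  childrenOK : ∀ v, h.mem v → ChildrenOK (h.credit x) (h.children v)

/-- The number of roots. -/
def numRoots (h : FibHeap n) : ℕ := (Finset.univ.filter fun v => h.mem v ∧ h.parent v = none).card

/-- The number of marked items. -/
def numMarked (h : FibHeap n) : ℕ := (Finset.univ.filter fun v => h.mem v ∧ h.mark v = true).card

/-- The number of items. -/
def size (h : FibHeap n) : ℕ := (Finset.univ.filter fun v => h.mem v = true).card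

/-- The potential, in credits. -/
def potential (h : FibHeap n) : ℕ := 12 * (h.numRoots + 2 * h.numMarked)

/-- The subtree below an item of rank r has at least F(r+2) items, by induction on the level: the
subtrees of the children are disjoint, and `ChildrenOK.fib_le` adds them up. The exception must be
`none`, so that each child has lost at most one child. -/
theorem Forest.fib_rank_le {h : FibHeap n} (hF : h.Forest none) {v : Fin n}
    (hv : h.mem v) : Nat.fib (h.rank v + 2) ≤ h.size := by
  classical
  obtain ⟨lev, hlev⟩ := hF.acyclic
  let r : Fin n → Fin n → Prop := fun u w => h.mem u ∧ h.parent u = some w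
  have runique : Relator.RightUnique r := by
    intro a b c hab hac
    exact Option.some_injective _ (hab.2.symm.trans hac.2)
  have rlev : ∀ u w, Relation.ReflTransGen r u w → lev u ≤ lev w := by
    intro u w huw
    induction huw with
    | refl => exact le_rfl
    | tail _ hbc ih => exact ih.trans (hlev _ _ hbc.1 hbc.2).le
  have rmem : ∀ u w, Relation.ReflTransGen r u w → h.mem w → h.mem u := by
    intro u w huw hw
    rcases Relation.ReflTransGen.cases_head huw with h1 | ⟨c, h1, _⟩
    · rwa [h1]
    · exact h1.1
  let desc : Fin n → Finset (Fin n) :=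
    fun w => Finset.univ.filter fun u => Relation.ReflTransGen r u w
  have key : ∀ k v, lev v = k → h.mem v → Nat.fib (h.rank v + 2) ≤ (desc v).card := by
    intro k
    induction k using Nat.strong_induction_on with
    | _ k ih =>
      intro v hvk hv
      have hsub : Insert.insert v ((h.children v).toFinset.biUnion desc) ⊆ desc v := by
        intro u hu
        simp only [Finset.mem_insert, Finset.mem_biUnion, List.mem_toFinset, desc,
          Finset.mem_filter, Finset.mem_univ, true_and] at hu ⊢
        rcases hu with rfl | ⟨c, hc, hu⟩
        · exact Relation.ReflTransGen.refl
        · exact hu.tail ((hF.mem_children v hv c).1 hc)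
      have hnot : v ∉ (h.children v).toFinset.biUnion desc := by
        simp only [Finset.mem_biUnion, List.mem_toFinset, desc, Finset.mem_filter,
          Finset.mem_univ, true_and, not_exists, not_and]
        intro c hc hvc
        have h1 := (hF.mem_children v hv c).1 hc
        have h2 := hlev _ _ h1.1 h1.2
        have h3 := rlev _ _ hvc
        omega
      -- Siblings are not descendants of each other: the only way up from `c` leads to `v`, whose
      -- level already exceeds that of `d`.
      have aux : ∀ c ∈ h.children v, ∀ d ∈ h.children v, c ≠ d →
          ¬ Relation.ReflTransGen r c d := by
        intro c hc d hd hcd hrcd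
        rcases Relation.ReflTransGen.cases_head hrcd with h1 | ⟨w, h1, h2⟩
        · exact hcd h1
        · have h3 := (hF.mem_children v hv c).1 hc
          have h4 : w = v := runique h1 h3
          have h5 := (hF.mem_children v hv d).1 hd
          have h6 := hlev _ _ h5.1 h5.2
          have h7 := rlev _ _ h2
          rw [h4] at h7
          omega
      have hdisj : Set.PairwiseDisjoint (↑(h.children v).toFinset) desc := by
        intro c hc d hd hcd
        simp only [List.coe_toFinset, Set.mem_ofPred_eq] at hc hd
        refine Finset.disjoint_left.2 fun u hu hu' => ?_
        simp only [desc, Finset.mem_filter, Finset.mem_univ, true_and] at hu hu'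
        rcases Relation.ReflTransGen.total_of_right_unique runique hu hu' with h1 | h1
        · exact aux c hc d hd hcd h1
        · exact aux d hd c hc hcd.symm h1
      have h1 := Finset.card_le_card hsub
      rw [Finset.card_insert_of_notMem hnot, Finset.card_biUnion hdisj,
        List.sum_toFinset _ (hF.nodup v hv)] at h1
      have h2 : ((h.children v).map fun c => Nat.fib (h.rank c + 2)).sum ≤
          ((h.children v).map fun c => (desc c).card).sum := by
        apply List.sum_le_sum
        intro c hc
        have h3 := (hF.mem_children v hv c).1 hc
        exact ih _ (hvk ▸ hlev _ _ h3.1 h3.2) c rfl h3.1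
      have h3 := (hF.childrenOK v hv).fib_le (k := h.rank) (by
        intro c _
        unfold credit
        split_ifs <;> simp_all)
      rw [← hF.rank_eq v hv] at h3
      omega
  refine (key _ v rfl hv).trans (Finset.card_le_card ?_)
  intro u hu
  simp only [desc, Finset.mem_filter, Finset.mem_univ, true_and] at hu ⊢
  exact rmem _ _ hu hv

/-- Two steps of the Fibonacci recursion at least double the value, which suffices for a logarithmic
rank bound without the golden ratio. -/
theorem two_pow_le_fib (k : ℕ) : 2 ^ (k / 2) ≤ Nat.fib (k + 2) := by
  induction k using Nat.strong_induction_on with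
  | _ k ih =>
    rcases k with _ | _ | k
    · simp
    · simp [Nat.fib]
    · have h1 := ih k (by omega)
      have h2 : (k + 1 + 1) / 2 = k / 2 + 1 := by omega
      have h3 : Nat.fib (k + 1 + 1 + 2) = Nat.fib (k + 2) + Nat.fib (k + 3) := Nat.fib_add_two
      have h4 : Nat.fib (k + 2) ≤ Nat.fib (k + 3) := Nat.fib_mono (by omega)
      rw [h2, pow_succ]
      omega

theorem Forest.rank_le {h : FibHeap n} (hF : h.Forest none) {v : Fin n}
    (hv : h.mem v) : h.rank v ≤ 2 * Nat.log 2 h.size + 1 := by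
  have h1 := (two_pow_le_fib (h.rank v)).trans (hF.fib_rank_le hv)
  have h2 := Nat.log_mono_right (b := 2) h1
  rw [Nat.log_pow (by norm_num)] at h2
  omega

/-- Climbing to the parent never increases the key and strictly increases the level, which is
bounded. Thus a minimum among the roots is a minimum of the queue. -/
theorem Forest.exists_root_le {h : FibHeap n} {x : Option (Fin n)} (hF : h.Forest x) {v : Fin n}
    (hv : h.mem v) : ∃ r, h.mem r ∧ h.parent r = none ∧ h.key r ≤ h.key v := by
  obtain ⟨lev, hlev⟩ := hF.acyclic
  have hB : ∀ u, lev u ≤ Finset.univ.sup lev := fun u => Finset.le_sup (Finset.mem_univ u)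
  generalize Finset.univ.sup lev = B at hB
  have key : ∀ k v, B - lev v = k → h.mem v →
      ∃ r, h.mem r ∧ h.parent r = none ∧ h.key r ≤ h.key v := by
    intro k
    induction k using Nat.strong_induction_on with
    | _ k ih =>
      intro v hk hv
      cases hp : h.parent v with
      | none => exact ⟨v, hv, hp, le_rfl⟩
      | some p =>
        have h1 := hlev v p hv hp
        have h2 := hB p
        obtain ⟨r, h3, h4, h5⟩ := ih (B - lev p) (by omega) p rfl (hF.mem_parent v p hv hp)
        exact ⟨r, h3, h4, h5.trans (hF.key_le v p hv hp)⟩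
  exact key _ v rfl hv

/-- The items of the queue form a consistent Fibonacci heap. -/
structure Inv (h : FibHeap n) : Prop where
  forest : h.Forest none
  roots_nodup : h.roots.Nodup
  mem_roots : ∀ v, v ∈ h.roots ↔ h.mem v ∧ h.parent v = none
  minRoot_none : h.minRoot = none → ∀ v, h.mem v = false
  minRoot_some : ∀ u, h.minRoot = some u → u ∈ h.roots ∧ ∀ v, h.mem v → h.key u ≤ h.key v
  slot_none : ∀ i, h.slot i = none

theorem Clean.inv {h : FibHeap n} (hc : h.Clean) : h.Inv := by
  obtain ⟨h1, h2, h3, h4⟩ := hc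
  refine ⟨⟨?_, ?_, ?_, ?_, ?_, ?_, ⟨fun _ => 0, ?_⟩, ?_⟩, ?_, ?_, ?_, ?_, h4⟩ <;> simp [h1, h2, h3]

theorem Clean.potential_eq {h : FibHeap n} (hc : h.Clean) : h.potential = 0 := by
  simp [potential, numRoots, numMarked, hc.2.2.1]

theorem Inv.clean {h : FibHeap n} (hI : h.Inv) (hm : ∀ v, h.mem v = false) : h.Clean := by
  have hr : h.roots = [] := List.eq_nil_iff_forall_not_mem.2 fun v hv => by
    have := ((hI.mem_roots v).1 hv).1
    simp [hm] at this
  refine ⟨hr, ?_, hm, hI.slot_none⟩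
  cases hu : h.minRoot with
  | none => rfl
  | some u =>
    have := (hI.minRoot_some u hu).1
    simp [hr] at this

end FibHeap

/-! ### Insertion and decreasing a key -/

namespace FibHeap

open Prog

variable {n : ℕ}

/-- The memory after `updateMin v`. -/
noncomputable def afterUpdateMin (h : FibHeap n) (v : Fin n) : FibHeap n :=
  { h with minRoot :=
      match h.minRoot with
      | none => some v
      | some u => if h.key v < h.key u then some v else some u }

theorem updateMin_eq (v : Fin n) : updateMin v = write fun h => h.afterUpdateMin v := by
  unfold updateMin
  congr 1
  funext h
  unfold afterUpdateMin
  obtain ⟨roots, minRoot, mem, key, parent, children, rank, mark, slot⟩ := h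
  cases minRoot
  · rfl
  · dsimp only
    split_ifs <;> rfl

/-- The recorded minimum need only be right for the items other than `v`, which covers a new item
and a lowered key alike. A non-root `v` is allowed if the recorded minimum is no larger, because
then the comparison changes nothing. -/
theorem inv_afterUpdateMin {h : FibHeap n} {v : Fin n} (hF : h.Forest none)
    (hnd : h.roots.Nodup) (hroots : ∀ w, w ∈ h.roots ↔ h.mem w ∧ h.parent w = none)
    (hslot : ∀ i, h.slot i = none)
    (hsome : ∀ u, h.minRoot = some u → u ∈ h.roots ∧ ∀ w, h.mem w → w ≠ v → h.key u ≤ h.key w)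
    (hnone : h.minRoot = none → ∀ w, h.mem w → w = v)
    (hv : v ∈ h.roots ∨ ∃ u, h.minRoot = some u ∧ h.key u ≤ h.key v) :
    (h.afterUpdateMin v).Inv := by
  refine ⟨⟨hF.1, hF.2, hF.3, hF.4, hF.5, hF.6, hF.7, hF.8⟩, hnd, hroots, ?_, ?_, hslot⟩
  · intro h1
    simp only [afterUpdateMin] at h1
    split at h1
    · cases h1
    · split_ifs at h1
  · intro u h1
    simp only [afterUpdateMin] at h1 ⊢
    cases hm : h.minRoot with
    | none =>
      simp only [hm, Option.some.injEq] at h1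
      subst h1
      refine ⟨hv.resolve_right (by simp [hm]), fun w hw => ?_⟩
      rw [hnone hm w hw]
    | some u' =>
      simp only [hm] at h1
      obtain ⟨h2, h3⟩ := hsome u' hm
      split_ifs at h1 with h4
      · rw [Option.some.injEq] at h1
        subst h1
        refine ⟨hv.resolve_right ?_, fun w hw => ?_⟩
        · rintro ⟨u, h5, h6⟩
          rw [hm, Option.some.injEq] at h5
          subst h5
          exact absurd h4 (not_lt.2 h6)
        · by_cases hwv : w = v
          · rw [hwv]
          · exact h4.le.trans (h3 w hw hwv)
      · rw [Option.some.injEq] at h1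
        subst h1
        refine ⟨h2, fun w hw => ?_⟩
        by_cases hwv : w = v
        · rw [hwv]; exact not_lt.1 h4
        · exact h3 w hw hwv

/-- The memory after the first step of `insert v k`. -/
noncomputable def addRoot (h : FibHeap n) (v : Fin n) (k : ℝ≥0∞) : FibHeap n :=
  { h with
    roots := v :: h.roots
    mem := Function.update h.mem v true
    key := Function.update h.key v k
    parent := Function.update h.parent v none
    children := Function.update h.children v []
    rank := Function.update h.rank v 0
    mark := Function.update h.mark v false }

theorem Forest.addRoot {h : FibHeap n} (hF : h.Forest none) {v : Fin n} (hv : h.mem v = false)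
    (k : ℝ≥0∞) : (h.addRoot v k).Forest none := by
  have hne : ∀ u, h.mem u → u ≠ v := by rintro u hu rfl; simp [hv] at hu
  have hpar : ∀ u w, h.mem u → h.parent u = some w → w ≠ v := fun u w hu huw =>
    hne w (hF.mem_parent u w hu huw)
  obtain ⟨lev, hlev⟩ := hF.acyclic
  constructor
  · intro w hw u
    by_cases hwv : w = v
    · subst hwv
      simp only [FibHeap.addRoot, Function.update_self, List.not_mem_nil, false_iff, not_and]
      intro hu
      by_cases huv : u = w
      · simp [huv]
      · simp only [Function.update_of_ne huv] at hu ⊢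
        exact fun h1 => hpar u w hu h1 rfl
    · simp only [FibHeap.addRoot, Function.update_of_ne hwv] at hw ⊢
      rw [hF.mem_children w hw u]
      by_cases huv : u = v
      · simp [huv, hv]
      · simp [Function.update_of_ne huv]
  · intro u w hu huw
    by_cases huv : u = v
    · simp [FibHeap.addRoot, huv] at huw
    · simp only [FibHeap.addRoot, Function.update_of_ne huv] at hu huw ⊢
      rw [Function.update_of_ne (hpar u w hu huw)]
      exact hF.mem_parent u w hu huw
  · intro w hw
    by_cases hwv : w = v
    · simp [FibHeap.addRoot, hwv]
    · simp only [FibHeap.addRoot, Function.update_of_ne hwv] at hw ⊢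
      exact hF.nodup w hw
  · intro w hw
    by_cases hwv : w = v
    · simp [FibHeap.addRoot, hwv]
    · simp only [FibHeap.addRoot, Function.update_of_ne hwv] at hw ⊢
      exact hF.rank_eq w hw
  · intro w hw hp
    by_cases hwv : w = v
    · simp [FibHeap.addRoot, hwv]
    · simp only [FibHeap.addRoot, Function.update_of_ne hwv] at hw hp ⊢
      exact hF.mark_root w hw hp
  · intro u w hu huw
    by_cases huv : u = v
    · simp [FibHeap.addRoot, huv] at huw
    · simp only [FibHeap.addRoot, Function.update_of_ne huv] at hu huw ⊢
      rw [Function.update_of_ne (hpar u w hu huw)]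
      exact hF.key_le u w hu huw
  · refine ⟨lev, fun u w hu huw => ?_⟩
    by_cases huv : u = v
    · simp [FibHeap.addRoot, huv] at huw
    · simp only [FibHeap.addRoot, Function.update_of_ne huv] at hu huw ⊢
      exact hlev u w hu huw
  · intro w hw
    by_cases hwv : w = v
    · simp [FibHeap.addRoot, hwv, ChildrenOK]
    · simp only [FibHeap.addRoot, Function.update_of_ne hwv] at hw ⊢
      refine (hF.childrenOK w hw).mono fun c hc => ?_
      have := hne c ((hF.mem_children w hw c).1 hc).1
      simp [credit, Function.update_of_ne this]

theorem card_filter_le_succ {p q : Fin n → Prop} [DecidablePred p] [DecidablePred q] (v : Fin n)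
    (h : ∀ u, q u → u = v ∨ p u) :
    (Finset.univ.filter q).card ≤ (Finset.univ.filter p).card + 1 := by
  classical
  refine (Finset.card_le_card (t := Insert.insert v (Finset.univ.filter p)) fun u hu => ?_).trans
    (Finset.card_insert_le _ _)
  simpa using h u (by simpa using hu)

theorem card_filter_le {p q : Fin n → Prop} [DecidablePred p] [DecidablePred q]
    (h : ∀ u, q u → p u) : (Finset.univ.filter q).card ≤ (Finset.univ.filter p).card :=
  Finset.card_le_card fun u hu => by simpa using h u (by simpa using hu)

theorem card_filter_lt {p q : Fin n → Prop} [DecidablePred p] [DecidablePred q]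
    (h : ∀ u, q u → p u) {v : Fin n} (hv : p v) (hv' : ¬ q v) :
    (Finset.univ.filter q).card < (Finset.univ.filter p).card :=
  Finset.card_lt_card ((Finset.ssubset_iff_of_subset fun u hu => by
    simpa using h u (by simpa using hu)).2 ⟨v, by simpa using hv, by simpa using hv'⟩)

theorem potential_addRoot_le (h : FibHeap n) (v : Fin n) (k : ℝ≥0∞) :
    (h.addRoot v k).potential ≤ h.potential + 12 := by
  have h1 : (h.addRoot v k).numRoots ≤ h.numRoots + 1 := by
    refine card_filter_le_succ v fun u hu => ?_
    by_cases huv : u = v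
    · exact Or.inl huv
    · simpa [addRoot, Function.update_of_ne huv, huv] using hu
  have h2 : (h.addRoot v k).numMarked ≤ h.numMarked := by
    refine card_filter_le fun u hu => ?_
    by_cases huv : u = v
    · simp [addRoot, huv] at hu
    · simpa [addRoot, Function.update_of_ne huv, huv] using hu
  unfold potential
  omega

theorem runs_insert {h : FibHeap n} (hI : h.Inv) {v : Fin n} (hv : h.mem v = false) (k : ℝ≥0∞)
    {N R : ℕ} (hN : h.potential + 14 + R ≤ N) :
    Runs (insert v k) h N fun _ h' N' => h'.Inv ∧ h'.mem = Function.update h.mem v true ∧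
      h'.key = Function.update h.key v k ∧ h'.potential + R ≤ N' := by
  have hne : ∀ u, h.mem u → u ≠ v := by rintro u hu rfl; simp [hv] at hu
  have hp := potential_addRoot_le h v k
  unfold insert
  refine runs_write_bind (by omega) ?_
  rw [updateMin_eq]
  refine runs_write (by omega) ⟨?_, rfl, rfl, ?_⟩
  · refine inv_afterUpdateMin (h := h.addRoot v k) (hI.forest.addRoot hv k) ?_ ?_ hI.slot_none
      ?_ ?_ ?_
    · refine List.nodup_cons.2 ⟨fun h1 => ?_, hI.roots_nodup⟩
      exact hne v ((hI.mem_roots v).1 h1).1 rfl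
    · intro w
      by_cases hwv : w = v
      · simp [addRoot, hwv]
      · simp [addRoot, hwv, hI.mem_roots]
    · intro u hu
      obtain ⟨h1, h2⟩ := hI.minRoot_some u hu
      refine ⟨List.mem_cons_of_mem _ h1, fun w hw hwv => ?_⟩
      have h3 := hne u ((hI.mem_roots u).1 h1).1
      simp only [addRoot, Function.update_of_ne hwv, Function.update_of_ne h3] at hw ⊢
      exact h2 w hw
    · intro h1 w hw
      by_contra hwv
      simp only [addRoot, Function.update_of_ne hwv] at hw
      simp [hI.minRoot_none h1] at hw
    · exact Or.inl (by simp [addRoot])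
  · change (h.addRoot v k).potential + R ≤ _
    omega

/-- The memory after `cut v p`. -/
def afterCut (h : FibHeap n) (v p : Fin n) : FibHeap n :=
  { h with
    roots := v :: h.roots
    parent := Function.update h.parent v none
    children := Function.update h.children p ((h.children p).erase v)
    rank := Function.update h.rank p (h.rank p - 1)
    mark := Function.update h.mark v false }

theorem Forest.ne_parent {h : FibHeap n} {x : Option (Fin n)} (hF : h.Forest x) {v p : Fin n}
    (hv : h.mem v) (hp : h.parent v = some p) : v ≠ p := by
  obtain ⟨lev, hlev⟩ := hF.acyclic
  rintro rfl
  exact lt_irrefl _ (hlev v v hv hp)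

/-- The exception moves up: `p` loses a child, and becoming the exception compensates its credit. A
previous exception at `v` is void, since a root occurs in no list of children. -/
theorem Forest.afterCut {h : FibHeap n} {v p : Fin n} {x : Option (Fin n)}
    (hx : x = none ∨ x = some v) (hF : h.Forest x) (hv : h.mem v) (hp : h.parent v = some p) :
    (h.afterCut v p).Forest (some p) := by
  obtain ⟨lev, hlev⟩ := hF.acyclic
  have hpm := hF.mem_parent v p hv hp
  have hvp := hF.ne_parent hv hp
  have hvc : v ∈ h.children p := (hF.mem_children p hpm v).2 ⟨hv, hp⟩
  have hch : ∀ w, h.mem w → ∀ u, u ∈ (h.afterCut v p).children w ↔ u ∈ h.children w ∧ u ≠ v := by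
    intro w hw u
    by_cases hwp : w = p
    · subst hwp
      simp only [FibHeap.afterCut, Function.update_self]
      rw [(hF.nodup w hw).mem_erase_iff, and_comm]
    · simp only [FibHeap.afterCut, Function.update_of_ne hwp]
      refine ⟨fun h1 => ⟨h1, ?_⟩, fun h1 => h1.1⟩
      rintro rfl
      have h2 := ((hF.mem_children w hw u).1 h1).2
      rw [hp, Option.some.injEq] at h2
      exact hwp h2.symm
  have hpar : ∀ u w, (h.afterCut v p).parent u = some w ↔ h.parent u = some w ∧ u ≠ v := by
    intro u w
    by_cases huv : u = v
    · simp [FibHeap.afterCut, huv]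
    · simp [FibHeap.afterCut, huv]
  have hrank : ∀ w, h.mem w → (h.afterCut v p).rank w = ((h.afterCut v p).children w).length := by
    intro w hw
    by_cases hwp : w = p
    · subst hwp
      simp only [FibHeap.afterCut, Function.update_self]
      rw [List.length_erase_of_mem hvc, hF.rank_eq w hw]
    · simp only [FibHeap.afterCut, Function.update_of_ne hwp]
      exact hF.rank_eq w hw
  constructor
  · intro w hw u
    rw [hch w hw, hF.mem_children w hw, hpar, and_assoc]
    rfl
  · intro u w hu huw
    exact hF.mem_parent u w hu ((hpar u w).1 huw).1
  · intro w hw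
    by_cases hwp : w = p
    · subst hwp
      simp only [FibHeap.afterCut, Function.update_self]
      exact (hF.nodup w hw).erase v
    · simp only [FibHeap.afterCut, Function.update_of_ne hwp]
      exact hF.nodup w hw
  · exact hrank
  · intro w hw hwn
    by_cases hwv : w = v
    · simp [FibHeap.afterCut, hwv]
    · simp only [FibHeap.afterCut, Function.update_of_ne hwv] at hw hwn ⊢
      exact hF.mark_root w hw hwn
  · intro u w hu huw
    exact hF.key_le u w hu ((hpar u w).1 huw).1
  · exact ⟨lev, fun u w hu huw => hlev u w hu ((hpar u w).1 huw).1⟩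
  · intro w hw
    have h1 : ChildrenOK (h.credit x) ((h.afterCut v p).children w) := by
      by_cases hwp : w = p
      · subst hwp
        simp only [FibHeap.afterCut, Function.update_self]
        exact (hF.childrenOK w hw).erase v
      · simp only [FibHeap.afterCut, Function.update_of_ne hwp]
        exact hF.childrenOK w hw
    refine h1.mono fun c hc => ?_
    have hcv : c ≠ v := ((hch w hw c).1 hc).2
    have hxc : x ≠ some c := by
      rcases hx with rfl | rfl
      · simp
      · simpa using hcv.symm
    by_cases hcp : c = p
    · subst hcp
      simp only [credit, if_neg hxc, FibHeap.afterCut, Function.update_of_ne hcv,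
        Function.update_self, if_true]
      omega
    · have : some p ≠ some c := by simpa using Ne.symm hcp
      simp only [credit, if_neg hxc, FibHeap.afterCut, Function.update_of_ne hcv,
        Function.update_of_ne hcp, if_neg this]
      exact le_rfl

theorem numRoots_afterCut_le (h : FibHeap n) (v p : Fin n) :
    (h.afterCut v p).numRoots ≤ h.numRoots + 1 := by
  refine card_filter_le_succ v fun u hu => ?_
  by_cases huv : u = v
  · exact Or.inl huv
  · simpa [afterCut, Function.update_of_ne huv, huv] using hu

theorem numMarked_afterCut_le (h : FibHeap n) (v p : Fin n) :
    (h.afterCut v p).numMarked ≤ h.numMarked := by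
  refine card_filter_le fun u hu => ?_
  by_cases huv : u = v
  · simp [afterCut, huv] at hu
  · simpa [afterCut, Function.update_of_ne huv, huv] using hu

theorem numMarked_afterCut_lt (h : FibHeap n) {v : Fin n} (p : Fin n) (hv : h.mem v)
    (hm : h.mark v = true) : (h.afterCut v p).numMarked < h.numMarked := by
  refine card_filter_lt (fun u hu => ?_) (v := v) ⟨hv, hm⟩ (by simp [afterCut])
  by_cases huv : u = v
  · simp [afterCut, huv] at hu
  · simpa [afterCut, Function.update_of_ne huv, huv] using hu

/-- What `decreaseKey` preserves before it updates the minimum. -/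
structure Frame (h h' : FibHeap n) : Prop where
  mem : h'.mem = h.mem
  key : h'.key = h.key
  minRoot : h'.minRoot = h.minRoot
  slot : h'.slot = h.slot
  roots : ∀ v ∈ h.roots, v ∈ h'.roots
  nodup : h'.roots.Nodup
  mem_roots : ∀ w, w ∈ h'.roots ↔ h'.mem w ∧ h'.parent w = none

theorem Frame.afterCut {h h' : FibHeap n} (hf : Frame h h') {v p : Fin n} (hv : h'.mem v)
    (hp : h'.parent v = some p) : Frame h (h'.afterCut v p) := by
  refine ⟨hf.mem, hf.key, hf.minRoot, hf.slot,
    fun w hw => List.mem_cons_of_mem _ (hf.roots w hw), List.nodup_cons.2 ⟨?_, hf.nodup⟩, ?_⟩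
  · intro h1
    simp [((hf.mem_roots v).1 h1).2] at hp
  · intro w
    by_cases hwv : w = v
    · simpa [FibHeap.afterCut, hwv] using hv
    · simp [FibHeap.afterCut, hwv, hf.mem_roots]

/-- Credits are only required of items in lists of children, so an exception at a root can be
forgotten. -/
theorem Forest.drop {h : FibHeap n} {p : Fin n} (hF : h.Forest (some p))
    (hp : h.parent p = none) : h.Forest none := by
  refine ⟨hF.1, hF.2, hF.3, hF.4, hF.5, hF.6, hF.7, fun w hw => ?_⟩
  refine (hF.childrenOK w hw).mono fun c hc => ?_
  have : some p ≠ some c := by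
    rintro h1
    rw [Option.some.injEq] at h1
    subst h1
    simp [((hF.mem_children w hw p).1 hc).2] at hp
  simp only [credit, if_neg this, reduceCtorEq, if_false]
  exact le_rfl

/-- The unit of credit that the exception granted to `p` is now granted by its mark. -/
theorem Forest.markItem {h : FibHeap n} {p g : Fin n} (hF : h.Forest (some p))
    (hp : h.parent p = some g) (hm : h.mark p = false) :
    ({ h with mark := Function.update h.mark p true } : FibHeap n).Forest none := by
  refine ⟨hF.1, hF.2, hF.3, hF.4, fun w hw hwn => ?_, hF.6, hF.7, fun w hw => ?_⟩
  · have hwp : w ≠ p := by rintro rfl; simp [hp] at hwn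
    simp only [Function.update_of_ne hwp]
    exact hF.mark_root w hw hwn
  · refine (hF.childrenOK w hw).mono fun c _ => ?_
    by_cases hcp : c = p
    · simp [credit, hcp, hm]
    · have : some p ≠ some c := by simpa using Ne.symm hcp
      simp only [credit, Function.update_of_ne hcp, if_neg this, reduceCtorEq, if_false]
      exact le_rfl

/-- A cascading cut creates one root and removes one mark, which releases 12 credits and pays for
the 4 steps of its round. The final marking raises the potential by at most 24; this and the last
round are covered by the 40 credits. -/
theorem runs_cascade {h₀ h : FibHeap n} {p : Fin n} (hF : h.Forest (some p)) (hf : Frame h₀ h)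
    (hp : h.mem p) {N R : ℕ} (hN : h.potential + 40 + R ≤ N) :
    Runs (cascade p) h N fun _ h' N' => h'.Forest none ∧ Frame h₀ h' ∧ h'.potential + R ≤ N' := by
  unfold cascade
  refine runs_repeatUntilNone (fun p h N => h.Forest (some p) ∧ Frame h₀ h ∧ h.mem p ∧
    h.potential + 40 + R ≤ N) ?_ ⟨hF, hf, hp, hN⟩
  clear hN hp hf hF N p h
  rintro p h N ⟨hF, hf, hp, hN⟩
  refine ⟨by omega, runs_read_bind (by omega) ?_⟩
  cases hg : h.parent p with
  | none =>
    exact runs_pure ⟨hF.drop hg, hf, by omega⟩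
  | some g =>
    refine runs_read_bind (by omega) ?_
    cases hm : h.mark p with
    | true =>
      refine runs_write_bind (by omega) (runs_pure ⟨hF.afterCut (Or.inr rfl) hp hg,
        hf.afterCut hp hg, hF.mem_parent p g hp hg, ?_⟩)
      have h1 := numRoots_afterCut_le h p g
      have h2 := numMarked_afterCut_lt h g hp hm
      change (h.afterCut p g).potential + 40 + R ≤ _
      unfold potential at hN ⊢
      omega
    | false =>
      refine runs_write_bind (by omega) (runs_pure ⟨hF.markItem hg hm, ?_, ?_⟩)
      · exact ⟨hf.1, hf.2, hf.3, hf.4, hf.5, hf.6, hf.7⟩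
      · have h1 : ({ h with mark := Function.update h.mark p true } : FibHeap n).numMarked ≤
            h.numMarked + 1 := by
          refine card_filter_le_succ p fun u hu => ?_
          by_cases huv : u = p
          · exact Or.inl huv
          · simpa [Function.update_of_ne huv, huv] using hu
        have h2 : ({ h with mark := Function.update h.mark p true } : FibHeap n).numRoots =
            h.numRoots := rfl
        unfold potential at hN ⊢
        omega

theorem runs_decreaseKey {h : FibHeap n} (hI : h.Inv) {v : Fin n} (hv : h.mem v) {k : ℝ≥0∞}
    (hk : k ≤ h.key v) {N R : ℕ} (hN : h.potential + 80 + R ≤ N) :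
    Runs (decreaseKey v k) h N fun _ h' N' => h'.Inv ∧ h'.mem = h.mem ∧
      h'.key = Function.update h.key v k ∧ h'.potential + R ≤ N' := by
  let h₁ : FibHeap n := { h with key := Function.update h.key v k }
  have hkey : ∀ u, h₁.key u ≤ h.key u := by
    intro u
    by_cases huv : u = v
    · simpa [h₁, huv] using hk
    · simp [h₁, Function.update_of_ne huv]
  have hf : Frame h₁ h₁ := ⟨rfl, rfl, rfl, rfl, fun _ h => h, hI.roots_nodup, hI.mem_roots⟩
  -- Either `v` is a root at the end, or it stays below an item of no larger key, and then it cannot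
  -- beat the recorded minimum.
  have finish : ∀ (h' : FibHeap n) (N : ℕ), h'.Forest none → Frame h₁ h' →
      (v ∈ h'.roots ∨ ∃ p, p ≠ v ∧ h₁.mem p ∧ h₁.key p ≤ h₁.key v) → h'.potential + 1 + R ≤ N →
      Runs (updateMin v) h' N fun _ h' N' => h'.Inv ∧ h'.mem = h.mem ∧
        h'.key = Function.update h.key v k ∧ h'.potential + R ≤ N' := by
    intro h' N hF hf hor hN
    rw [updateMin_eq]
    refine runs_write (by omega) ⟨?_, hf.mem, hf.key, ?_⟩
    · have hmin : ∀ u, h.minRoot = some u → u ∈ h.roots ∧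
          ∀ w, h.mem w → w ≠ v → h₁.key u ≤ h₁.key w := by
        intro u hu
        obtain ⟨h1, h2⟩ := hI.minRoot_some u hu
        refine ⟨h1, fun w hw hwv => (hkey u).trans ((h2 w hw).trans ?_)⟩
        simp [h₁, Function.update_of_ne hwv]
      have hnn : h.minRoot ≠ none := by
        intro h1
        simp [hI.minRoot_none h1] at hv
      refine inv_afterUpdateMin hF hf.nodup hf.mem_roots ?_ ?_ ?_ ?_
      · rw [hf.slot]; exact hI.slot_none
      · rw [hf.minRoot, hf.mem, hf.key]
        intro u hu
        exact ⟨hf.roots u (hmin u hu).1, (hmin u hu).2⟩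
      · rw [hf.minRoot]
        exact fun h1 => absurd h1 hnn
      · refine hor.imp id ?_
        rintro ⟨p, h1, h2, h3⟩
        obtain ⟨u, hu⟩ := Option.ne_none_iff_exists'.1 hnn
        refine ⟨u, hf.minRoot.trans hu, ?_⟩
        rw [hf.key]
        exact ((hmin u hu).2 p h2 h1).trans h3
    · change h'.potential + R ≤ _
      omega
  have hF₁ : (∀ p, h.parent v = some p → h₁.key p ≤ k) → h₁.Forest none := by
    intro hpk
    have hF := hI.forest
    refine ⟨hF.1, hF.2, hF.3, hF.4, hF.5, fun u w hu huw => ?_, hF.7, hF.8⟩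
    by_cases huv : u = v
    · subst huv
      simpa [h₁] using hpk w huw
    · refine (hkey w).trans ((hF.key_le u w hu huw).trans ?_)
      simp [h₁, Function.update_of_ne huv]
  have hpot : h₁.potential = h.potential := rfl
  unfold decreaseKey
  refine runs_write_bind (by omega) (runs_read_bind (by omega) ?_)
  change Runs (match h.parent v with | none => _ | some p => _) h₁ _ _
  cases hp : h.parent v with
  | none =>
    exact finish _ _ (hF₁ (by simp [hp])) hf
      (Or.inl ((hI.mem_roots v).2 ⟨hv, hp⟩)) (by omega)
  | some p =>
    have hpm := hI.forest.mem_parent v p hv hp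
    have hvp := hI.forest.ne_parent hv hp
    refine runs_read_bind (by omega) ?_
    by_cases hviol : k < h₁.key p
    · rw [if_pos (by simpa using hviol)]
      -- With the new key the uncut forest violates the heap order. So the cut is analysed with the
      -- old keys; once `v` is a root, lowering its key is harmless.
      have hcut : (h₁.afterCut v p).Forest (some p) := by
        have hF' := hI.forest.afterCut (Or.inl rfl) hv hp
        refine ⟨hF'.1, hF'.2, hF'.3, hF'.4, hF'.5, fun u w hu huw => ?_, hF'.7, hF'.8⟩
        have huv : u ≠ v := by
          rintro rfl
          simp [afterCut] at huw
        refine (hkey w).trans ((hF'.key_le u w hu huw).trans ?_)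
        simp [h₁, afterCut, Function.update_of_ne huv]
      have h1 := numRoots_afterCut_le h₁ v p
      have h2 := numMarked_afterCut_le h₁ v p
      have h3 : (h₁.afterCut v p).potential ≤ h₁.potential + 12 := by
        unfold potential
        omega
      refine runs_write_bind (by omega) (runs_bind ?_)
      have hf₂ := Frame.afterCut hf hv hp
      refine (runs_cascade (R := 1 + R) hcut (h₀ := h₁.afterCut v p)
        ⟨rfl, rfl, rfl, rfl, fun _ h => h, hf₂.nodup, hf₂.mem_roots⟩ hpm (by omega)).mono ?_
      rintro _ h' N' ⟨hF', hf', hN'⟩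
      exact finish h' N' hF' ⟨hf'.1, hf'.2, hf'.3, hf'.4,
        fun w hw => hf'.5 w (List.mem_cons_of_mem _ hw), hf'.6, hf'.7⟩
        (Or.inl (hf'.5 v (by simp [afterCut]))) (by omega)
    · rw [if_neg (by simpa using hviol)]
      refine finish _ _ (hF₁ ?_) hf (Or.inr ⟨p, hvp.symm, hpm, ?_⟩) (by omega)
      · intro p' hp'
        rw [hp, Option.some.injEq] at hp'
        subst hp'
        exact not_lt.1 hviol
      · simpa [h₁] using hviol

end FibHeap

/-! ### Consolidation and extraction of the minimum -/

namespace FibHeap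

open Prog

variable {n : ℕ}

/-- The memory after the root `los` has become a child of the root `win`. -/
def afterLink (h : FibHeap n) (win los : Fin n) : FibHeap n :=
  { h with
    parent := Function.update h.parent los (some win)
    children := Function.update h.children win (los :: h.children win)
    rank := Function.update h.rank win (h.rank win + 1)
    mark := Function.update h.mark los false }

theorem runs_link {h : FibHeap n} (x y : Fin n) {N : ℕ} {Q : Fin n → FibHeap n → ℕ → Prop}
    (hN : 1 ≤ N) (hxy : h.key x ≤ h.key y → Q x (h.afterLink x y) (N - 1))
    (hyx : h.key y ≤ h.key x → Q y (h.afterLink y x) (N - 1)) : Runs (link x y) h N Q := by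
  unfold link
  refine runs_step hN ?_
  by_cases hlt : h.key y < h.key x
  · simp only [if_pos hlt]
    exact hyx hlt.le
  · simp only [if_neg hlt]
    exact hxy (not_lt.1 hlt)

/-- Equality of the ranks is what gives the new child its credit: its rank is the number of the
children that now stand behind it. -/
theorem Forest.afterLink {h : FibHeap n} (hF : h.Forest none) {win los : Fin n} (hne : win ≠ los)
    (hwin : h.mem win) (hwin' : h.parent win = none) (hlos : h.mem los)
    (hlos' : h.parent los = none) (hkey : h.key win ≤ h.key los) (hrank : h.rank win = h.rank los) :
    (h.afterLink win los).Forest none := by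
  have hmark : Function.update h.mark los false = h.mark := by
    rw [← hF.mark_root los hlos hlos', Function.update_eq_self]
  have hpar : ∀ u w, (h.afterLink win los).parent u = some w ↔
      h.parent u = some w ∨ u = los ∧ w = win := by
    intro u w
    by_cases hu : u = los
    · subst hu
      simp [FibHeap.afterLink, hlos', eq_comm]
    · simp [FibHeap.afterLink, hu]
  obtain ⟨lev, hlev⟩ := hF.acyclic
  constructor
  · intro w hw u
    have h1 := hF.mem_children w hw u
    rw [hpar]
    by_cases hww : w = win
    · subst hww
      simp only [FibHeap.afterLink, Function.update_self, List.mem_cons, h1]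
      constructor
      · rintro (rfl | h2)
        · exact ⟨hlos, Or.inr (by simp)⟩
        · exact ⟨h2.1, Or.inl h2.2⟩
      · rintro ⟨h2, h3 | h3⟩
        · exact Or.inr ⟨h2, h3⟩
        · exact Or.inl h3.1
    · simp only [FibHeap.afterLink, Function.update_of_ne hww, h1, hww, and_false, or_false]
  · intro u w hu huw
    rcases (hpar u w).1 huw with h1 | ⟨rfl, rfl⟩
    · exact hF.mem_parent u w hu h1
    · exact hwin
  · intro w hw
    by_cases hww : w = win
    · subst hww
      simp only [FibHeap.afterLink, Function.update_self, List.nodup_cons]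
      refine ⟨fun h1 => ?_, hF.nodup w hw⟩
      have := ((hF.mem_children w hw los).1 h1).2
      simp [hlos'] at this
    · simp only [FibHeap.afterLink, Function.update_of_ne hww]
      exact hF.nodup w hw
  · intro w hw
    by_cases hww : w = win
    · subst hww
      simp only [FibHeap.afterLink, Function.update_self, List.length_cons]
      rw [hF.rank_eq w hw]
    · simp only [FibHeap.afterLink, Function.update_of_ne hww]
      exact hF.rank_eq w hw
  · intro w hw hwn
    by_cases hwl : w = los
    · simp [FibHeap.afterLink, hwl]
    · simp only [FibHeap.afterLink, Function.update_of_ne hwl] at hwn ⊢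
      exact hF.mark_root w hw hwn
  · intro u w hu huw
    rcases (hpar u w).1 huw with h1 | ⟨rfl, rfl⟩
    · exact hF.key_le u w hu h1
    · exact hkey
  -- The winner is lifted above the loser; being a root, it has no parent that would have to be
  -- lifted too.
  · refine ⟨Function.update lev win (max (lev win) (lev los + 1)), fun u w hu huw => ?_⟩
    rcases (hpar u w).1 huw with h1 | ⟨rfl, rfl⟩
    · have h2 : u ≠ win := by rintro rfl; simp [hwin'] at h1
      rw [Function.update_of_ne h2]
      have h3 := hlev u w hu h1
      by_cases hww : w = win
      · subst hww
        rw [Function.update_self]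
        omega
      · rwa [Function.update_of_ne hww]
    · rw [Function.update_self, Function.update_of_ne (Ne.symm hne)]
      omega
  · have hcr : ∀ c, h.credit none c ≤ (h.afterLink win los).credit none c := by
      intro c
      simp only [credit, FibHeap.afterLink, hmark, reduceCtorEq, if_false]
      by_cases hcw : c = win
      · simp [hcw]
      · simp [hcw]
    intro w hw
    have h1 := (hF.childrenOK w hw).mono fun c _ => hcr c
    by_cases hww : w = win
    · subst hww
      simp only [FibHeap.afterLink, Function.update_self]
      refine ⟨(?_ : (h.children w).length ≤ (h.afterLink w los).credit none los), h1⟩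
      rw [← hF.rank_eq w hw, hrank]
      refine le_trans ?_ (hcr los)
      unfold credit
      omega
    · simp only [FibHeap.afterLink, Function.update_of_ne hww]
      exact h1

theorem numRoots_afterLink_lt {h : FibHeap n} {win los : Fin n} (hlos : h.mem los)
    (hlos' : h.parent los = none) : (h.afterLink win los).numRoots < h.numRoots := by
  refine card_filter_lt (fun u hu => ?_) (v := los) ⟨hlos, hlos'⟩ (by simp [afterLink])
  by_cases hul : u = los
  · simp [afterLink, hul] at hu
  · simpa [afterLink, Function.update_of_ne hul] using hu

theorem numMarked_afterLink_le (h : FibHeap n) (win los : Fin n) :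
    (h.afterLink win los).numMarked ≤ h.numMarked := by
  refine card_filter_le fun u hu => ?_
  by_cases hul : u = los
  · simp [afterLink, hul] at hu
  · simpa [afterLink, Function.update_of_ne hul] using hu

/-- The state of consolidation while roots are linked: `x` is the root in the register, `rest` are
the roots to come, and all other roots are in the slots. -/
structure Linking (h₀ h : FibHeap n) (rs rest : List (Fin n)) (x : Option (Fin n)) : Prop where
  forest : h.Forest none
  mem : h.mem = h₀.mem
  key : h.key = h₀.key
  numMarked_le : h.numMarked ≤ h₀.numMarked
  roots : h.roots = []
  minRoot : h.minRoot = none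
  nodup : rest.Nodup
  root_of : ∀ w, x = some w ∨ w ∈ rest → h.mem w ∧ h.parent w = none ∧ w ∈ rs
  slot : ∀ i w, h.slot i = some w → h.mem w ∧ h.parent w = none ∧ w ∈ rs ∧ h.rank w = i ∧
    x ≠ some w ∧ w ∉ rest
  cover : ∀ w, h.mem w → h.parent w = none →
    x = some w ∨ w ∈ rest ∨ h.slot (h.rank w) = some w
  notMem : ∀ w, x = some w → w ∉ rest

theorem Linking.next {h₀ h : FibHeap n} {rs rest : List (Fin n)} {r : Fin n}
    (hL : Linking h₀ h rs (r :: rest) none) : Linking h₀ h rs rest (some r) := by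
  obtain ⟨h1, h2, h3, h4, h5, h6, h7, h8, h9, h10, -⟩ := hL
  rw [List.nodup_cons] at h7
  refine ⟨h1, h2, h3, h4, h5, h6, h7.2, fun w hw => h8 w (Or.inr ?_), fun i w hw => ?_,
    fun w hw hw' => ?_, ?_⟩
  · rcases hw with hw | hw
    · simp_all
    · simp [hw]
  · have := h9 i w hw
    simp only [List.mem_cons, not_or] at this
    simp only [ne_eq, Option.some.injEq]
    tauto
  · have := h10 w hw hw'
    simp only [reduceCtorEq, List.mem_cons, false_or] at this
    simp only [Option.some.injEq]
    tauto
  · rintro w ⟨⟩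
    exact h7.1

theorem Linking.store {h₀ h : FibHeap n} {rs rest : List (Fin n)} {x : Fin n}
    (hL : Linking h₀ h rs rest (some x)) (hx : h.slot (h.rank x) = none) :
    Linking h₀ { h with slot := Function.update h.slot (h.rank x) (some x) } rs rest none := by
  obtain ⟨h1, h2, h3, h4, h5, h6, h7, h8, h9, h10, h11⟩ := hL
  refine ⟨⟨h1.1, h1.2, h1.3, h1.4, h1.5, h1.6, h1.7, h1.8⟩, h2, h3, h4, h5, h6, h7,
    fun w hw => h8 w (Or.inr ?_), fun i w hw => ?_, fun w hw hw' => ?_, by simp⟩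
  · simpa using hw
  · by_cases hi : i = h.rank x
    · subst hi
      simp only [Function.update_self, Option.some.injEq] at hw
      subst hw
      have := h8 x (Or.inl rfl)
      exact ⟨this.1, this.2.1, this.2.2, rfl, by simp, h11 x rfl⟩
    · simp only [Function.update_of_ne hi] at hw
      have := h9 i w hw
      exact ⟨this.1, this.2.1, this.2.2.1, this.2.2.2.1, by simp, this.2.2.2.2.2⟩
  · rcases h10 w hw hw' with h12 | h12 | h12
    · rw [Option.some.injEq] at h12
      subst h12
      simp
    · exact Or.inr (Or.inl h12)
    · refine Or.inr (Or.inr ?_)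
      have : h.rank w ≠ h.rank x := fun h13 => by rw [h13, hx] at h12; cases h12
      simp only [Function.update_of_ne this]
      exact h12

/-- The register and the slots hold different roots, so `x` and `y` are distinct. Whichever wins
takes over the register, and the number of roots drops, which pays for the round. -/
theorem Linking.link {h₀ h : FibHeap n} {rs rest : List (Fin n)} {x y win los : Fin n}
    (hL : Linking h₀ h rs rest (some x)) (hy : h.slot (h.rank x) = some y)
    (hwl : win = x ∧ los = y ∨ win = y ∧ los = x) (hkey : h.key win ≤ h.key los) :
    Linking h₀ (({ h with slot := Function.update h.slot (h.rank x) none } : FibHeap n).afterLink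
      win los) rs rest (some win) ∧
    (({ h with slot := Function.update h.slot (h.rank x) none } : FibHeap n).afterLink
      win los).numRoots < h.numRoots := by
  obtain ⟨h1, h2, h3, h4, h5, h6, h7, h8, h9, h10, h11⟩ := hL
  obtain ⟨hx1, hx2, hx3⟩ := h8 x (Or.inl rfl)
  have hx4 := h11 x rfl
  obtain ⟨hy1, hy2, hy3, hy4, hy5, hy6⟩ := h9 _ y hy
  have hxy : x ≠ y := by simpa using hy5
  have hwin : h.mem win ∧ h.parent win = none ∧ win ∈ rs ∧ win ∉ rest := by
    rcases hwl with ⟨rfl, rfl⟩ | ⟨rfl, rfl⟩ <;> tauto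
  have hlos : h.mem los ∧ h.parent los = none ∧ los ∉ rest := by
    rcases hwl with ⟨rfl, rfl⟩ | ⟨rfl, rfl⟩ <;> tauto
  have hne : win ≠ los := by
    rcases hwl with ⟨rfl, rfl⟩ | ⟨rfl, rfl⟩
    · exact hxy
    · exact hxy.symm
  have hrank : h.rank win = h.rank los := by
    rcases hwl with ⟨rfl, rfl⟩ | ⟨rfl, rfl⟩ <;> simp [hy4]
  have hF : ({ h with slot := Function.update h.slot (h.rank x) none } : FibHeap n).Forest none :=
    ⟨h1.1, h1.2, h1.3, h1.4, h1.5, h1.6, h1.7, h1.8⟩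
  refine ⟨⟨hF.afterLink hne hwin.1 hwin.2.1 hlos.1 hlos.2.1 hkey hrank, h2, h3,
    (numMarked_afterLink_le _ _ _).trans h4, h5, h6, h7, ?_, ?_, ?_, ?_⟩,
    numRoots_afterLink_lt (h := { h with slot := Function.update h.slot (h.rank x) none })
      hlos.1 hlos.2.1⟩
  · rintro w (hw | hw)
    · rw [Option.some.injEq] at hw
      subst hw
      refine ⟨hwin.1, ?_, hwin.2.2.1⟩
      simp only [FibHeap.afterLink, Function.update_of_ne hne]
      exact hwin.2.1
    · have hwl : w ≠ los := by rintro rfl; exact hlos.2.2 hw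
      obtain ⟨h12, h13, h14⟩ := h8 w (Or.inr hw)
      refine ⟨h12, ?_, h14⟩
      simp only [FibHeap.afterLink, Function.update_of_ne hwl]
      exact h13
  · intro i w hw
    simp only [FibHeap.afterLink] at hw
    by_cases hi : i = h.rank x
    · simp [hi] at hw
    · rw [Function.update_of_ne hi] at hw
      obtain ⟨h12, h13, h14, h15, h16, h17⟩ := h9 i w hw
      have hwx : w ≠ x := by rintro rfl; exact h16 rfl
      have hwy : w ≠ y := by rintro rfl; exact hi (h15.symm.trans hy4)
      have hw1 : w ≠ win := by rcases hwl with ⟨rfl, rfl⟩ | ⟨rfl, rfl⟩ <;> assumption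
      have hw2 : w ≠ los := by rcases hwl with ⟨rfl, rfl⟩ | ⟨rfl, rfl⟩ <;> assumption
      refine ⟨h12, ?_, h14, ?_, by simpa using hw1.symm, h17⟩
      · simp only [FibHeap.afterLink, Function.update_of_ne hw2]
        exact h13
      · simp only [FibHeap.afterLink, Function.update_of_ne hw1]
        exact h15
  · intro w hw hw'
    have hw2 : w ≠ los := by
      rintro rfl
      simp [FibHeap.afterLink] at hw'
    simp only [FibHeap.afterLink, Function.update_of_ne hw2] at hw hw' ⊢
    by_cases hw1 : w = win
    · exact Or.inl (by rw [hw1])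
    · have hwx : w ≠ x := by rcases hwl with ⟨rfl, rfl⟩ | ⟨rfl, rfl⟩ <;> assumption
      have hwy : w ≠ y := by rcases hwl with ⟨rfl, rfl⟩ | ⟨rfl, rfl⟩ <;> assumption
      rcases h10 w hw hw' with h12 | h12 | h12
      · rw [Option.some.injEq] at h12
        exact absurd h12.symm hwx
      · exact Or.inr (Or.inl h12)
      · refine Or.inr (Or.inr ?_)
        rw [Function.update_of_ne hw1, Function.update_of_ne, h12]
        intro h13
        rw [h13, hy, Option.some.injEq] at h12
        exact hwy h12.symm
  · rintro w ⟨⟩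
    exact hwin.2.2.2

/-- The state of consolidation while the roots are collected: the roots that are not yet in the
root list are in the slots and occur in the list `l`. -/
structure Collecting (h₁ h : FibHeap n) (l : List (Fin n)) : Prop where
  forest : h.Forest none
  mem : h.mem = h₁.mem
  key : h.key = h₁.key
  potential : h.potential = h₁.potential
  nodup : h.roots.Nodup
  mem_roots : ∀ w ∈ h.roots, h.mem w ∧ h.parent w = none ∧ h.slot (h.rank w) ≠ some w
  cover : ∀ w, h.mem w → h.parent w = none → w ∈ h.roots ∨ h.slot (h.rank w) = some w
  slot : ∀ i w, h.slot i = some w → w ∈ l ∧ h.mem w ∧ h.parent w = none ∧ h.rank w = i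
  minRoot_none : h.minRoot = none → h.roots = []
  minRoot_some : ∀ u, h.minRoot = some u → u ∈ h.roots ∧ ∀ r ∈ h.roots, h.key u ≤ h.key r

theorem Linking.collecting {h₀ h : FibHeap n} {rs : List (Fin n)}
    (hL : Linking h₀ h rs [] none) : Collecting h h rs := by
  obtain ⟨h1, h2, h3, h4, h5, h6, h7, h8, h9, h10, h11⟩ := hL
  refine ⟨h1, rfl, rfl, rfl, by simp [h5], by simp [h5], fun w hw hw' => ?_, fun i w hw => ?_,
    fun _ => h5, by simp [h6]⟩
  · exact Or.inr (by simpa using h10 w hw hw')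
  · have := h9 i w hw
    tauto

/-- At the end of linking every root sits in the slot of its rank. So the ranks of the roots are
distinct, and they are at most 2 log + 1. -/
theorem Linking.numRoots_le {h₀ h : FibHeap n} {rs : List (Fin n)}
    (hL : Linking h₀ h rs [] none) : h.numRoots ≤ 2 * Nat.log 2 h.size + 2 := by
  rw [← Finset.card_range (2 * Nat.log 2 h.size + 2)]
  refine Finset.card_le_card_of_injOn h.rank (fun v hv => ?_) fun v hv w hw hvw => ?_
  · have hv' := (Finset.mem_filter.1 hv).2
    have := hL.forest.rank_le hv'.1
    simp only [Finset.coe_range, Set.mem_Iio]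
    omega
  · have hv' := (Finset.mem_filter.1 hv).2
    have hw' := (Finset.mem_filter.1 hw).2
    have h1 := hL.cover v hv'.1 hv'.2
    have h2 := hL.cover w hw'.1 hw'.2
    simp only [reduceCtorEq, List.not_mem_nil, false_or] at h1 h2
    rw [hvw, h2, Option.some.injEq] at h1
    exact h1.symm

theorem Collecting.skip {h₁ h : FibHeap n} {r : Fin n} {l : List (Fin n)}
    (hC : Collecting h₁ h (r :: l)) (hr : h.slot (h.rank r) ≠ some r) : Collecting h₁ h l := by
  refine ⟨hC.1, hC.2, hC.3, hC.4, hC.5, hC.6, hC.7, fun i w hw => ?_, hC.9, hC.10⟩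
  obtain ⟨h1, h2, h3, h4⟩ := hC.slot i w hw
  refine ⟨(List.mem_cons.1 h1).resolve_left ?_, h2, h3, h4⟩
  rintro rfl
  rw [← h4] at hw
  exact hr hw

theorem Collecting.collect {h₁ h : FibHeap n} {r : Fin n} {l : List (Fin n)}
    (hC : Collecting h₁ h (r :: l)) (hr : h.slot (h.rank r) = some r) :
    Collecting h₁ (({ h with
      slot := Function.update h.slot (h.rank r) none
      roots := r :: h.roots } : FibHeap n).afterUpdateMin r) l := by
  obtain ⟨h1, h2, h3, h4, h5, h6, h7, h8, h9, h10⟩ := hC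
  obtain ⟨hr1, hr2, hr3, hr4⟩ := h8 _ r hr
  have hrr : r ∉ h.roots := fun hmem => (h6 r hmem).2.2 hr
  refine ⟨⟨h1.1, h1.2, h1.3, h1.4, h1.5, h1.6, h1.7, h1.8⟩, h2, h3, h4,
    List.nodup_cons.2 ⟨hrr, h5⟩, ?_, ?_, ?_, ?_, ?_⟩
  · intro w hw
    simp only [afterUpdateMin, List.mem_cons] at hw ⊢
    rcases hw with rfl | hw
    · refine ⟨hr2, hr3, by simp⟩
    · obtain ⟨h11, h12, h13⟩ := h6 w hw
      refine ⟨h11, h12, ?_⟩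
      by_cases hi : h.rank w = h.rank r
      · simp [hi]
      · rwa [Function.update_of_ne hi]
  · intro w hw hw'
    simp only [afterUpdateMin, List.mem_cons] at hw hw' ⊢
    by_cases hwr : w = r
    · exact Or.inl (Or.inl hwr)
    · rcases h7 w hw hw' with h11 | h11
      · exact Or.inl (Or.inr h11)
      · refine Or.inr ?_
        rw [Function.update_of_ne, h11]
        intro h12
        rw [h12, hr, Option.some.injEq] at h11
        exact hwr h11.symm
  · intro i w hw
    simp only [afterUpdateMin] at hw ⊢
    by_cases hi : i = h.rank r
    · simp [hi] at hw
    · rw [Function.update_of_ne hi] at hw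
      obtain ⟨h11, h12, h13, h14⟩ := h8 i w hw
      refine ⟨(List.mem_cons.1 h11).resolve_left ?_, h12, h13, h14⟩
      rintro rfl
      exact hi h14.symm
  · intro hn
    simp only [afterUpdateMin] at hn
    split at hn
    · cases hn
    · split_ifs at hn
  · intro u hu
    simp only [afterUpdateMin] at hu ⊢
    cases hm : h.minRoot with
    | none =>
      simp only [hm, Option.some.injEq] at hu
      subst hu
      simp [h9 hm]
    | some u' =>
      simp only [hm] at hu
      obtain ⟨h11, h12⟩ := h10 u' hm
      split_ifs at hu with hlt
      · rw [Option.some.injEq] at hu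
        subst hu
        refine ⟨by simp, fun w hw => ?_⟩
        rcases List.mem_cons.1 hw with rfl | hw
        · exact le_rfl
        · exact hlt.le.trans (h12 w hw)
      · rw [Option.some.injEq] at hu
        subst hu
        refine ⟨List.mem_cons_of_mem _ h11, fun w hw => ?_⟩
        rcases List.mem_cons.1 hw with rfl | hw
        · exact not_lt.1 hlt
        · exact h12 w hw

theorem Collecting.inv {h₁ h : FibHeap n} (hC : Collecting h₁ h []) : h.Inv := by
  have hslot : ∀ i, h.slot i = none := by
    intro i
    cases hs : h.slot i with
    | none => rfl
    | some w => simpa using (hC.slot i w hs).1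
  have hroots : ∀ v, v ∈ h.roots ↔ h.mem v ∧ h.parent v = none := fun v =>
    ⟨fun hv => ⟨(hC.mem_roots v hv).1, (hC.mem_roots v hv).2.1⟩,
      fun hv => (hC.cover v hv.1 hv.2).resolve_right (by simp [hslot])⟩
  refine ⟨hC.forest, hC.nodup, hroots, fun hm v => ?_, fun u hu => ?_, hslot⟩
  · by_contra hv
    rw [Bool.not_eq_false] at hv
    obtain ⟨r, h1, h2, -⟩ := hC.forest.exists_root_le hv
    have := (hroots r).2 ⟨h1, h2⟩
    rw [hC.minRoot_none hm] at this
    simp at this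
  · refine ⟨(hC.minRoot_some u hu).1, fun v hv => ?_⟩
    obtain ⟨r, h1, h2, h3⟩ := hC.forest.exists_root_le hv
    exact ((hC.minRoot_some u hu).2 r ((hroots r).2 ⟨h1, h2⟩)).trans h3

/-- Of the 12 credits of an old root, 4 pay for its turn in the linking pass, 4 for a link that
removes a root and 4 for its turn in the collecting pass. The logarithmic allowance finances the
potential of the at most 2 log + 2 new roots; no marks are added. -/
theorem runs_consolidate {h : FibHeap n} (hF : h.Forest none) (hnd : h.roots.Nodup)
    (hroots : ∀ w, w ∈ h.roots ↔ h.mem w ∧ h.parent w = none) (hmin : h.minRoot = none)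
    (hslot : ∀ i, h.slot i = none) {N R : ℕ}
    (hN : h.potential + 24 * Nat.log 2 h.size + 27 + R ≤ N) :
    Runs consolidate h N fun _ h' N' => h'.Inv ∧ h'.mem = h.mem ∧ h'.key = h.key ∧
      h'.potential + R ≤ N' := by
  have hlen : h.roots.length = h.numRoots := by
    rw [← List.toFinset_card_of_nodup hnd, numRoots]
    congr 1
    ext v
    simp [hroots]
  have hpot : h.potential = 12 * (h.numRoots + 2 * h.numMarked) := rfl
  unfold consolidate
  refine runs_bind (runs_step (by omega) ?_)
  dsimp only
  refine runs_bind ?_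
  set rs := h.roots with hrs
  refine runs_foldEach (fun l _ h' N' => Linking h h' rs l none ∧
    4 * h'.numRoots + 4 * l.length + 1 + (4 * h.numRoots + 24 * h.numMarked +
      24 * Nat.log 2 h.size + 25 + R) ≤ N') ⟨?_, ?_⟩ ?_ ?_
  · refine ⟨⟨hF.1, hF.2, hF.3, hF.4, hF.5, hF.6, hF.7, hF.8⟩, rfl, rfl, le_rfl, rfl, hmin, hnd,
      ?_, ?_, ?_, by simp⟩
    · rintro w (hw | hw)
      · cases hw
      · exact ⟨((hroots w).1 hw).1, ((hroots w).1 hw).2, hw⟩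
    · intro i w hw
      simp [hslot] at hw
    · exact fun w hw hw' => Or.inr (Or.inl ((hroots w).2 ⟨hw, hw'⟩))
  · change 4 * h.numRoots + _ + _ + _ ≤ _
    omega
  · rintro r l _ h' N' ⟨hL, hN'⟩
    rw [List.length_cons] at hN'
    refine ⟨by omega, ?_⟩
    refine runs_repeatUntilNone (fun x h'' N'' => Linking h h'' rs l (some x) ∧
      4 * h''.numRoots + 4 * l.length + 4 + (4 * h.numRoots + 24 * h.numMarked +
      24 * Nat.log 2 h.size + 25 + R) ≤ N'') ?_ ⟨hL.next, by omega⟩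
    clear hN' hL N' h' r
    rintro x h' N' ⟨hL, hN'⟩
    refine ⟨by omega, runs_read_bind (by omega) ?_⟩
    cases hy : h'.slot (h'.rank x) with
    | none =>
      refine runs_write_bind (by omega) (runs_pure ⟨hL.store hy, ?_⟩)
      change 4 * h'.numRoots + _ + _ + _ ≤ _
      omega
    | some y =>
      have hx1 := hL.root_of x (Or.inl rfl)
      refine runs_write_bind (by omega) (runs_bind (runs_link _ _ (by omega) ?_ ?_))
      · intro hkey
        obtain ⟨h1, h2⟩ := hL.link hy (Or.inl ⟨rfl, rfl⟩) hkey
        exact runs_pure ⟨h1, by omega⟩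
      · intro hkey
        obtain ⟨h1, h2⟩ := hL.link hy (Or.inr ⟨rfl, rfl⟩) hkey
        exact runs_pure ⟨h1, by omega⟩
  · rintro _ h₁ N₁ ⟨hL, hN₁⟩
    rw [List.length_nil] at hN₁
    refine ⟨by omega, ?_⟩
    have hsize : h₁.size = h.size := by unfold size; rw [hL.mem]
    have hle := hL.numRoots_le
    have hmk := hL.numMarked_le
    rw [hsize] at hle
    have hpot₁ : h₁.potential = 12 * (h₁.numRoots + 2 * h₁.numMarked) := rfl
    refine runs_foldEach (fun l _ h' N' => Collecting h₁ h' l ∧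
      h₁.potential + 4 * l.length + 1 + R ≤ N') ⟨hL.collecting, by omega⟩ ?_ ?_
    · rintro r l _ h' N' ⟨hC, hN'⟩
      rw [List.length_cons] at hN'
      refine ⟨by omega, runs_read_bind (by omega) ?_⟩
      by_cases hr : h'.slot (h'.rank r) = some r
      · rw [if_pos (by simpa using hr)]
        refine runs_write_bind (by omega) ?_
        rw [updateMin_eq]
        exact runs_write (by omega) ⟨hC.collect hr, by omega⟩
      · rw [if_neg (by simpa using hr)]
        exact runs_pure ⟨hC.skip hr, by omega⟩
    · rintro _ h' N' ⟨hC, hN'⟩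
      rw [List.length_nil] at hN'
      refine ⟨by omega, hC.inv, hC.mem.trans hL.mem, hC.key.trans hL.key, ?_⟩
      rw [hC.potential]
      omega

/-- The memory after the items `cs` have become roots. -/
def afterPromote (h : FibHeap n) (cs : List (Fin n)) : FibHeap n :=
  { h with
    roots := cs.reverse ++ h.roots
    parent := fun u => if u ∈ cs then none else h.parent u
    mark := fun u => if u ∈ cs then false else h.mark u }

/-- The memory of `extractMin` when the minimum `z` has been removed, before consolidation. -/
def afterRemove (h : FibHeap n) (z : Fin n) : FibHeap n :=
  { h.afterPromote (h.children z) with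
    roots := ((h.children z).reverse ++ h.roots).erase z
    minRoot := none
    mem := Function.update h.mem z false
    children := Function.update h.children z []
    rank := Function.update h.rank z 0 }

theorem Inv.afterRemove {h : FibHeap n} (hI : h.Inv) {z : Fin n} (hz : h.mem z)
    (hzp : h.parent z = none) : (h.afterRemove z).Forest none ∧ (h.afterRemove z).roots.Nodup ∧
    ∀ w, w ∈ (h.afterRemove z).roots ↔
      (h.afterRemove z).mem w ∧ (h.afterRemove z).parent w = none := by
  have hF := hI.forest
  obtain ⟨lev, hlev⟩ := hF.acyclic
  have hmem : ∀ u, (h.afterRemove z).mem u ↔ h.mem u ∧ u ≠ z := by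
    intro u
    by_cases huz : u = z
    · simp [FibHeap.afterRemove, huz]
    · simp [FibHeap.afterRemove, huz]
  have hzc : z ∉ h.children z := by
    rw [hF.mem_children z hz]
    simp [hzp]
  have hpar : ∀ u w, h.mem u →
      ((h.afterRemove z).parent u = some w ↔ h.parent u = some w ∧ w ≠ z) := by
    intro u w hu
    have h1 := hF.mem_children z hz u
    by_cases huc : u ∈ h.children z
    · have h2 := (h1.1 huc).2
      simp only [FibHeap.afterRemove, afterPromote, if_pos huc, h2, Option.some.injEq,
        reduceCtorEq, false_iff, not_and, not_not]
      exact fun h => h.symm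
    · simp only [FibHeap.afterRemove, afterPromote, if_neg huc]
      refine ⟨fun h2 => ⟨h2, ?_⟩, fun h2 => h2.1⟩
      rintro rfl
      exact huc (h1.2 ⟨hu, h2⟩)
  have hnd : ((h.children z).reverse ++ h.roots).Nodup := by
    refine List.Nodup.append (List.nodup_reverse.2 (hF.nodup z hz)) hI.roots_nodup ?_
    intro u hu hu'
    rw [List.mem_reverse] at hu
    have h1 := ((hF.mem_children z hz u).1 hu).2
    rw [((hI.mem_roots u).1 hu').2] at h1
    cases h1
  refine ⟨⟨?_, ?_, ?_, ?_, ?_, ?_, ?_, ?_⟩, hnd.erase z, ?_⟩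
  · intro w hw u
    rw [hmem] at hw
    simp only [FibHeap.afterRemove, Function.update_of_ne hw.2]
    rw [hF.mem_children w hw.1]
    constructor
    · rintro ⟨h1, h2⟩
      exact ⟨(hmem u).2 ⟨h1, by rintro rfl; simp [hzp] at h2⟩, (hpar u w h1).2 ⟨h2, hw.2⟩⟩
    · rintro ⟨h1, h2⟩
      have h3 := ((hmem u).1 h1).1
      exact ⟨h3, ((hpar u w h3).1 h2).1⟩
  · intro u w hu huw
    have h3 := ((hmem u).1 hu).1
    have h4 := (hpar u w h3).1 huw
    exact (hmem w).2 ⟨hF.mem_parent u w h3 h4.1, h4.2⟩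
  · intro w hw
    rw [hmem] at hw
    simp only [FibHeap.afterRemove, Function.update_of_ne hw.2]
    exact hF.nodup w hw.1
  · intro w hw
    rw [hmem] at hw
    simp only [FibHeap.afterRemove, Function.update_of_ne hw.2]
    exact hF.rank_eq w hw.1
  · intro w hw hwn
    rw [hmem] at hw
    by_cases hwc : w ∈ h.children z
    · simp [FibHeap.afterRemove, afterPromote, hwc]
    · simp only [FibHeap.afterRemove, afterPromote, if_neg hwc] at hwn ⊢
      exact hF.mark_root w hw.1 hwn
  · intro u w hu huw
    have h3 := ((hmem u).1 hu).1
    exact hF.key_le u w h3 ((hpar u w h3).1 huw).1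
  · refine ⟨lev, fun u w hu huw => ?_⟩
    have h3 := ((hmem u).1 hu).1
    exact hlev u w h3 ((hpar u w h3).1 huw).1
  · intro w hw
    rw [hmem] at hw
    simp only [FibHeap.afterRemove, Function.update_of_ne hw.2]
    refine (hF.childrenOK w hw.1).mono fun c hc => ?_
    have hc' := (hF.mem_children w hw.1 c).1 hc
    have hcz : c ≠ z := by rintro rfl; simp [hzp] at hc'
    have hcc : c ∉ h.children z := fun h1 => by
      have h2 := ((hF.mem_children z hz c).1 h1).2
      rw [hc'.2, Option.some.injEq] at h2
      exact hw.2 h2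
    simp only [credit, afterPromote, if_neg hcc, Function.update_of_ne hcz]
    exact le_rfl
  · intro w
    simp only [FibHeap.afterRemove]
    rw [hnd.mem_erase_iff, List.mem_append, List.mem_reverse, hI.mem_roots]
    by_cases hwz : w = z
    · simp [hwz]
    · by_cases hwc : w ∈ h.children z
      · have := ((hF.mem_children z hz w).1 hwc).1
        simp [hwz, hwc, this, afterPromote]
      · simp [hwz, hwc, afterPromote]

theorem numRoots_afterRemove_le (h : FibHeap n) (z : Fin n) :
    (h.afterRemove z).numRoots ≤ h.numRoots + (h.children z).length := by
  classical
  refine (Finset.card_le_card (t := (Finset.univ.filter fun v => h.mem v ∧ h.parent v = none) ∪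
    (h.children z).toFinset) fun u hu => ?_).trans ((Finset.card_union_le _ _).trans
    (Nat.add_le_add_left (List.toFinset_card_le _) _))
  have hu' := (Finset.mem_filter.1 hu).2
  simp only [Finset.mem_union, Finset.mem_filter, Finset.mem_univ, true_and, List.mem_toFinset]
  by_cases huc : u ∈ h.children z
  · exact Or.inr huc
  · refine Or.inl ?_
    by_cases huz : u = z
    · simp [afterRemove, huz] at hu'
    · simpa [afterRemove, afterPromote, huc, huz] using hu'

theorem numMarked_afterRemove_le (h : FibHeap n) (z : Fin n) :
    (h.afterRemove z).numMarked ≤ h.numMarked := by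
  refine card_filter_le fun u hu => ?_
  by_cases huz : u = z
  · simp [afterRemove, huz] at hu
  · by_cases huc : u ∈ h.children z
    · simp [afterRemove, afterPromote, huc] at hu
    · simpa [afterRemove, afterPromote, huc, huz] using hu

theorem size_afterRemove_le (h : FibHeap n) (z : Fin n) : (h.afterRemove z).size ≤ h.size := by
  refine card_filter_le fun u hu => ?_
  by_cases huz : u = z
  · simp [afterRemove, huz] at hu
  · simpa [afterRemove, huz] using hu

/-- The promoted children number at most 2 log + 1, so moving them and the potential of the new
roots cost O(log), on top of consolidation. -/
theorem runs_extractMin {h : FibHeap n} (hI : h.Inv) {N R : ℕ}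
    (hN : h.potential + 60 * (Nat.log 2 h.size + 1) + R ≤ N) :
    Runs extractMin h N fun z? h' N' =>
      match z? with
      | none => h.Clean ∧ h' = h ∧ h.potential + R ≤ N'
      | some z => h.mem z ∧ (∀ v, h.mem v → h.key z ≤ h.key v) ∧ h'.Inv ∧
          h'.mem = Function.update h.mem z false ∧ h'.key = h.key ∧ h'.potential + R ≤ N' := by
  unfold extractMin
  refine runs_read_bind (by omega) ?_
  cases hz : h.minRoot with
  | none => exact runs_pure ⟨hI.clean (hI.minRoot_none hz), rfl, by omega⟩
  | some z =>
    obtain ⟨h1, h2⟩ := hI.minRoot_some z hz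
    obtain ⟨h3, h4⟩ := (hI.mem_roots z).1 h1
    have hrank := hI.forest.rank_le h3
    rw [hI.forest.rank_eq z h3] at hrank
    refine runs_read_bind (by omega) (runs_bind ?_)
    refine runs_foldEach (fun l _ h' N' => (∃ l', l' ++ l = h.children z ∧
      h' = h.afterPromote l') ∧ 2 * l.length + 1 + (h.potential + 12 * (h.children z).length +
        24 * Nat.log 2 h.size + 28 + R) ≤ N') ⟨⟨[], rfl, ?_⟩, by omega⟩ ?_ ?_
    · simp [afterPromote]
    · rintro c l _ h' N' ⟨⟨l', h5, rfl⟩, hN'⟩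
      rw [List.length_cons] at hN'
      refine ⟨by omega, runs_write (by omega) ⟨⟨l' ++ [c], by simp [h5], ?_⟩, by omega⟩⟩
      simp only [afterPromote, List.reverse_append, List.reverse_cons, List.reverse_nil,
        List.nil_append, List.cons_append, List.mem_append, List.mem_singleton, mk.injEq,
        true_and, and_true]
      constructor <;>
      · funext u
        by_cases huc : u = c
        · simp [huc]
        · simp [huc]
    · rintro _ h' N' ⟨⟨l', h5, rfl⟩, hN'⟩
      rw [List.append_nil] at h5
      subst h5
      rw [List.length_nil] at hN'
      refine ⟨by omega, runs_write_bind (by omega) (runs_bind ?_)⟩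
      obtain ⟨h5, h6, h7⟩ := hI.afterRemove h3 h4
      have h8 := numRoots_afterRemove_le h z
      have h9 := numMarked_afterRemove_le h z
      have h10 := Nat.log_mono_right (b := 2) (size_afterRemove_le h z)
      have h11 : (h.afterRemove z).potential ≤ h.potential + 12 * (h.children z).length := by
        unfold potential
        omega
      refine (runs_consolidate h5 h6 h7 rfl hI.slot_none (R := R) (by omega)).mono ?_
      rintro _ h' N'' ⟨h12, h13, h14, h15⟩
      exact runs_pure ⟨h3, h2, h12, h13, h14, h15⟩

end FibHeap

/-! # Distances and their changes -/

namespace WeightedHypergraph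

variable {n m : ℕ} (H : WeightedHypergraph n m)

theorem dist_self (s : Fin n) : H.dist s s = 0 := by simp [dist]

/-- Cut the hyperpath at its first hyperedge containing `z`: up to there `h2` transports `g` from
vertex to vertex, none of them `z`, and `h1` is applied to that hyperedge. The rest of the path has
nonnegative weight. -/
theorem le_add_pathWeight {g : Fin n → ℝ≥0∞} {B : ℝ≥0∞} {z : Fin n}
    (h1 : ∀ e u, u ≠ z → u ∈ H.edge e → z ∈ H.edge e → B ≤ g u + H.weight e)
    (h2 : ∀ e u q, u ∈ H.edge e → q ∈ H.edge e → g q ≤ g u + H.weight e)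
    (L : List (Fin m)) (u : Fin n) (hu : u ≠ z) (hL : H.IsHyperpath u z L) :
    B ≤ g u + H.pathWeight L := by
  induction L generalizing u with
  | nil => exact absurd rfl hL.1.1
  | cons e L ih =>
    obtain ⟨⟨h, hu', hz⟩, hch⟩ := hL
    rw [List.head_cons] at hu'
    simp only [pathWeight, List.map_cons, List.sum_cons]
    by_cases hze : z ∈ H.edge e
    · refine (h1 e u hu hu' hze).trans ?_
      rw [← add_assoc]
      exact le_self_add
    · cases L with
      | nil => exact absurd hz hze
      | cons f L =>
        rw [List.isChain_cons_cons] at hch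
        obtain ⟨⟨q, hq⟩, hch⟩ := hch
        rw [Finset.mem_inter] at hq
        have hqz : q ≠ z := by rintro rfl; exact hze hq.1
        refine (ih q hqz ⟨⟨by simp, hq.2, by simpa using hz⟩, hch⟩).trans ?_
        rw [← add_assoc]
        exact add_le_add (h2 e u q hu' hq.1) le_rfl

/-- Maximality of the distance among the feasible functions. All later comparisons of old and new
distances come from this and `dist_le_add`, without handling hyperpaths. -/
theorem le_dist {s : Fin n} {g : Fin n → ℝ≥0∞} (hs : g s = 0)
    (hg : ∀ e u v, u ∈ H.edge e → v ∈ H.edge e → g v ≤ g u + H.weight e) (v : Fin n) :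
    g v ≤ H.dist s v := by
  unfold dist
  split_ifs with hv
  · rw [hv, hs]
  · refine le_iInf₂ fun L hL => ?_
    have := H.le_add_pathWeight (g := g) (B := g v) (fun e u _ hu hv => hg e u v hu hv)
      hg L s (Ne.symm hv) hL
    rwa [hs, zero_add] at this

theorem dist_le_add {s u v : Fin n} {e : Fin m} (hu : u ∈ H.edge e) (hv : v ∈ H.edge e) :
    H.dist s v ≤ H.dist s u + H.weight e := by
  by_cases hvs : v = s
  · rw [hvs, dist_self]
    exact zero_le
  by_cases hus : u = s
  · subst hus
    rw [dist_self, zero_add, dist, if_neg hvs]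
    refine (iInf₂_le [e] ⟨⟨by simp, by simpa using hu, by simpa using hv⟩, by simp⟩).trans ?_
    simp [pathWeight]
  · rw [dist, dist, if_neg hvs, if_neg hus]
    simp only [ENNReal.iInf_add]
    refine le_iInf₂ fun L hL => ?_
    obtain ⟨⟨h, h1, h2⟩, h3⟩ := hL
    refine (iInf₂_le (L ++ [e]) ⟨⟨by simp, ?_, by simpa using hv⟩, ?_⟩).trans ?_
    · simp [pathWeight]
    · rwa [List.head_append_of_ne_nil h]
    · rw [List.isChain_append]
      refine ⟨h3, by simp, fun x hx y hy => ?_⟩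
      rw [List.getLast?_eq_getLast_of_ne_nil h, Option.mem_some_iff] at hx
      simp only [List.head?_cons, Option.mem_some_iff] at hy
      subst hx hy
      exact ⟨u, Finset.mem_inter.2 ⟨h2, hu⟩⟩

/-- The infimum over infinitely many hyperpaths is bounded below by the minimum over the finitely
many possible last steps into `z`, so some last step realises it. -/
theorem exists_pred {s z : Fin n} (hz : z ≠ s) (hd : H.dist s z ≠ ∞) :
    ∃ q f, q ≠ z ∧ q ∈ H.edge f ∧ z ∈ H.edge f ∧ H.dist s q + H.weight f ≤ H.dist s z := by
  classical
  by_contra! hcon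
  let S : Finset (Fin n × Fin m) :=
    Finset.univ.filter fun a => a.1 ≠ z ∧ a.1 ∈ H.edge a.2 ∧ z ∈ H.edge a.2
  -- A finite infimum of strictly larger values is strictly larger. Finiteness of the distance
  -- covers an empty `S`, whose infimum is `∞`.
  have h1 : H.dist s z < S.inf fun a => H.dist s a.1 + H.weight a.2 := by
    rw [Finset.lt_inf_iff (lt_top_iff_ne_top.2 hd)]
    rintro ⟨q, f⟩ hqf
    simp only [S, Finset.mem_filter, Finset.mem_univ, true_and] at hqf
    exact hcon q f hqf.1 hqf.2.1 hqf.2.2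
  refine absurd h1 (not_lt.2 ?_)
  conv_rhs => rw [dist, if_neg hz]
  refine le_iInf₂ fun L hL => ?_
  have h2 := H.le_add_pathWeight (g := H.dist s)
    (B := S.inf fun a => H.dist s a.1 + H.weight a.2) (z := z) (fun e u hu hue hze => ?_)
    (fun e u q hu hq => H.dist_le_add hu hq) L s hz.symm hL
  · rwa [dist_self, zero_add] at h2
  · exact Finset.inf_le (f := fun a : Fin n × Fin m => H.dist s a.1 + H.weight a.2) (b := (u, e))
      (by simp [S, hu, hue, hze])

/-! ### Changing one weight: distances and affected vertices -/

theorem weight_le_setWeight {c : Fin m} {x : ℝ≥0∞} (hx : H.weight c ≤ x) (e : Fin m) :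
    H.weight e ≤ (H.setWeight c x).weight e := by
  by_cases he : e = c
  · simpa [setWeight, he] using hx
  · simp [setWeight, he]

theorem setWeight_weight_le {c : Fin m} {x : ℝ≥0∞} (hx : x ≤ H.weight c) (e : Fin m) :
    (H.setWeight c x).weight e ≤ H.weight e := by
  by_cases he : e = c
  · simpa [setWeight, he] using hx
  · simp [setWeight, he]

theorem dist_le_dist_setWeight {c : Fin m} {x : ℝ≥0∞} (hx : H.weight c ≤ x) (s v : Fin n) :
    H.dist s v ≤ (H.setWeight c x).dist s v :=
  (H.setWeight c x).le_dist (H.dist_self s) (fun e _ _ hu hv => (H.dist_le_add hu hv).trans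
    (add_le_add le_rfl (H.weight_le_setWeight hx e))) v

theorem dist_setWeight_le_dist {c : Fin m} {x : ℝ≥0∞} (hx : x ≤ H.weight c) (s v : Fin n) :
    (H.setWeight c x).dist s v ≤ H.dist s v :=
  H.le_dist (dist_self _ s) (fun e _ _ hu hv => ((H.setWeight c x).dist_le_add hu hv).trans
    (add_le_add le_rfl (H.setWeight_weight_le hx e))) v

variable {H} {s : Fin n} {D : Fin n → ℝ≥0∞} {P : Fin n → Option (Fin n)}
  {E : Fin n → Option (Fin m)} {c : Fin m} {x : ℝ≥0∞}

theorem mem_affected {H' : WeightedHypergraph n m} {v : Fin n} :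
    v ∈ H.affected H' s P E ↔ H'.dist s v ≠ H.dist s v ∨
      ∃ p e, P v = some p ∧ E v = some e ∧ H'.dist s p + H'.weight e ≠ H'.dist s v := by
  simp [affected]

theorem dist_eq_of_notMem_affected {H' : WeightedHypergraph n m} {v : Fin n}
    (hv : v ∉ H.affected H' s P E) : H'.dist s v = H.dist s v := by
  by_contra h
  exact hv (mem_affected.2 (Or.inl h))

theorem IsShortestPathData.of_parent (hd : H.IsShortestPathData s D P E) {v p : Fin n}
    (hp : P v = some p) : v ≠ s ∧ H.dist s v ≠ ∞ ∧ ∃ e, E v = some e ∧ p ∈ H.edge e ∧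
      v ∈ H.edge e ∧ H.dist s p + H.weight e = H.dist s v := by
  obtain ⟨h1, h2, h3, -⟩ := hd
  have hv : v ≠ s := fun h => by simp [h2 v (Or.inl h)] at hp
  have hv' : D v ≠ ∞ := fun h => by simp [h2 v (Or.inr h)] at hp
  obtain ⟨p', e, h4, h5, h6, h7, h8⟩ := h3 v hv hv'
  rw [hp, Option.some.injEq] at h4
  subst h4
  rw [h1, h1] at h8
  exact ⟨hv, h1 v ▸ hv', e, h5, h6, h7, h8⟩

theorem IsShortestPathData.of_edge (hd : H.IsShortestPathData s D P E) {v : Fin n} {e : Fin m}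
    (he : E v = some e) : ∃ p, P v = some p := by
  obtain ⟨-, h2, h3, -⟩ := hd
  have hv : v ≠ s := fun h => by simp [h2 v (Or.inl h)] at he
  have hv' : D v ≠ ∞ := fun h => by simp [h2 v (Or.inr h)] at he
  obtain ⟨p', e, h4, -⟩ := h3 v hv hv'
  exact ⟨p', h4⟩

/-- A vertex whose shortest hyperpath ends with the hyperedge that becomes heavier is affected. -/
theorem IsShortestPathData.affected_of_edge (hd : H.IsShortestPathData s D P E)
    (hx : H.weight c < x) {v : Fin n} (hv : E v = some c) :
    v ∈ H.affected (H.setWeight c x) s P E := by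
  obtain ⟨p, hp⟩ := hd.of_edge hv
  obtain ⟨-, h1, e, h2, -, -, h3⟩ := hd.of_parent hp
  rw [hv, Option.some.injEq] at h2
  subst h2
  by_contra hcon
  have h4 := dist_eq_of_notMem_affected hcon
  refine hcon (mem_affected.2 (Or.inr ⟨p, c, hp, hv, ?_⟩))
  rw [h4, ← h3]
  refine ne_of_gt (lt_of_lt_of_le ?_ (add_le_add (H.dist_le_dist_setWeight hx.le s p) le_rfl))
  have h5 : H.dist s p ≠ ∞ := fun h => h1 (by rw [← h3, h, top_add])
  simpa [setWeight] using ENNReal.add_lt_add_left h5 hx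

/-- A child of a vertex whose distance has increased is affected. -/
theorem IsShortestPathData.affected_of_parent (hd : H.IsShortestPathData s D P E)
    (hx : H.weight c < x) {v z : Fin n} (hv : P v = some z)
    (hz : (H.setWeight c x).dist s z ≠ H.dist s z) : v ∈ H.affected (H.setWeight c x) s P E := by
  obtain ⟨-, h1, e, h2, -, -, h3⟩ := hd.of_parent hv
  by_contra hcon
  have h4 := dist_eq_of_notMem_affected hcon
  refine hcon (mem_affected.2 (Or.inr ⟨z, e, hv, h2, ?_⟩))
  rw [h4, ← h3]
  have h5 : H.weight e ≠ ∞ := fun h => h1 (by rw [← h3, h, add_top])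
  have h6 := lt_of_le_of_ne (H.dist_le_dist_setWeight hx.le s z) (Ne.symm hz)
  exact ne_of_gt (lt_of_lt_of_le (ENNReal.add_lt_add_right h5 h6)
    (add_le_add le_rfl (H.weight_le_setWeight hx.le e)))

/-- A vertex whose distance stays the same although a hyperedge becomes heavier has a neighbour
with the same property through which the distance is realised. -/
theorem exists_tight_pred (hx : H.weight c ≤ x) {z : Fin n} (hz : z ≠ s) (hzd : H.dist s z ≠ ∞)
    (hd : (H.setWeight c x).dist s z = H.dist s z) :
    ∃ q f, q ≠ z ∧ q ∈ H.edge f ∧ z ∈ H.edge f ∧ (H.setWeight c x).dist s q = H.dist s q ∧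
      H.dist s q + (H.setWeight c x).weight f = H.dist s z := by
  obtain ⟨q, f, h1, h2, h3, h4⟩ := exists_pred (H.setWeight c x) hz (by rwa [hd])
  have h5 : H.dist s z ≤ H.dist s q + H.weight f := H.dist_le_add h2 h3
  have h6 := H.dist_le_dist_setWeight hx s q
  have h7 := H.weight_le_setWeight hx f
  rw [hd] at h4
  have h8 : H.dist s q + (H.setWeight c x).weight f = H.dist s z :=
    le_antisymm ((add_le_add h6 le_rfl).trans h4) (h5.trans (add_le_add le_rfl h7))
  refine ⟨q, f, h1, h2, h3, le_antisymm ?_ h6, h8⟩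
  -- A finite weight can be cancelled, which turns the comparison at `z` into one at `q`.
  have h9 : (H.setWeight c x).weight f ≠ ∞ := fun h => hzd (by rw [← h8, h, add_top])
  rw [← h8] at h4
  exact (ENNReal.add_le_add_iff_right h9).1 h4

/-- If some vertex is affected, then so is some vertex of the changed hyperedge. -/
theorem IsShortestPathData.exists_affected_mem (hd : H.IsShortestPathData s D P E)
    (hA : (H.affected (H.setWeight c x) s P E).Nonempty) :
    ∃ v ∈ H.edge c, v ∈ H.affected (H.setWeight c x) s P E := by
  by_contra! hcon
  obtain ⟨v, hv⟩ := hA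
  rcases le_or_gt x (H.weight c) with hx | hx
  -- Decrease: the old distances stay feasible for the new weights, because on `c` they coincide
  -- with the new distances.
  · have h1 : ∀ v, (H.setWeight c x).dist s v = H.dist s v := by
      refine fun v => le_antisymm (H.dist_setWeight_le_dist hx s v)
        ((H.setWeight c x).le_dist (H.dist_self s) (fun e u v hu hv => ?_) v)
      by_cases he : e = c
      · subst he
        rw [← dist_eq_of_notMem_affected (hcon v hv), ← dist_eq_of_notMem_affected (hcon u hu)]
        exact dist_le_add (H.setWeight e x) hu hv
      · have : (H.setWeight c x).weight e = H.weight e := by simp [setWeight, he]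
        rw [this]
        exact H.dist_le_add hu hv
    rcases mem_affected.1 hv with h2 | ⟨p, e, h2, h3, h4⟩
    · exact h2 (h1 v)
    · obtain ⟨-, -, e', h5, h6, h7, h8⟩ := hd.of_parent h2
      rw [h3, Option.some.injEq] at h5
      subst h5
      refine h4 (le_antisymm ?_ (dist_le_add (H.setWeight c x) h6 h7))
      rw [h1, h1, ← h8]
      exact add_le_add le_rfl (H.setWeight_weight_le hx e)
  -- Increase: no edge of the relationship tree uses `c`, so induction along the tree shows that
  -- every finite distance is still attained.
  · have h0 : ∀ {v p e}, P v = some p → E v = some e → e ≠ c := by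
      rintro v p e hp he rfl
      obtain ⟨-, -, e', h5, -, h7, -⟩ := hd.of_parent hp
      rw [he, Option.some.injEq] at h5
      subst h5
      exact hcon v h7 (hd.affected_of_edge hx he)
    have h0' : ∀ {e}, e ≠ c → (H.setWeight c x).weight e = H.weight e := fun he => by
      simp [setWeight, he]
    have h1 : ∀ v, (H.setWeight c x).dist s v = H.dist s v := by
      intro v
      refine le_antisymm ?_ (H.dist_le_dist_setWeight hx.le s v)
      by_cases hv : D v = ∞
      · rw [← hd.1 v, hv]
        exact le_top
      have h2 := hd.2.2.2 v hv
      clear hv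
      induction h2 using Relation.ReflTransGen.head_induction_on with
      | refl => rw [dist_self, dist_self]
      | head hab _ ih =>
        obtain ⟨-, -, e, h5, h6, h7, h8⟩ := hd.of_parent hab
        rw [← h8, ← h0' (h0 hab h5)]
        exact (dist_le_add (H.setWeight c x) h6 h7).trans (add_le_add ih le_rfl)
    rcases mem_affected.1 hv with h2 | ⟨p, e, h2, h3, h4⟩
    · exact h2 (h1 v)
    · obtain ⟨-, -, e', h5, h6, h7, h8⟩ := hd.of_parent h2
      rw [h3, Option.some.injEq] at h5
      subst h5
      exact h4 (by rw [h1, h1, h0' (h0 h2 h3), h8])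

end WeightedHypergraph

/-! # Scans and the distance updates -/

namespace Mem

variable {n m : ℕ}

/-- The parts of the memory that describe the hypergraph and its underlying graph are the same. -/
structure SameStatic (M M₀ : Mem n m) : Prop where
  verts : M.verts = M₀.verts
  inc : M.inc = M₀.inc
  weight : M.weight = M₀.weight
  adj : M.adj = M₀.adj
  edgeWeight : M.edgeWeight = M₀.edgeWeight

theorem SameStatic.refl (M : Mem n m) : M.SameStatic M := ⟨rfl, rfl, rfl, rfl, rfl⟩

theorem SameStatic.trans {M M₁ M₀ : Mem n m} (h : M.SameStatic M₁) (h' : M₁.SameStatic M₀) :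
    M.SameStatic M₀ :=
  ⟨h.1.trans h'.1, h.2.trans h'.2, h.3.trans h'.3, h.4.trans h'.4, h.5.trans h'.5⟩

end Mem

namespace DSP

open Prog

variable {n m : ℕ}

theorem runs_onQueue {α : Type} {p : Prog (FibHeap n) α} {M : Mem n m} {N : ℕ}
    {Q : α → Mem n m → ℕ → Prop}
    (h : Runs p M.queue N fun a q N' => Q a { M with queue := q } N') :
    Runs (onQueue p) M N Q := by
  obtain ⟨a, q, t, h1, h2, h3⟩ := h
  refine ⟨a, { M with queue := q }, t, ?_, h2, h3⟩
  unfold onQueue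
  rw [h1]
  rfl

/-- The visits of a scan of `z`. -/
def visits (a : Variant) (M : Mem n m) (z : Fin n) : List (Fin n × Fin m × ℝ≥0∞) :=
  match a with
  | Variant.HE => (M.inc z).flatMap fun e => (M.verts e).map fun v => (v, e, M.weight e)
  | Variant.DR => (M.adj z).flatMap fun v => ((M.edgeWeight z v).map fun t => (v, t)).toList

/-- A bound for the number of steps of a scan of `z`, up to a factor. -/
def scanCost (a : Variant) (M : Mem n m) (z : Fin n) : ℕ :=
  match a with
  | Variant.HE => 1 + ((M.inc z).map fun e => 1 + (M.verts e).length).sum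
  | Variant.DR => 1 + (M.adj z).length

/-- One rule for both variants. The fixed memory `M₀` supplies the lists, which the visits do not
alter; `k` is the amortized cost of a visit, and 5 more per unit of `scanCost` cover the traversal.
The invariant `J` sees the visits still to come. -/
theorem runs_scan {β : Type} {a : Variant} {z : Fin n} {b : β}
    {f : β → Fin n → Fin m → ℝ≥0∞ → Prog (Mem n m) β} {M M₀ : Mem n m} {N : ℕ}
    {Q : β → Mem n m → ℕ → Prop} (J : List (Fin n × Fin m × ℝ≥0∞) → β → Mem n m → Prop)
    (k R : ℕ) (hS : M.SameStatic M₀) (hJ : J (visits a M₀ z) b M)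
    (hN : M.queue.potential + (k + 5) * scanCost a M₀ z + R ≤ N)
    (hf : ∀ v e x l b M N R, (v, e, x) ∈ visits a M₀ z → M.SameStatic M₀ →
      J ((v, e, x) :: l) b M → M.queue.potential + k + R ≤ N →
      Runs (f b v e x) M N fun b' M' N' =>
        M'.SameStatic M₀ ∧ J l b' M' ∧ M'.queue.potential + R ≤ N')
    (hQ : ∀ b M N, M.SameStatic M₀ → J [] b M → M.queue.potential + R ≤ N → Q b M N) :
    Runs (scan a z b f) M N Q := by
  cases a with
  | HE =>
    simp only [scanCost] at hN
    have hpos : 1 ≤ N := by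
      have : (k + 5) * 1 ≤ (k + 5) * (1 + ((M₀.inc z).map fun e => 1 + (M₀.verts e).length).sum) :=
        Nat.mul_le_mul_left _ (by omega)
      omega
    refine runs_read_bind hpos ?_
    rw [hS.inc]
    refine runs_foldEach_cost
      (fun es b M => M.SameStatic M₀ ∧ (∀ e ∈ es, e ∈ M₀.inc z) ∧
        J (es.flatMap fun e => (M₀.verts e).map fun v => (v, e, M₀.weight e)) b M)
      (fun M => M.queue.potential) (fun e => 3 + (k + 1) * (M₀.verts e).length) R
      ⟨hS, fun _ h => h, hJ⟩ ?_ ?_ ?_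
    · have h1 : ∀ es : List (Fin m), (es.map fun e => 3 + (k + 1) * (M₀.verts e).length).sum +
          es.length ≤ (k + 5) * (es.map fun e => 1 + (M₀.verts e).length).sum := by
        intro es
        induction es with
        | nil => simp
        | cons e es ih =>
          simp only [List.map_cons, List.sum_cons, List.length_cons]
          have : (k + 1) * (M₀.verts e).length ≤ (k + 5) * (M₀.verts e).length :=
            Nat.mul_le_mul_right _ (by omega)
          rw [mul_add, mul_add]
          omega
      have h2 := h1 (M₀.inc z)
      rw [mul_add] at hN
      omega
    · rintro e es b M N R ⟨hS, hes, hJ⟩ hN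
      refine runs_read_bind (by omega) (runs_read_bind (by omega) ?_)
      rw [hS.verts, hS.weight]
      refine runs_foldEach_cost
        (fun vs b M => M.SameStatic M₀ ∧ (∀ v ∈ vs, v ∈ M₀.verts e) ∧
          J ((vs.map fun v => (v, e, M₀.weight e)) ++
            es.flatMap fun e => (M₀.verts e).map fun v => (v, e, M₀.weight e)) b M)
        (fun M => M.queue.potential) (fun _ => k) R ⟨hS, fun _ h => h, by simpa using hJ⟩ ?_ ?_ ?_
      · simp only [List.map_const', List.sum_replicate, smul_eq_mul]
        rw [add_mul, one_mul, mul_comm k] at hN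
        omega
      · rintro v vs b M N R ⟨hS, hvs, hJ⟩ hN
        refine (hf v e (M₀.weight e) _ b M N R ?_ hS hJ hN).mono ?_
        · simp only [visits, List.mem_flatMap, List.mem_map]
          exact ⟨e, hes e (by simp), v, hvs v (by simp), rfl⟩
        · rintro b' M' N' ⟨h1, h2, h3⟩
          exact ⟨⟨h1, fun w hw => hvs w (by simp [hw]), h2⟩, h3⟩
      · rintro b M N ⟨hS, -, hJ⟩ hN
        exact ⟨⟨hS, fun e' he' => hes e' (by simp [he']), by simpa using hJ⟩, hN⟩
    · rintro b M N ⟨hS, -, hJ⟩ hN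
      exact hQ b M N hS hJ hN
  | DR =>
    simp only [scanCost] at hN
    rw [mul_add, mul_one] at hN
    refine runs_read_bind (by omega) ?_
    rw [hS.adj]
    refine runs_foldEach_cost
      (fun vs b M => M.SameStatic M₀ ∧ (∀ v ∈ vs, v ∈ M₀.adj z) ∧
        J (vs.flatMap fun v => ((M₀.edgeWeight z v).map fun t => (v, t)).toList) b M)
      (fun M => M.queue.potential) (fun _ => k + 1) R ⟨hS, fun _ h => h, hJ⟩ ?_ ?_ ?_
    · simp only [List.map_const', List.sum_replicate, smul_eq_mul]
      rw [add_mul, mul_comm k] at hN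
      rw [mul_add, mul_one]
      omega
    · rintro v vs b M N R ⟨hS, hvs, hJ⟩ hN
      refine runs_read_bind (by omega) ?_
      rw [hS.edgeWeight]
      simp only [List.flatMap_cons] at hJ
      cases ht : M₀.edgeWeight z v with
      | none =>
        rw [ht] at hJ
        exact runs_pure ⟨⟨hS, fun w hw => hvs w (by simp [hw]), by simpa using hJ⟩, by omega⟩
      | some t =>
        obtain ⟨e, x⟩ := t
        rw [ht] at hJ
        refine (hf v e x _ b M (N - 1) R ?_ hS (by simpa using hJ) (by omega)).mono ?_
        · simp only [visits, List.mem_flatMap]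
          exact ⟨v, hvs v (by simp), by simp [ht]⟩
        · rintro b' M' N' ⟨h1, h2, h3⟩
          exact ⟨⟨h1, fun w hw => hvs w (by simp [hw]), h2⟩, h3⟩
    · rintro b M N ⟨hS, -, hJ⟩ hN
      exact hQ b M N hS hJ hN

theorem runs_enqueueOrUpdate {M : Mem n m} (hI : M.queue.Inv) {v : Fin n}
    (hv : M.queue.mem v → M.D v ≤ M.queue.key v) {N R : ℕ}
    (hN : M.queue.potential + 82 + R ≤ N) :
    Runs (enqueueOrUpdate v) M N fun _ M' N' => ∃ q : FibHeap n, M' = { M with queue := q } ∧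
      q.Inv ∧ q.mem = Function.update M.queue.mem v true ∧
      q.key = Function.update M.queue.key v (M.D v) ∧ q.potential + R ≤ N' := by
  unfold enqueueOrUpdate
  refine runs_read_bind (by omega) (runs_read_bind (by omega) ?_)
  cases hm : M.queue.mem v with
  | true =>
    refine runs_onQueue ((FibHeap.runs_decreaseKey hI hm (hv hm) (R := R) (by omega)).mono ?_)
    rintro _ q N' ⟨h1, h2, h3, h4⟩
    exact ⟨q, rfl, h1, by rw [h2, ← hm, Function.update_eq_self], h3, h4⟩
  | false =>
    refine runs_onQueue ((FibHeap.runs_insert hI hm (M.D v) (R := R) (by omega)).mono ?_)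
    rintro _ q N' ⟨h1, h2, h3, h4⟩
    exact ⟨q, rfl, h1, h2, h3, h4⟩

/-- The update of `D[v]` when `v` is visited from `z` through the hyperedge `e` of weight `x`. -/
noncomputable def relax (z v : Fin n) (e : Fin m) (x : ℝ≥0∞) : Prog (Mem n m) Unit := do
  let dz ← read fun M => M.D z
  let dv ← read fun M => M.D v
  if dz + x < dv then
    setPath v (dz + x) (some z) (some e)
    enqueueOrUpdate v
  else
    pure ()

/-- The state of the distance updates: `ℓ` is a lower bound for the distances that they cannot
improve, `A` contains all vertices that they can reach, and `done` are the vertices that have been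
dequeued. -/
structure Updating (ℓ : Fin n → ℝ≥0∞) (A done : Finset (Fin n)) (M : Mem n m) : Prop where
  inv : M.queue.Inv
  key : ∀ v, M.queue.mem v → M.queue.key v = M.D v
  mem : ∀ v, M.queue.mem v → v ∈ A
  le : ∀ v, ℓ v ≤ M.D v
  ge : ∀ v, v ∉ A → M.D v ≤ ℓ v
  done_le : ∀ u ∈ done, ∀ v, M.queue.mem v → M.D u ≤ M.D v
  done_notMem : ∀ u ∈ done, M.queue.mem u = false

/-- An improved `v` satisfies D[v] > D[z] + x. It is not a dequeued vertex, since these have D at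
most D[z]. It lies in `A`, since otherwise D[v] ≤ ℓ(v) ≤ ℓ(z) + x ≤ D[z] + x. -/
theorem runs_relax {ℓ : Fin n → ℝ≥0∞} {A done : Finset (Fin n)} {M : Mem n m}
    (hU : Updating ℓ A done M) {z v : Fin n} {x : ℝ≥0∞} (e : Fin m)
    (hz : ∀ u ∈ done, M.D u ≤ M.D z) (hℓ : ℓ v ≤ ℓ z + x) {N R : ℕ}
    (hN : M.queue.potential + 85 + R ≤ N) :
    Runs (relax z v e x) M N fun _ M' N' => M'.SameStatic M ∧ M'.colour = M.colour ∧
      M'.seen = M.seen ∧ Updating ℓ A done M' ∧ (∀ u ∈ done, M'.D u ≤ M'.D z) ∧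
      M'.queue.potential + R ≤ N' := by
  unfold relax
  refine runs_read_bind (by omega) (runs_read_bind (by omega) ?_)
  by_cases hlt : M.D z + x < M.D v
  · rw [if_pos hlt]
    obtain ⟨h1, h2, h3, h4, h5, h6, h7⟩ := hU
    have hzv : z ≠ v := by
      rintro rfl
      exact absurd hlt (not_lt.2 le_self_add)
    have hdv : ∀ u ∈ done, u ≠ v := by
      rintro u hu rfl
      exact absurd hlt (not_lt.2 ((hz u hu).trans le_self_add))
    have hvA : v ∈ A := by
      by_contra hvA
      exact absurd hlt (not_lt.2 ((h5 v hvA).trans (hℓ.trans (add_le_add (h4 z) le_rfl))))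
    refine runs_write_bind (by omega) ?_
    refine (runs_enqueueOrUpdate (R := R) (M := { M with
      D := Function.update M.D v (M.D z + x)
      P := Function.update M.P v (some z)
      E := Function.update M.E v (some e) }) h1 (fun hm => ?_) ?_).mono ?_
    · simp only [Function.update_self]
      rw [h2 v hm]
      exact hlt.le
    · dsimp only
      omega
    · rintro _ _ N' ⟨q, rfl, h8, h9, h10, h11⟩
      simp only [Function.update_self] at h9 h10
      refine ⟨⟨rfl, rfl, rfl, rfl, rfl⟩, rfl, rfl, ⟨h8, ?_, ?_, ?_, ?_, ?_, ?_⟩, ?_, h11⟩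
      · intro w hw
        dsimp only at hw ⊢
        rw [h9] at hw
        rw [h10]
        by_cases hwv : w = v
        · simp [hwv]
        · simp only [Function.update_of_ne hwv] at hw ⊢
          exact h2 w hw
      · intro w hw
        dsimp only at hw
        rw [h9] at hw
        by_cases hwv : w = v
        · rwa [hwv]
        · simp only [Function.update_of_ne hwv] at hw
          exact h3 w hw
      · intro w
        by_cases hwv : w = v
        · subst hwv
          simp only [Function.update_self]
          exact hℓ.trans (add_le_add (h4 z) le_rfl)
        · simp only [Function.update_of_ne hwv]
          exact h4 w
      · intro w hw
        have hwv : w ≠ v := by rintro rfl; exact hw hvA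
        simp only [Function.update_of_ne hwv]
        exact h5 w hw
      · intro u hu w hw
        dsimp only at hw ⊢
        rw [h9] at hw
        rw [Function.update_of_ne (hdv u hu)]
        by_cases hwv : w = v
        · subst hwv
          rw [Function.update_self]
          exact (hz u hu).trans le_self_add
        · simp only [Function.update_of_ne hwv] at hw ⊢
          exact h6 u hu w hw
      · intro u hu
        dsimp only
        rw [h9, Function.update_of_ne (hdv u hu)]
        exact h7 u hu
      · intro u hu
        simp only [Function.update_of_ne (hdv u hu), Function.update_of_ne hzv]
        exact hz u hu
  · rw [if_neg hlt]
    exact runs_pure ⟨.refl M, rfl, rfl, hU, hz, by omega⟩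

/-- A bound for the amortized number of steps for dequeuing and scanning `z` once when at most the
vertices of `A` are in the queue. -/
def roundCost (a : Variant) (M : Mem n m) (A : Finset (Fin n)) (z : Fin n) : ℕ :=
  70 * (Nat.log 2 A.card + 1) + 200 * scanCost a M z

theorem log_size_le {h : FibHeap n} {A : Finset (Fin n)} (hA : ∀ v, h.mem v → v ∈ A) :
    Nat.log 2 h.size ≤ Nat.log 2 A.card :=
  Nat.log_mono_right (Finset.card_le_card fun v hv => hA v (Finset.mem_filter.1 hv).2)

theorem sum_sdiff_insert {f : Fin n → ℕ} {A done : Finset (Fin n)} {z : Fin n} (hz : z ∈ A)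
    (hz' : z ∉ done) : ∑ v ∈ A \ done, f v = f z + ∑ v ∈ A \ Insert.insert z done, f v := by
  rw [Finset.sdiff_insert, Finset.add_sum_erase _ f (Finset.mem_sdiff.2 ⟨hz, hz'⟩)]

/-- Dijkstra's argument in amortized form: a dequeued vertex joins `done`, never returns to the
queue, and is paid for by its own summand. The logarithmic term outside the sum pays for the last
extraction, which finds the queue empty. -/
theorem runs_decreaseStep2 {a : Variant} {ℓ : Fin n → ℝ≥0∞} {A : Finset (Fin n)}
    {M M₀ : Mem n m} (hS : M.SameStatic M₀) (hU : Updating ℓ A ∅ M)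
    (hℓ : ∀ z v e x, (v, e, x) ∈ visits a M₀ z → ℓ v ≤ ℓ z + x) {N R : ℕ}
    (hN : M.queue.potential + ∑ z ∈ A, roundCost a M₀ A z + 70 * (Nat.log 2 A.card + 1) + R ≤ N) :
    Runs (decreaseStep2 a) M N fun _ M' N' => M'.SameStatic M₀ ∧ M'.colour = M.colour ∧
      M'.seen = M.seen ∧ M'.queue.Clean ∧ R ≤ N' := by
  unfold decreaseStep2
  refine runs_repeatUntilNone (fun _ M' N' => ∃ done, M'.SameStatic M₀ ∧ M'.colour = M.colour ∧
      M'.seen = M.seen ∧ Updating ℓ A done M' ∧ M'.queue.potential +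
      ∑ z ∈ A \ done, roundCost a M₀ A z + 70 * (Nat.log 2 A.card + 1) + R ≤ N')
    ?_ ⟨∅, hS, rfl, rfl, hU, by simpa using hN⟩
  rintro _ M' N' ⟨done, hS', hc, hs, hU', hN'⟩
  have hlog := log_size_le hU'.mem
  refine ⟨by omega, runs_bind (runs_onQueue ?_)⟩
  -- Extraction takes 60 of the 70 logarithmic units; one credit out of the other 10 has gone to the
  -- loop.
  refine (FibHeap.runs_extractMin hU'.inv (R := ∑ z ∈ A \ done, roundCost a M₀ A z +
    10 * (Nat.log 2 A.card + 1) - 1 + R) (by omega)).mono ?_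
  rintro z? q N'' h
  cases z? with
  | none =>
    obtain ⟨h1, rfl, h2⟩ := h
    exact runs_pure ⟨hS', hc, hs, h1, by omega⟩
  | some z =>
    obtain ⟨h1, h2, h3, h4, h5, h6⟩ := h
    have hzA := hU'.mem z h1
    have hzd : z ∉ done := fun hz => by simp [hU'.done_notMem z hz] at h1
    have hmem : ∀ v, q.mem v → M'.queue.mem v := by
      intro v hv
      rw [h4] at hv
      by_cases hvz : v = z
      · simp [hvz] at hv
      · rwa [Function.update_of_ne hvz] at hv
    rw [sum_sdiff_insert hzA hzd] at h6
    have hU'' : Updating ℓ A (Insert.insert z done) { M' with queue := q } := by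
      refine ⟨h3, fun v hv => ?_, fun v hv => hU'.mem v (hmem v hv), hU'.le, hU'.ge, ?_, ?_⟩
      · dsimp only
        rw [h5]
        exact hU'.key v (hmem v hv)
      · intro u hu v hv
        rcases Finset.mem_insert.1 hu with rfl | hu
        · have := h2 v (hmem v hv)
          rwa [hU'.key _ h1, hU'.key v (hmem v hv)] at this
        · exact hU'.done_le u hu v (hmem v hv)
      · intro u hu
        dsimp only
        rw [h4]
        rcases Finset.mem_insert.1 hu with rfl | hu
        · simp
        · by_cases huz : u = z
          · simp [huz]
          · rw [Function.update_of_ne huz]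
            exact hU'.done_notMem u hu
    have hcost : roundCost a M₀ A z = 70 * (Nat.log 2 A.card + 1) + 200 * scanCost a M₀ z := rfl
    refine runs_bind (runs_scan (M₀ := M₀) (fun _ _ M₁ => M₁.colour = M.colour ∧
      M₁.seen = M.seen ∧ Updating ℓ A (Insert.insert z done) M₁ ∧
      ∀ u ∈ Insert.insert z done, M₁.D u ≤ M₁.D z) 85
      (∑ v ∈ A \ Insert.insert z done, roundCost a M₀ A v + 70 * (Nat.log 2 A.card + 1) + R)
      ⟨hS'.1, hS'.2, hS'.3, hS'.4, hS'.5⟩ ⟨hc, hs, hU'', ?_⟩ (by dsimp only; omega) ?_ ?_)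
    · intro u hu
      rcases Finset.mem_insert.1 hu with rfl | hu
      · exact le_rfl
      · exact hU'.done_le u hu z h1
    · rintro v e x - - M₁ N₁ R₁ hv hS₁ ⟨h7, h8, h9, h10⟩ hN₁
      refine (runs_relax h9 e h10 (hℓ z v e x hv) hN₁).mono ?_
      rintro _ M₂ N₂ ⟨h11, h12, h13, h14, h15, h16⟩
      exact ⟨h11.trans hS₁, ⟨h12.trans h7, h13.trans h8, h14, h15⟩, h16⟩
    · rintro _ M₁ N₁ hS₁ ⟨h7, h8, h9, h10⟩ hN₁
      exact runs_pure ⟨_, hS₁, h7, h8, h9, by omega⟩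

end DSP

/-! # Weight decrease and weight increase -/

namespace DSP

open Prog

variable {n m : ℕ}

theorem runs_argminD (c : Fin m) {M : Mem n m} {N R : ℕ}
    (hN : 2 * (M.verts c).length + 2 + R ≤ N) :
    Runs (argminD c) M N fun x? M' N' => M' = M ∧ (∀ x, x? = some x → x ∈ M.verts c) ∧
      R ≤ N' := by
  unfold argminD
  refine runs_read_bind (by omega) ?_
  refine runs_foldEach_cost (fun l x? M' => M' = M ∧ (∀ x, x? = some x → x ∈ M.verts c) ∧
    ∀ v ∈ l, v ∈ M.verts c) (fun _ => 0) (fun _ => 1) R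
    ⟨rfl, by simp, fun _ h => h⟩ ?_ ?_ ?_
  · simp only [List.map_const', List.sum_replicate, smul_eq_mul]
    omega
  · rintro v l x? _ N R ⟨rfl, h1, h2⟩ hN
    cases x? with
    | none =>
      refine runs_pure ⟨⟨rfl, ?_, fun w hw => h2 w (by simp [hw])⟩, by omega⟩
      rintro x ⟨⟩
      exact h2 v (by simp)
    | some x =>
      refine runs_read_bind (by omega) (runs_pure ⟨⟨rfl, ?_, fun w hw => h2 w (by simp [hw])⟩,
        by omega⟩)
      rintro y hy
      rw [Option.some.injEq] at hy
      subst hy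
      split_ifs
      · exact h2 v (by simp)
      · exact h1 x rfl
  · rintro x? _ N ⟨rfl, h1, -⟩ hN
    exact ⟨rfl, h1, by omega⟩

/-- For the time bound it only matters that the chosen vertex lies in `c`; its minimality is not
needed, because no vertex has been dequeued yet. The loop body is `relax` by definition. -/
theorem runs_decreaseStep1 {c : Fin m} {x : ℝ≥0∞} {ℓ : Fin n → ℝ≥0∞} {A : Finset (Fin n)}
    {M : Mem n m} (hU : Updating ℓ A ∅ M)
    (hℓ : ∀ u ∈ M.verts c, ∀ v ∈ M.verts c, ℓ v ≤ ℓ u + x) {N R : ℕ}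
    (hN : M.queue.potential + 88 * (M.verts c).length + 4 + R ≤ N) :
    Runs (decreaseStep1 c x) M N fun _ M' N' => M'.SameStatic M ∧ M'.colour = M.colour ∧
      M'.seen = M.seen ∧ Updating ℓ A ∅ M' ∧ M'.queue.potential + R ≤ N' := by
  unfold decreaseStep1
  refine runs_bind ((runs_argminD c (R := M.queue.potential + 86 * (M.verts c).length + 2 + R)
    (by omega)).mono ?_)
  rintro u? _ N' ⟨rfl, h1, hN'⟩
  rename_i M
  cases u? with
  | none => exact runs_pure ⟨.refl M, rfl, rfl, hU, by omega⟩
  | some u =>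
    refine runs_read_bind (by omega) ?_
    refine runs_foldEach_cost (fun l _ M' => M'.SameStatic M ∧ M'.colour = M.colour ∧
      M'.seen = M.seen ∧ Updating ℓ A ∅ M' ∧ ∀ v ∈ l, v ∈ M.verts c)
      (fun M => M.queue.potential) (fun _ => 85) R ⟨.refl M, rfl, rfl, hU, fun _ h => h⟩ ?_ ?_ ?_
    · simp only [List.map_const', List.sum_replicate, smul_eq_mul]
      omega
    · rintro v l _ M' N R ⟨h2, h3, h4, h5, h6⟩ hN
      refine (runs_relax (z := u) (v := v) h5 c (by simp)
        (hℓ u (h1 u rfl) v (h6 v (by simp))) hN).mono ?_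
      rintro _ M'' N'' ⟨h7, h8, h9, h10, -, h11⟩
      exact ⟨⟨h7.trans h2, h8.trans h3, h9.trans h4, h10, fun w hw => h6 w (by simp [hw])⟩, h11⟩
    · rintro _ M' N ⟨h2, h3, h4, h5, -⟩ hN
      exact ⟨h2, h3, h4, h5, hN⟩

/-- The visits of the scans are those of the hypergraph `H`. -/
structure VisitsOK (a : Variant) (M : Mem n m) (H : WeightedHypergraph n m) : Prop where
  sound : ∀ z v e y, (v, e, y) ∈ visits a M z → z ∈ H.edge e ∧ v ∈ H.edge e ∧ y = H.weight e
  complete : ∀ z q f, q ≠ z → q ∈ H.edge f → z ∈ H.edge f →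
    ∃ e y, (q, e, y) ∈ visits a M z ∧ y ≤ H.weight f

/-- The state of the colouring process for a change of the weight of `c` to `x`, where `P₀` and `E₀`
are the initial parent data. -/
structure Colouring (H : WeightedHypergraph n m) (s : Fin n) (c : Fin m) (x : ℝ≥0∞)
    (P₀ : Fin n → Option (Fin n)) (E₀ : Fin n → Option (Fin m)) (M : Mem n m) : Prop where
  dist : ∀ v, M.D v = H.dist s v
  inv : M.queue.Inv
  mem : ∀ v, M.queue.mem v = true ↔ M.colour v = Colour.queued
  seen : ∀ v, v ∈ M.seen ↔ M.colour v ≠ Colour.white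
  nodup : M.seen.Nodup
  affected : ∀ v, M.colour v ≠ Colour.white →
    v ∈ H.affected (H.setWeight c x) s P₀ E₀ ∧ v ≠ s ∧ H.dist s v ≠ ∞
  white : ∀ v, M.colour v = Colour.white → M.P v = P₀ v
  red : ∀ v, M.colour v = Colour.red → (H.setWeight c x).dist s v ≠ H.dist s v

/-! ### The colouring process and the reset of the red vertices -/

variable {H : WeightedHypergraph n m} {s : Fin n} {c : Fin m} {x : ℝ≥0∞}
  {P₀ : Fin n → Option (Fin n)} {E₀ : Fin n → Option (Fin m)}

theorem runs_enqueueForColouring {M : Mem n m} (hC : Colouring H s c x P₀ E₀ M) {v : Fin n}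
    (hv : M.colour v = Colour.white)
    (hvA : v ∈ H.affected (H.setWeight c x) s P₀ E₀ ∧ v ≠ s ∧ H.dist s v ≠ ∞) {N R : ℕ}
    (hN : M.queue.potential + 16 + R ≤ N) :
    Runs (enqueueForColouring v) M N fun _ M' N' => M'.SameStatic M ∧
      Colouring H s c x P₀ E₀ M' ∧ M'.E = M.E ∧
      M'.colour = Function.update M.colour v Colour.queued ∧ M'.queue.potential + R ≤ N' := by
  have hm : M.queue.mem v = false := by
    rw [← Bool.not_eq_true, hC.mem, hv]
    simp
  unfold enqueueForColouring
  refine runs_write_bind (by omega) (runs_read_bind (by omega) (runs_onQueue ?_))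
  refine (FibHeap.runs_insert hC.inv hm (M.D v) (R := R) (by omega)).mono ?_
  rintro _ q N' ⟨h1, h2, h3, h4⟩
  refine ⟨⟨rfl, rfl, rfl, rfl, rfl⟩, ⟨hC.dist, h1, ?_, ?_, ?_, ?_, ?_, ?_⟩, rfl, rfl, h4⟩
  · intro w
    dsimp only
    rw [h2]
    by_cases hwv : w = v
    · simp [hwv]
    · simpa [Function.update_of_ne hwv] using hC.mem w
  · intro w
    by_cases hwv : w = v
    · simp [hwv]
    · simpa [Function.update_of_ne hwv, hwv] using hC.seen w
  · refine List.nodup_cons.2 ⟨fun h => (hC.seen v).1 h hv, hC.nodup⟩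
  · intro w hw
    by_cases hwv : w = v
    · rwa [hwv]
    · simp only [Function.update_of_ne hwv] at hw
      exact hC.affected w hw
  · intro w hw
    by_cases hwv : w = v
    · simp [hwv] at hw
    · simp only [Function.update_of_ne hwv] at hw
      exact hC.white w hw
  · intro w hw
    by_cases hwv : w = v
    · simp [hwv] at hw
    · simp only [Function.update_of_ne hwv] at hw
      exact hC.red w hw

theorem runs_increaseStep1 {M : Mem n m} {D : Fin n → ℝ≥0∞}
    (hd : H.IsShortestPathData s D P₀ E₀) (hx : H.weight c < x)
    (hC : Colouring H s c x P₀ E₀ M) (hE : M.E = E₀) (hnd : (M.verts c).Nodup)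
    (hw : ∀ v, M.colour v = Colour.white) {N R : ℕ}
    (hN : M.queue.potential + 18 * (M.verts c).length + 2 + R ≤ N) :
    Runs (increaseStep1 c) M N fun _ M' N' => M'.SameStatic M ∧
      Colouring H s c x P₀ E₀ M' ∧ M'.queue.potential + R ≤ N' := by
  unfold increaseStep1
  refine runs_read_bind (by omega) ?_
  refine runs_foldEach_cost (fun l _ M' => M'.SameStatic M ∧ Colouring H s c x P₀ E₀ M' ∧
    M'.E = E₀ ∧ l.Nodup ∧ ∀ v ∈ l, M'.colour v = Colour.white) (fun M => M.queue.potential)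
    (fun _ => 17) R ⟨.refl M, hC, hE, hnd, fun v _ => hw v⟩ ?_ ?_ ?_
  · simp only [List.map_const', List.sum_replicate, smul_eq_mul]
    omega
  · rintro v l _ M' N R ⟨h1, h2, h3, h4, h5⟩ hN
    rw [List.nodup_cons] at h4
    refine runs_read_bind (by omega) ?_
    rw [h3]
    by_cases hv : E₀ v = some c
    · rw [if_pos hv]
      obtain ⟨p, hp⟩ := hd.of_edge hv
      have h6 := hd.of_parent hp
      refine (runs_enqueueForColouring h2 (h5 v (by simp))
        ⟨hd.affected_of_edge hx hv, h6.1, h6.2.1⟩ (R := R) (by omega)).mono ?_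
      rintro _ M'' N'' ⟨h7, h8, h9, h10, h11⟩
      refine ⟨⟨h7.trans h1, h8, h9.trans h3, h4.2, fun w hw => ?_⟩, h11⟩
      have hwv : w ≠ v := by rintro rfl; exact h4.1 hw
      rw [h10, Function.update_of_ne hwv]
      exact h5 w (by simp [hw])
    · rw [if_neg hv]
      exact runs_pure ⟨⟨h1, h2, h3, h4.2, fun w hw => h5 w (by simp [hw])⟩, by omega⟩
  · rintro _ M' N ⟨h1, h2, -⟩ hN
    exact ⟨h1, h2, hN⟩

/-- A dequeued vertex is coloured pink or red. -/
theorem Colouring.recolour {M : Mem n m} (hC : Colouring H s c x P₀ E₀ M) {z : Fin n}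
    (hz : M.queue.mem z) {q : FibHeap n} (hq : q.Inv)
    (hqm : q.mem = Function.update M.queue.mem z false) {col : Colour}
    (hcol : col = Colour.pink ∨ col = Colour.red)
    (hred : col = Colour.red → (H.setWeight c x).dist s z ≠ H.dist s z)
    {P : Fin n → Option (Fin n)} (hP : ∀ v, v ≠ z → P v = M.P v) (E : Fin n → Option (Fin m)) :
    Colouring H s c x P₀ E₀ { M with
      colour := Function.update M.colour z col
      P := P
      E := E
      queue := q } := by
  have hzq := (hC.mem z).1 hz
  have hcol1 : col ≠ Colour.white := by rcases hcol with rfl | rfl <;> simp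
  have hcol2 : col ≠ Colour.queued := by rcases hcol with rfl | rfl <;> simp
  refine ⟨hC.dist, hq, ?_, ?_, hC.nodup, ?_, ?_, ?_⟩
  · intro w
    dsimp only
    rw [hqm]
    by_cases hwz : w = z
    · simp [hwz, hcol2]
    · simpa [Function.update_of_ne hwz] using hC.mem w
  · intro w
    by_cases hwz : w = z
    · have := hC.seen z
      simp_all
    · simpa [Function.update_of_ne hwz] using hC.seen w
  · intro w hw
    by_cases hwz : w = z
    · exact hC.affected w (by rw [hwz, hzq]; simp)
    · simp only [Function.update_of_ne hwz] at hw
      exact hC.affected w hw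
  · intro w hw
    by_cases hwz : w = z
    · simp [hwz, hcol1] at hw
    · simp only [Function.update_of_ne hwz] at hw
      exact (hP w hwz).trans (hC.white w hw)
  · intro w hw
    by_cases hwz : w = z
    · subst hwz
      simp only [Function.update_self] at hw
      exact hred hw
    · simp only [Function.update_of_ne hwz] at hw
      exact hC.red w hw

/-- A vertex for which no visit offers a path of the same length through a nonred vertex is at a
larger distance than before. -/
theorem Colouring.dist_ne {a : Variant} {M M₀ : Mem n m} (hC : Colouring H s c x P₀ E₀ M)
    (hx : H.weight c ≤ x) (hV : VisitsOK a M₀ (H.setWeight c x)) {z : Fin n}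
    (hz : M.colour z ≠ Colour.white)
    (hvis : ∀ q e y, (q, e, y) ∈ visits a M₀ z →
      ¬ (q ≠ z ∧ M.colour q ≠ Colour.red ∧ M.D q + y = M.D z)) :
    (H.setWeight c x).dist s z ≠ H.dist s z := by
  intro hd
  obtain ⟨-, hzs, hzd⟩ := hC.affected z hz
  obtain ⟨q, f, h1, h2, h3, h4, h5⟩ := WeightedHypergraph.exists_tight_pred hx hzs hzd hd
  obtain ⟨e, y, h6, h7⟩ := hV.complete z q f h1 h2 h3
  obtain ⟨h8, h9, rfl⟩ := hV.sound z q e y h6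
  refine hvis q e _ h6 ⟨h1, fun hr => hC.red q hr h4, ?_⟩
  rw [hC.dist, hC.dist]
  refine le_antisymm ((add_le_add le_rfl h7).trans h5.le) ?_
  exact (H.dist_le_add h9 h8).trans (add_le_add le_rfl (H.weight_le_setWeight hx e))

/-- A queued vertex never becomes white again, so it is enqueued and paid for once. Only one
direction is needed of the colours, that red vertices have changed their distance; the order of
extraction plays no role. -/
theorem runs_increaseStep2 {a : Variant} {M M₀ : Mem n m} {D : Fin n → ℝ≥0∞}
    (hd : H.IsShortestPathData s D P₀ E₀) (hx : H.weight c < x)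
    (hV : VisitsOK a M₀ (H.setWeight c x)) (hS : M.SameStatic M₀)
    (hC : Colouring H s c x P₀ E₀ M) {A : Finset (Fin n)}
    (hA : A = H.affected (H.setWeight c x) s P₀ E₀) {N R : ℕ}
    (hN : M.queue.potential + ∑ z ∈ A, roundCost a M₀ A z + 70 * (Nat.log 2 A.card + 1) + R ≤ N) :
    Runs (increaseStep2 a) M N fun _ M' N' => M'.SameStatic M₀ ∧ Colouring H s c x P₀ E₀ M' ∧
      M'.queue.Clean ∧ R ≤ N' := by
  unfold increaseStep2
  refine runs_repeatUntilNone (fun _ M' N' => ∃ done : Finset (Fin n), M'.SameStatic M₀ ∧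
      Colouring H s c x P₀ E₀ M' ∧
      (∀ v ∈ done, M'.colour v ≠ Colour.white ∧ M'.colour v ≠ Colour.queued) ∧
      M'.queue.potential + ∑ z ∈ A \ done, roundCost a M₀ A z +
        70 * (Nat.log 2 A.card + 1) + R ≤ N')
    ?_ ⟨∅, hS, hC, by simp, by simpa using hN⟩
  clear hN N hC hS M
  rintro _ M N ⟨done, hS, hC, hdone, hN⟩
  have hmemA : ∀ v, M.queue.mem v → v ∈ A := by
    intro v hv
    rw [hA]
    exact (hC.affected v (by rw [(hC.mem v).1 hv]; simp)).1
  have hlog := log_size_le hmemA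
  refine ⟨by omega, runs_bind (runs_onQueue ?_)⟩
  refine (FibHeap.runs_extractMin hC.inv (R := ∑ z ∈ A \ done, roundCost a M₀ A z +
    10 * (Nat.log 2 A.card + 1) - 1 + R) (by omega)).mono ?_
  rintro z? q N' h
  cases z? with
  | none =>
    obtain ⟨h1, rfl, h2⟩ := h
    exact runs_pure ⟨hS, hC, h1, by omega⟩
  | some z =>
    obtain ⟨h1, -, h3, h4, -, h6⟩ := h
    have hzA := hmemA z h1
    have hzc := (hC.mem z).1 h1
    have hzd : z ∉ done := fun hz => (hdone z hz).2 hzc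
    rw [sum_sdiff_insert hzA hzd] at h6
    have hcost : roundCost a M₀ A z = 70 * (Nat.log 2 A.card + 1) + 200 * scanCost a M₀ z := rfl
    -- As long as the accumulator is empty, every visit already made has failed; at the end all
    -- have, as `Colouring.dist_ne` requires.
    refine runs_bind (runs_scan (M₀ := M₀) (fun l acc M₁ => M₁ = { M with queue := q } ∧
      (acc = none → ∀ v e y, (v, e, y) ∈ visits a M₀ z → (v, e, y) ∈ l ∨
        ¬ (v ≠ z ∧ M.colour v ≠ Colour.red ∧ M.D v + y = M.D z))) 1
      (∑ v ∈ A \ Insert.insert z done, roundCost a M₀ A v + 70 * (Nat.log 2 A.card + 1) +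
        50 * scanCost a M₀ z + 5 + R)
      ⟨hS.1, hS.2, hS.3, hS.4, hS.5⟩ ⟨rfl, fun _ v e y hv => Or.inl hv⟩
      (by dsimp only; omega) ?_ ?_)
    · rintro v e y l acc _ N₁ R₁ - hS₁ ⟨rfl, hacc⟩ hN₁
      dsimp only at hN₁
      refine runs_read_bind (by omega) (runs_pure ⟨hS₁, ⟨rfl, ?_⟩, by dsimp only; omega⟩)
      dsimp only
      split_ifs with hgood
      · intro h; cases h
      · intro hn v' e' y' hv'
        rw [decide_eq_true_eq] at hgood
        rcases hacc hn v' e' y' hv' with h7 | h7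
        · rcases List.mem_cons.1 h7 with h7 | h7
          · obtain ⟨rfl, rfl, rfl⟩ : v' = v ∧ e' = e ∧ y' = y := by simpa using h7
            exact Or.inr hgood
          · exact Or.inl h7
        · exact Or.inr h7
    · rintro acc _ N₁ - ⟨rfl, hacc⟩ hN₁
      dsimp only at hN₁
      have hdone' : ∀ (col : Colour), col = Colour.pink ∨ col = Colour.red →
          ∀ v ∈ Insert.insert z done, Function.update M.colour z col v ≠ Colour.white ∧
            Function.update M.colour z col v ≠ Colour.queued := by
        intro col hcol v hv
        by_cases hvz : v = z
        · rcases hcol with rfl | rfl <;> simp [hvz]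
        · rw [Function.update_of_ne hvz]
          exact hdone v ((Finset.mem_insert.1 hv).resolve_left hvz)
      cases acc with
      | some t =>
        obtain ⟨q', e'⟩ := t
        refine runs_write_bind (by omega) (runs_pure ?_)
        refine ⟨Insert.insert z done, ⟨hS.1, hS.2, hS.3, hS.4, hS.5⟩,
          hC.recolour h1 h3 h4 (Or.inl rfl) (by simp)
            (P := Function.update M.P z (some q')) (fun v hv => Function.update_of_ne hv _ _) _,
          hdone' _ (Or.inl rfl), ?_⟩
        dsimp only
        omega
      | none =>
        have hne : (H.setWeight c x).dist s z ≠ H.dist s z := by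
          refine hC.dist_ne hx.le hV (by rw [hzc]; simp) fun v e y hv => ?_
          exact (hacc rfl v e y hv).resolve_left (by simp)
        refine runs_write_bind (by omega) (runs_bind ?_)
        refine runs_scan (M₀ := M₀) (fun _ _ M₁ => Colouring H s c x P₀ E₀ M₁ ∧
          ∀ v ∈ Insert.insert z done, M₁.colour v ≠ Colour.white ∧ M₁.colour v ≠ Colour.queued) 17
          (∑ v ∈ A \ Insert.insert z done, roundCost a M₀ A v + 70 * (Nat.log 2 A.card + 1) + R)
          ⟨hS.1, hS.2, hS.3, hS.4, hS.5⟩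
          ⟨hC.recolour h1 h3 h4 (Or.inr rfl) (fun _ => hne) (P := M.P) (fun _ _ => rfl) _,
            hdone' _ (Or.inr rfl)⟩ (by dsimp only; omega) ?_ ?_
        · rintro v e y l _ M₁ N₂ R₂ - hS₁ ⟨hC₁, hdone₁⟩ hN₂
          refine runs_read_bind (by omega) ?_
          by_cases hch : M₁.P v = some z ∧ M₁.colour v = Colour.white
          · rw [if_pos (by simpa using hch)]
            -- Parents are rewritten only for pink vertices, so a white child of `z` was its child
            -- initially and is affected together with `z`.
            have hP := (hC₁.white v hch.2).symm.trans hch.1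
            have h7 := hd.of_parent hP
            refine (runs_enqueueForColouring hC₁ hch.2
              ⟨hd.affected_of_parent hx hP hne, h7.1, h7.2.1⟩ (R := R₂) (by omega)).mono ?_
            rintro _ M₂ N₃ ⟨h8, h9, -, h10, h11⟩
            refine ⟨h8.trans hS₁, ⟨h9, fun w hw => ?_⟩, h11⟩
            have hwv : w ≠ v := by rintro rfl; exact (hdone₁ w hw).1 hch.2
            rw [h10, Function.update_of_ne hwv]
            exact hdone₁ w hw
          · rw [if_neg (by simpa using hch)]
            exact runs_pure ⟨hS₁, ⟨hC₁, hdone₁⟩, by omega⟩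
        · rintro _ M₁ N₂ hS₁ ⟨hC₁, hdone₁⟩ hN₂
          exact runs_pure ⟨_, hS₁, hC₁, hdone₁, by omega⟩

theorem Updating.setPath {ℓ : Fin n → ℝ≥0∞} {A : Finset (Fin n)} {M : Mem n m}
    (hU : Updating ℓ A ∅ M) {z : Fin n} (hz : z ∈ A) (hzm : M.queue.mem z = false) {d : ℝ≥0∞}
    (hd : ℓ z ≤ d) (P : Fin n → Option (Fin n)) (E : Fin n → Option (Fin m)) :
    Updating ℓ A ∅ { M with D := Function.update M.D z d, P := P, E := E } := by
  refine ⟨hU.inv, fun w hw => ?_, hU.mem, fun w => ?_, fun w hw => ?_, by simp, by simp⟩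
  · have hwz : w ≠ z := by rintro rfl; simp [hzm] at hw
    simp only [Function.update_of_ne hwz]
    exact hU.key w hw
  · by_cases hwz : w = z
    · subst hwz
      simpa using hd
    · simp only [Function.update_of_ne hwz]
      exact hU.le w
  · have hwz : w ≠ z := by rintro rfl; exact hw hz
    simp only [Function.update_of_ne hwz]
    exact hU.ge w hw

/-- Every value given to a red `z` is `∞` or D[q] + x ≥ ℓ(q) + x ≥ ℓ(z), so the lower bound
persists. Since `seen` has no duplicates, `z` is not yet in the queue when its D is raised, and no
stored key becomes stale. -/
theorem runs_increaseStep3a {a : Variant} {ℓ : Fin n → ℝ≥0∞} {A : Finset (Fin n)}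
    {M M₀ : Mem n m} (hS : M.SameStatic M₀) (hU : Updating ℓ A ∅ M)
    (hA : ∀ v, M.colour v = Colour.red → v ∈ A)
    (hℓ : ∀ z v e x, (v, e, x) ∈ visits a M₀ z → ℓ z ≤ ℓ v + x)
    (hnd : M.seen.Nodup) (hmem : ∀ v, M.queue.mem v = false) {N R : ℕ}
    (hN : M.queue.potential + (M.seen.map fun z => 86 + 9 * scanCost a M₀ z).sum +
      M.seen.length + 2 + R ≤ N) :
    Runs (increaseStep3a a) M N fun _ M' N' => M'.SameStatic M₀ ∧ M'.colour = M.colour ∧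
      M'.seen = M.seen ∧ Updating ℓ A ∅ M' ∧ M'.queue.potential + R ≤ N' := by
  unfold increaseStep3a
  refine runs_read_bind (by omega) ?_
  refine runs_foldEach_cost (fun l _ M' => M'.SameStatic M₀ ∧ M'.colour = M.colour ∧
    M'.seen = M.seen ∧ Updating ℓ A ∅ M' ∧ l.Nodup ∧ ∀ v ∈ l, M'.queue.mem v = false)
    (fun M => M.queue.potential) (fun z => 86 + 9 * scanCost a M₀ z) R
    ⟨hS, rfl, rfl, hU, hnd, fun v _ => hmem v⟩ (by omega) ?_ ?_
  · rintro z l _ M' N' R ⟨h1, h2, h3, h4, h5, h6⟩ hN'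
    rw [List.nodup_cons] at h5
    refine runs_read_bind (by omega) ?_
    by_cases hz : M'.colour z = Colour.red
    · rw [if_pos (by simpa using hz)]
      have hzA : z ∈ A := hA z (h2 ▸ hz)
      have hzm := h6 z (by simp)
      refine runs_write_bind (by omega) (runs_bind ?_)
      refine runs_scan (M₀ := M₀) (fun _ _ M₁ => M₁.colour = M.colour ∧ M₁.seen = M.seen ∧
        Updating ℓ A ∅ M₁ ∧ M₁.queue = M'.queue) 4 (83 + R) ⟨h1.1, h1.2, h1.3, h1.4, h1.5⟩
        ⟨h2, h3, h4.setPath hzA hzm le_top _ _, rfl⟩ (by dsimp only; omega) ?_ ?_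
      · rintro q e y _ _ M₁ N₁ R₁ hq hS₁ ⟨h7, h8, h9, h10⟩ hN₁
        refine runs_read_bind (by omega) (runs_read_bind (by omega)
          (runs_read_bind (by omega) ?_))
        split_ifs
        · refine runs_write (by omega) ⟨⟨hS₁.1, hS₁.2, hS₁.3, hS₁.4, hS₁.5⟩,
            ⟨h7, h8, h9.setPath hzA (by rw [h10, hzm]) ?_ _ _, h10⟩, by dsimp only; omega⟩
          exact (hℓ z q e y hq).trans (add_le_add (h9.le q) le_rfl)
        · exact runs_pure ⟨hS₁, ⟨h7, h8, h9, h10⟩, by omega⟩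
      · rintro _ M₁ N₁ hS₁ ⟨h7, h8, h9, h10⟩ hN₁
        refine runs_read_bind (by omega) ?_
        split_ifs
        · refine (runs_enqueueOrUpdate h9.inv (v := z) (R := R) ?_ (by omega)).mono ?_
          · rw [h10, hzm]
            simp
          · rintro _ _ N₂ ⟨q, rfl, h11, h12, h13, h14⟩
            refine ⟨⟨⟨hS₁.1, hS₁.2, hS₁.3, hS₁.4, hS₁.5⟩, h7, h8,
              ⟨h11, ?_, ?_, h9.le, h9.ge, by simp, by simp⟩, h5.2, ?_⟩, h14⟩
            · intro w hw
              dsimp only at hw ⊢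
              rw [h12] at hw
              rw [h13]
              by_cases hwz : w = z
              · simp [hwz]
              · simp only [Function.update_of_ne hwz] at hw ⊢
                exact h9.key w hw
            · intro w hw
              dsimp only at hw
              rw [h12] at hw
              by_cases hwz : w = z
              · rwa [hwz]
              · simp only [Function.update_of_ne hwz] at hw
                exact h9.mem w hw
            · intro w hw
              have hwz : w ≠ z := by rintro rfl; exact h5.1 hw
              dsimp only
              rw [h12, Function.update_of_ne hwz, h10]
              exact h6 w (by simp [hw])
        · refine runs_pure ⟨⟨hS₁, h7, h8, h9, h5.2, fun w hw => ?_⟩, by omega⟩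
          rw [h10]
          exact h6 w (by simp [hw])
    · rw [if_neg (by simpa using hz)]
      exact runs_pure ⟨⟨h1, h2, h3, h4, h5.2, fun w hw => h6 w (by simp [hw])⟩, by omega⟩
  · rintro _ M' N' ⟨h1, h2, h3, h4, -⟩ hN'
    exact ⟨h1, h2, h3, h4, hN'⟩

theorem runs_cleanUp {M : Mem n m} (hseen : ∀ v, M.colour v ≠ Colour.white → v ∈ M.seen)
    (hq : M.queue.Clean) {N : ℕ} (hN : 2 * M.seen.length + 2 ≤ N) :
    Runs cleanUp M N fun _ M' _ => M'.Clean := by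
  unfold cleanUp
  refine runs_bind (runs_step (by omega) ?_)
  refine runs_foldEach_cost (fun l _ M' => M'.seen = [] ∧ M'.queue.Clean ∧
    ∀ v, M'.colour v ≠ Colour.white → v ∈ l) (fun _ => 0) (fun _ => 1) 0
    ⟨rfl, hq, hseen⟩ ?_ ?_ ?_
  · simp only [List.map_const', List.sum_replicate, smul_eq_mul]
    omega
  · rintro v l _ M' N R ⟨h1, h2, h3⟩ hN
    refine runs_write (by omega) ⟨⟨h1, h2, fun w hw => ?_⟩, by omega⟩
    by_cases hwv : w = v
    · simp [hwv] at hw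
    · simp only [Function.update_of_ne hwv] at hw
      exact (List.mem_cons.1 (h3 w hw)).resolve_left hwv
  · rintro _ M' N ⟨h1, h2, h3⟩ -
    refine ⟨fun v => ?_, h1, h2⟩
    by_contra hv
    exact absurd (h3 v hv) (by simp)

end DSP

/-! # Tournament trees and the update of the underlying graph -/

theorem Entry.better_eq_or {m : ℕ} (a b : Entry m) : a.better b = a ∨ a.better b = b := by
  rcases a with _ | a <;> rcases b with _ | b <;> simp only [Entry.better, true_or, or_true]
  split_ifs <;> simp

theorem Entry.exists_better_le_left {m : ℕ} {a b : Entry m} {e : Fin m} {y : ℝ≥0∞}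
    (h : a = some (e, y)) : ∃ e' y', a.better b = some (e', y') ∧ y' ≤ y := by
  subst h
  rcases b with _ | ⟨e', y'⟩
  · exact ⟨e, y, rfl, le_rfl⟩
  · simp only [Entry.better]
    split_ifs with hlt
    · exact ⟨e', y', rfl, hlt.le⟩
    · exact ⟨e, y, rfl, le_rfl⟩

theorem Entry.exists_better_le_right {m : ℕ} {a b : Entry m} {e : Fin m} {y : ℝ≥0∞}
    (h : b = some (e, y)) : ∃ e' y', a.better b = some (e', y') ∧ y' ≤ y := by
  subst h
  rcases a with _ | ⟨e', y'⟩
  · exact ⟨e, y, rfl, le_rfl⟩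
  · simp only [Entry.better]
    split_ifs with hlt
    · exact ⟨e, y, rfl, le_rfl⟩
    · exact ⟨e', y', rfl, not_lt.1 hlt⟩

/-- The nodes of `T` form a tournament tree of the hyperedges in `p` with the weights `w`. -/
structure Tournament {m : ℕ} (p : Fin m → Prop) (w : Fin m → ℝ≥0∞) (T : ℕ → Entry m) : Prop where
  leaf : ∀ e : Fin m, p e → T (leafCount m + e) = some (e, w e)
  leaf_none : ∀ e : Fin m, ¬ p e → T (leafCount m + e) = none
  pad : ∀ i, leafCount m + m ≤ i → i < 2 * leafCount m → T i = none
  node : ∀ i, 1 ≤ i → i < leafCount m → T i = (T (2 * i)).better (T (2 * i + 1))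

theorem le_leafCount (m : ℕ) : m ≤ leafCount m := Nat.le_pow_clog (by norm_num) m

namespace Tournament

variable {m : ℕ} {p : Fin m → Prop} {w : Fin m → ℝ≥0∞} {T : ℕ → Entry m}

/-- An entry at an inner node comes from one of its two children, so it can be followed down to a
leaf; the padding leaves are empty. -/
theorem sound (hT : Tournament p w T) {i : ℕ} (h1 : 1 ≤ i) (h2 : i < 2 * leafCount m) {e : Fin m}
    {y : ℝ≥0∞} (h : T i = some (e, y)) : p e ∧ y = w e := by
  have key : ∀ k i, 2 * leafCount m - i = k → 1 ≤ i → i < 2 * leafCount m → T i = some (e, y) →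
      p e ∧ y = w e := by
    intro k
    induction k using Nat.strong_induction_on with
    | _ k ih =>
      intro i hk h1 h2 h
      by_cases hi : i < leafCount m
      · rw [hT.node i h1 hi] at h
        rcases Entry.better_eq_or (T (2 * i)) (T (2 * i + 1)) with h3 | h3
        · exact ih _ (by omega) (2 * i) rfl (by omega) (by omega) (h3.symm.trans h)
        · exact ih _ (by omega) (2 * i + 1) rfl (by omega) (by omega) (h3.symm.trans h)
      · by_cases him : i < leafCount m + m
        · obtain ⟨j, rfl⟩ := Nat.exists_eq_add_of_le (not_lt.1 hi)
          have hj : j < m := by omega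
          by_cases hp : p ⟨j, hj⟩
          · have h3 := hT.leaf ⟨j, hj⟩ hp
            simp only [h, Option.some.injEq, Prod.mk.injEq] at h3
            obtain ⟨rfl, rfl⟩ := h3
            exact ⟨hp, rfl⟩
          · have h3 := hT.leaf_none ⟨j, hj⟩ hp
            simp only [h] at h3
            cases h3
        · rw [hT.pad i (by omega) h2] at h
          cases h
  exact key _ i rfl h1 h2 h

/-- On the way from a leaf to the root by halving the index, an entry is replaced only by entries of
no larger weight. -/
theorem exists_root_le (hT : Tournament p w T) {e : Fin m} (he : p e) :
    ∃ e' y, T 1 = some (e', y) ∧ y ≤ w e := by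
  have key : ∀ i e y, 1 ≤ i → i < 2 * leafCount m → T i = some (e, y) →
      ∃ e' y', T 1 = some (e', y') ∧ y' ≤ y := by
    intro i
    induction i using Nat.strong_induction_on with
    | _ i ih =>
      intro e y h1 h2 h
      by_cases hi : i = 1
      · exact ⟨e, y, hi ▸ h, le_rfl⟩
      · have h3 := hT.node (i / 2) (by omega) (by omega)
        have h4 : ∃ e' y', T (i / 2) = some (e', y') ∧ y' ≤ y := by
          rw [h3]
          rcases Nat.even_or_odd' i with ⟨j, hj | hj⟩
          · have : 2 * (i / 2) = i := by omega
            rw [this]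
            exact Entry.exists_better_le_left h
          · have : 2 * (i / 2) + 1 = i := by omega
            rw [this]
            exact Entry.exists_better_le_right h
        obtain ⟨e', y', h5, h6⟩ := h4
        obtain ⟨e'', y'', h7, h8⟩ := ih (i / 2) (by omega) e' y' (by omega) (by omega) h5
        exact ⟨e'', y'', h7, h8.trans h6⟩
  have h1 := le_leafCount m
  have h2 := e.isLt
  exact key (leafCount m + e) e (w e) (by omega) (by omega) (hT.leaf e he)

theorem congr_weight (hT : Tournament p w T) {w' : Fin m → ℝ≥0∞} (h : ∀ e, p e → w' e = w e) :
    Tournament p w' T :=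
  ⟨fun e he => by rw [hT.leaf e he, h e he], hT.leaf_none, hT.pad, hT.node⟩

end Tournament

namespace DSP

open Prog

variable {n m : ℕ}

/-- The memory with a new tournament tree for the pair `u`, `v`. -/
def setPairQueue (M : Mem n m) (u v : Fin n) (T : ℕ → Entry m) : Mem n m :=
  { M with pairQueue := Function.update M.pairQueue u (Function.update (M.pairQueue u) v T) }

theorem setPairQueue_pairQueue (M : Mem n m) (u v : Fin n) (T : ℕ → Entry m) :
    (setPairQueue M u v T).pairQueue u v = T := by
  simp [setPairQueue]

theorem setPairQueue_setPairQueue (M : Mem n m) (u v : Fin n) (T T' : ℕ → Entry m) :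
    setPairQueue (setPairQueue M u v T) u v T' = setPairQueue M u v T' := by
  simp [setPairQueue]

/-- Only nodes on the way from the current `i` to the root, those of the form `i / 2 ^ j`, may
disagree with their children. Each round repairs `i` and moves up; `i < 2 ^ r` bounds the number of
rounds that write. -/
theorem runs_pairQueueUpdate {p : Fin m → Prop} {w : Fin m → ℝ≥0∞} {M : Mem n m} {u v : Fin n}
    (hT : Tournament p w (M.pairQueue u v)) {c : Fin m} (hc : p c) (x : ℝ≥0∞) {N R : ℕ}
    (hN : 2 * Nat.clog 2 m + 2 + R ≤ N) :
    Runs (pairQueueUpdate u v c x) M N fun _ M' N' => ∃ T, M' = setPairQueue M u v T ∧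
      Tournament p (Function.update w c x) T ∧ R ≤ N' := by
  have hm := le_leafCount m
  have hcm := c.isLt
  unfold pairQueueUpdate
  refine runs_write_bind (by omega) ?_
  refine runs_repeatUntilNone (fun i M' N' => ∃ T r, M' = setPairQueue M u v T ∧
    (∀ e : Fin m, p e → T (leafCount m + e) = some (e, Function.update w c x e)) ∧
    (∀ e : Fin m, ¬ p e → T (leafCount m + e) = none) ∧
    (∀ i, leafCount m + m ≤ i → i < 2 * leafCount m → T i = none) ∧
    (∀ k, 1 ≤ k → k < leafCount m → (∀ j, k ≠ i / 2 ^ j) →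
      T k = (T (2 * k)).better (T (2 * k + 1))) ∧
    i < leafCount m ∧ i < 2 ^ r ∧ 2 * r + 1 + R ≤ N') ?_ ?_
  · rintro i _ N' ⟨T, r, rfl, h1, h2, h3, h4, h5, h6, h7⟩
    refine ⟨by omega, ?_⟩
    by_cases hi : i = 0
    · rw [if_pos hi]
      refine runs_pure ⟨T, rfl, ⟨h1, h2, h3, fun k hk hk' => h4 k hk hk' fun j => ?_⟩, by omega⟩
      rw [hi, Nat.zero_div]
      omega
    · rw [if_neg hi]
      have hr : 1 ≤ r := by
        by_contra hr
        have : r = 0 := by omega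
        simp [this] at h6
        omega
      refine runs_write_bind (by omega) (runs_pure ?_)
      refine ⟨Function.update T i ((T (2 * i)).better (T (2 * i + 1))), r - 1, ?_, ?_, ?_, ?_, ?_,
        by omega, ?_, by omega⟩
      · rw [setPairQueue_pairQueue]
        exact setPairQueue_setPairQueue M u v T _
      · intro e he
        rw [Function.update_of_ne (by omega)]
        exact h1 e he
      · intro e he
        rw [Function.update_of_ne (by omega)]
        exact h2 e he
      · intro k hk hk'
        rw [Function.update_of_ne (by omega)]
        exact h3 k hk hk'
      · intro k hk hk' hj
        have h8 := hj 0
        rw [pow_zero, Nat.div_one] at h8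
        by_cases hki : k = i
        · subst hki
          rw [Function.update_self, Function.update_of_ne (by omega),
            Function.update_of_ne (by omega)]
        · rw [Function.update_of_ne hki, Function.update_of_ne (by omega),
            Function.update_of_ne (by omega)]
          refine h4 k hk hk' fun j => ?_
          cases j with
          | zero => simpa using hki
          | succ j =>
            have := hj j
            rwa [Nat.div_div_eq_div_mul, ← pow_succ'] at this
      · obtain ⟨r, rfl⟩ := Nat.exists_eq_add_of_le hr
        rw [pow_add, pow_one] at h6
        rw [Nat.add_sub_cancel_left]
        omega
  -- The parent of a leaf has index below `leafCount m`, a power of two with exponent `Nat.clog 2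
  -- m`. For `m = 1` the leaf is the root, and the loop starts at 0.
  · refine ⟨Function.update (M.pairQueue u v) (leafCount m + c) (some (c, x)), Nat.clog 2 m, rfl,
      ?_, ?_, ?_, ?_, by omega, ?_, by omega⟩
    · intro e he
      by_cases hec : e = c
      · simp [hec]
      · have : leafCount m + (e : ℕ) ≠ leafCount m + c := fun h => hec (Fin.ext (by omega))
        rw [Function.update_of_ne this, Function.update_of_ne hec]
        exact hT.leaf e he
    · intro e he
      have hec : e ≠ c := by rintro rfl; exact he hc
      have : leafCount m + (e : ℕ) ≠ leafCount m + c := fun h => hec (Fin.ext (by omega))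
      rw [Function.update_of_ne this]
      exact hT.leaf_none e he
    · intro i hi hi'
      rw [Function.update_of_ne (by omega)]
      exact hT.pad i hi hi'
    · intro k hk hk' hj
      have h8 := hj 0
      rw [pow_zero, Nat.div_one] at h8
      rw [Function.update_of_ne (by omega), Function.update_of_ne (by omega),
        Function.update_of_ne (by omega)]
      exact hT.node k hk hk'
    · change (leafCount m + c) / 2 < leafCount m
      omega

/-- The pairs in `S` still wait for the update of their tournament trees; for all others it is
complete. -/
structure Pairs (H : WeightedHypergraph n m) (c : Fin m) (x : ℝ≥0∞) (S : Fin n → Fin n → Prop)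
    (M : Mem n m) : Prop where
  old : ∀ u v, u ≠ v → S u v →
    Tournament (fun e => u ∈ H.edge e ∧ v ∈ H.edge e) H.weight (M.pairQueue u v)
  new : ∀ u v, u ≠ v → ¬ S u v → M.edgeWeight u v = M.pairQueue u v 1 ∧
    Tournament (fun e => u ∈ H.edge e ∧ v ∈ H.edge e) (H.setWeight c x).weight (M.pairQueue u v)

/-- Everything except the tournament trees and the weights of the underlying graph is the same. -/
def SamePart (M M₀ : Mem n m) : Prop :=
  ∃ pq ew, M = { M₀ with pairQueue := pq, edgeWeight := ew }

/-- Trees are stored for ordered pairs, so those of (u, v) and (v, u) are updated independently; in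
all there are at most |c|² updates of logarithmic cost. -/
theorem runs_graphUpdate {H : WeightedHypergraph n m} {c : Fin m} {x : ℝ≥0∞} {M : Mem n m}
    (hnd : (M.verts c).Nodup) (hverts : ∀ v, v ∈ M.verts c ↔ v ∈ H.edge c)
    (hP : Pairs H c x (fun u v => u ∈ H.edge c ∧ v ∈ H.edge c) M) {N R : ℕ}
    (hN : (M.verts c).length * ((M.verts c).length * (2 * Nat.clog 2 m + 4) + 2) + 2 + R ≤ N) :
    Runs (graphUpdate c x) M N fun _ M' N' => SamePart M' M ∧ Pairs H c x (fun _ _ => False) M' ∧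
      R ≤ N' := by
  unfold graphUpdate
  refine runs_read_bind (by omega) ?_
  refine runs_foldEach_cost (fun l _ M' => SamePart M' M ∧ l.Nodup ∧ (∀ u ∈ l, u ∈ M.verts c) ∧
    Pairs H c x (fun u v => u ∈ l ∧ v ∈ M.verts c) M') (fun _ => 0)
    (fun _ => (M.verts c).length * (2 * Nat.clog 2 m + 4) + 1) R
    ⟨⟨_, _, rfl⟩, hnd, fun _ h => h, by simpa only [hverts] using hP⟩ ?_ ?_ ?_
  · simp only [List.map_const', List.sum_replicate, smul_eq_mul]
    rw [mul_add, mul_add] at *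
    omega
  · rintro u l _ M₁ N₁ R₁ ⟨h1, h2, h3, h4⟩ hN₁
    rw [List.nodup_cons] at h2
    refine runs_foldEach_cost (fun l' _ M' => SamePart M' M ∧ l'.Nodup ∧
      (∀ v ∈ l', v ∈ M.verts c) ∧
      Pairs H c x (fun a b => a ∈ l ∧ b ∈ M.verts c ∨ a = u ∧ b ∈ l') M') (fun _ => 0)
      (fun _ => 2 * Nat.clog 2 m + 3) R₁
      ⟨h1, hnd, fun _ h => h, ?_⟩ ?_ ?_ ?_
    · have : (fun a b => a ∈ l ∧ b ∈ M.verts c ∨ a = u ∧ b ∈ M.verts c) =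
          fun a b => a ∈ u :: l ∧ b ∈ M.verts c := by
        funext a b
        simp only [List.mem_cons, eq_iff_iff]
        tauto
      rwa [this]
    · simp only [List.map_const', List.sum_replicate, smul_eq_mul]
      rw [mul_add] at *
      omega
    · rintro v l' _ M₂ N₂ R₂ ⟨h5, h6, h7, h8⟩ hN₂
      rw [List.nodup_cons] at h6
      dsimp only
      by_cases huv : u = v
      · rw [if_pos huv]
        subst huv
        refine runs_pure ⟨⟨h5, h6.2, fun w hw => h7 w (by simp [hw]), ?_, ?_⟩, by omega⟩
        · rintro a b hab hS
          refine h8.old a b hab (hS.imp id fun h => ⟨h.1, by simp [h.2]⟩)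
        · rintro a b hab hS
          refine h8.new a b hab fun h => hS (h.imp id fun h => ⟨h.1, ?_⟩)
          refine (List.mem_cons.1 h.2).resolve_left ?_
          rintro rfl
          exact hab h.1
      · rw [if_neg huv]
        have huc := h3 u (by simp)
        have hvc := h7 v (by simp)
        refine runs_bind ((runs_pairQueueUpdate (h8.old u v huv (Or.inr ⟨rfl, by simp⟩))
          ⟨(hverts u).1 huc, (hverts v).1 hvc⟩ x (R := 1 + R₂) (by omega)).mono ?_)
        rintro _ _ N₃ ⟨T, rfl, hT, hN₃⟩
        refine runs_write (by omega) ⟨⟨?_, h6.2, fun w hw => h7 w (by simp [hw]), ?_, ?_⟩,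
          by omega⟩
        · obtain ⟨pq, ew, rfl⟩ := h5
          exact ⟨_, _, rfl⟩
        · rintro a b hab hS
          have hne : ¬ (a = u ∧ b = v) := by
            rintro ⟨rfl, rfl⟩
            rcases hS with hS | hS
            · exact h2.1 hS.1
            · exact h6.1 hS.2
          have hold := h8.old a b hab (hS.imp id fun h => ⟨h.1, by simp [h.2]⟩)
          by_cases hau : a = u
          · subst hau
            have hbv : b ≠ v := fun h => hne ⟨rfl, h⟩
            simpa [setPairQueue, hbv] using hold
          · simpa [setPairQueue, hau] using hold
        · rintro a b hab hS
          by_cases hne : a = u ∧ b = v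
          · obtain ⟨rfl, rfl⟩ := hne
            refine ⟨by simp [setPairQueue], ?_⟩
            have := setPairQueue_pairQueue M₂ a b T
            simp only [setPairQueue] at this ⊢
            rw [this]
            exact hT
          · have hnew := h8.new a b hab fun h => hS (h.imp id fun h => ⟨h.1, ?_⟩)
            · by_cases hau : a = u
              · subst hau
                have hbv : b ≠ v := fun h => hne ⟨rfl, h⟩
                simpa [setPairQueue, hbv] using hnew
              · simpa [setPairQueue, hau] using hnew
            · exact (List.mem_cons.1 h.2).resolve_left fun h' => hne ⟨h.1, h'⟩
    · rintro _ M₂ N₂ ⟨h5, -, -, h8⟩ hN₂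
      exact ⟨⟨h5, h2.2, fun w hw => h3 w (by simp [hw]), by simpa using h8⟩, hN₂⟩
  · rintro _ M' N' ⟨h1, -, -, h4⟩ hN'
    exact ⟨h1, by simpa using h4, by omega⟩

end DSP

/-! # The number of steps of the two algorithms -/

namespace DSP

open Prog

variable {n m : ℕ} {H : WeightedHypergraph n m} {s : Fin n} {c : Fin m} {x : ℝ≥0∞}

theorem one_le_scanCost (a : Variant) (M : Mem n m) (z : Fin n) : 1 ≤ scanCost a M z := by
  cases a <;> simp only [scanCost] <;> omega

theorem SamePart.scanCost_eq {M M₀ : Mem n m} (h : SamePart M M₀) (a : Variant) (z : Fin n) :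
    scanCost a M z = scanCost a M₀ z := by
  obtain ⟨pq, ew, rfl⟩ := h
  cases a <;> rfl

/-- The distance updates with ℓ the new distance and `A` the affected set: D still holds the old
distances, which are at least ℓ after a decrease and equal ℓ outside `A`. -/
theorem runs_weightDecrease_rest {a : Variant} {M : Mem n m}
    (hverts : ∀ v, v ∈ M.verts c ↔ v ∈ H.edge c) (hV : VisitsOK a M (H.setWeight c x))
    (hD : ∀ v, M.D v = H.dist s v) (hM : M.Clean) (hx : x ≤ H.weight c) {A : Finset (Fin n)}
    (hA : A = H.affected (H.setWeight c x) s M.P M.E) {N : ℕ}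
    (hN : 88 * (M.verts c).length + ∑ z ∈ A, roundCost a M A z +
      70 * (Nat.log 2 A.card + 1) + 4 ≤ N) :
    Runs (decreaseStep1 c x >>= fun _ => decreaseStep2 a) M N fun _ M' _ => M'.Clean := by
  have hpot := hM.2.2.potential_eq
  have hU : Updating ((H.setWeight c x).dist s) A ∅ M := by
    refine ⟨hM.2.2.inv, ?_, ?_, fun v => ?_, fun v hv => ?_, by simp, by simp⟩
    · intro v hv
      simp [hM.2.2.2.2.1] at hv
    · intro v hv
      simp [hM.2.2.2.2.1] at hv
    · rw [hD]
      exact H.dist_setWeight_le_dist hx s v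
    · rw [hA] at hv
      rw [hD, WeightedHypergraph.dist_eq_of_notMem_affected hv]
  have hℓ : ∀ u ∈ M.verts c, ∀ v ∈ M.verts c,
      (H.setWeight c x).dist s v ≤ (H.setWeight c x).dist s u + x := by
    intro u hu v hv
    have := (H.setWeight c x).dist_le_add (s := s) ((hverts u).1 hu) ((hverts v).1 hv)
    simpa [WeightedHypergraph.setWeight] using this
  refine runs_bind ((runs_decreaseStep1 hU hℓ (R := ∑ z ∈ A, roundCost a M A z +
      70 * (Nat.log 2 A.card + 1)) (by omega)).mono ?_)
  rintro _ M₁ N₁ ⟨h1, h2, h3, h4, h5⟩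
  refine (runs_decreaseStep2 h1 h4 (fun z v e y hv => ?_) (R := 0) (by omega)).mono ?_
  · obtain ⟨h6, h7, rfl⟩ := hV.sound z v e y hv
    exact (H.setWeight c x).dist_le_add h6 h7
  · rintro _ M₂ N₂ ⟨-, h6, h7, h8, -⟩
    exact ⟨fun v => by rw [h6, h2, hM.1], by rw [h7, h3, hM.2.1], h8⟩

/-- Four copies of the sum pay for the colouring, step 3a, the distance updates and the reset of the
colours. The factor 140 is twice 70, for the two extractions from an empty queue. -/
theorem runs_weightIncrease_rest {a : Variant} {M : Mem n m} (hnd : (M.verts c).Nodup)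
    (hV : VisitsOK a M (H.setWeight c x)) (hd : H.IsShortestPathData s M.D M.P M.E)
    (hM : M.Clean) (hx : H.weight c < x) {A : Finset (Fin n)}
    (hA : A = H.affected (H.setWeight c x) s M.P M.E) {N : ℕ}
    (hN : 18 * (M.verts c).length + 4 * ∑ z ∈ A, roundCost a M A z +
      140 * (Nat.log 2 A.card + 1) + 10 ≤ N) :
    Runs (increaseStep1 c >>= fun _ => increaseStep2 a >>= fun _ => increaseStep3a a >>= fun _ =>
      decreaseStep2 a >>= fun _ => cleanUp) M N fun _ M' _ => M'.Clean := by
  classical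
  have hpot := hM.2.2.potential_eq
  have hC : Colouring H s c x M.P M.E M := by
    refine ⟨hd.1, hM.2.2.inv, ?_, ?_, ?_, ?_, fun _ _ => rfl, ?_⟩ <;>
      simp [hM.1, hM.2.1, hM.2.2.2.2.1]
  refine runs_bind ((runs_increaseStep1 hd hx hC rfl hnd hM.1
    (R := 4 * ∑ z ∈ A, roundCost a M A z + 140 * (Nat.log 2 A.card + 1) + 8) (by omega)).mono ?_)
  rintro _ M₁ N₁ ⟨h1, h2, h3⟩
  refine runs_bind ((runs_increaseStep2 hd hx hV h1 h2 hA
    (R := 3 * ∑ z ∈ A, roundCost a M A z + 70 * (Nat.log 2 A.card + 1) + 8) (by omega)).mono ?_)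
  rintro _ M₂ N₂ ⟨h4, h5, h6, h7⟩
  have hseenA : ∀ v ∈ M₂.seen, v ∈ A := fun v hv => by
    rw [hA]
    exact (h5.affected v ((h5.seen v).1 hv)).1
  have hsum : (M₂.seen.map fun z => 86 + 9 * scanCost a M z).sum + M₂.seen.length ≤
      ∑ z ∈ A, roundCost a M A z := by
    have h8 : (M₂.seen.map fun z => 86 + 9 * scanCost a M z).sum + M₂.seen.length =
        (M₂.seen.map fun z => 87 + 9 * scanCost a M z).sum := by
      induction M₂.seen with
      | nil => rfl
      | cons z l ih =>
        simp only [List.map_cons, List.sum_cons, List.length_cons]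
        omega
    rw [h8, ← List.sum_toFinset _ h5.nodup]
    refine (Finset.sum_le_sum fun z _ => ?_).trans (Finset.sum_le_sum_of_subset
      fun v hv => hseenA v (List.mem_toFinset.1 hv))
    have := one_le_scanCost a M z
    unfold roundCost
    omega
  have hpot₂ := h6.potential_eq
  let B : Finset (Fin n) := Finset.univ.filter fun v => M₂.colour v = Colour.red
  have hBA : B ⊆ A := fun v hv => hseenA v ((h5.seen v).2 (by
    rw [(Finset.mem_filter.1 hv).2]
    simp))
  -- The lower bound is the old distance, to which D is still equal everywhere; only red vertices
  -- are about to leave it.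
  have hU : Updating (H.dist s) B ∅ M₂ := by
    refine ⟨h6.inv, ?_, ?_, fun v => (h5.dist v).ge, fun v _ => (h5.dist v).le,
      by simp, by simp⟩
    · intro v hv
      simp [h6.2.2.1] at hv
    · intro v hv
      simp [h6.2.2.1] at hv
  have hle : ∀ z v e y, (v, e, y) ∈ visits a M z →
      H.dist s z ≤ H.dist s v + y ∧ H.dist s v ≤ H.dist s z + y := by
    intro z v e y hv
    obtain ⟨h6, h7, rfl⟩ := hV.sound z v e y hv
    exact ⟨(H.dist_le_add h7 h6).trans (add_le_add le_rfl (H.weight_le_setWeight hx.le e)),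
      (H.dist_le_add h6 h7).trans (add_le_add le_rfl (H.weight_le_setWeight hx.le e))⟩
  have hlogB : Nat.log 2 B.card ≤ Nat.log 2 A.card :=
    Nat.log_mono_right (Finset.card_le_card hBA)
  have hsumB : ∑ z ∈ B, roundCost a M B z ≤ ∑ z ∈ A, roundCost a M A z := by
    refine (Finset.sum_le_sum fun z _ => ?_).trans (Finset.sum_le_sum_of_subset hBA)
    unfold roundCost
    omega
  have hlen : M₂.seen.length ≤ ∑ z ∈ A, roundCost a M A z := by omega
  refine runs_bind ((runs_increaseStep3a h4 hU (fun v hv => by simpa [B] using hv)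
    (fun z v e y hv => (hle z v e y hv).1) h5.nodup h6.2.2.1
    (R := 2 * ∑ z ∈ A, roundCost a M A z + 70 * (Nat.log 2 A.card + 1) + 6) (by omega)).mono ?_)
  rintro _ M₃ N₃ ⟨h8, h9, h10, h11, h12⟩
  have h2len : 2 * M₂.seen.length ≤ ∑ z ∈ A, roundCost a M A z := by
    refine le_trans ?_ hsum
    have h13 : M₂.seen.length ≤ (M₂.seen.map fun z => 86 + 9 * scanCost a M z).sum := by
      induction M₂.seen with
      | nil => simp
      | cons z l ih =>
        simp only [List.map_cons, List.sum_cons, List.length_cons]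
        omega
    omega
  refine runs_bind ((runs_decreaseStep2 h8 h11 (fun z v e y hv => (hle z v e y hv).2)
    (R := ∑ z ∈ A, roundCost a M A z + 6) (by omega)).mono ?_)
  rintro _ M₄ N₄ ⟨-, h13, h14, h15, h16⟩
  refine runs_cleanUp (fun v hv => ?_) h15 ?_
  · rw [h14, h10, h5.seen, ← h9, ← h13]
    exact hv
  · rw [h14, h10]
    omega

/-- The variants differ only in step 0 and in the cost of their scans, so step 0 enters through its
cost `K` and the correctness of the later visits. -/
theorem runs_run {a : Variant} {M : Mem n m} (hM : M.RepresentsHE H s) (hx : x ≠ H.weight c)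
    {A : Finset (Fin n)} (hA : A = H.affected (H.setWeight c x) s M.P M.E) {K : ℕ}
    (h0 : ∀ N R, K + R ≤ N → Runs (step0 a c x) M N fun _ M' N' =>
      SamePart M' { M with weight := (H.setWeight c x).weight } ∧
        VisitsOK a M' (H.setWeight c x) ∧ R ≤ N') {N : ℕ}
    (hN : K + 88 * (H.edge c).card + 4 * ∑ z ∈ A, roundCost a M A z +
      140 * (Nat.log 2 A.card + 1) + 11 ≤ N) :
    Runs (run a c x) M N fun _ M' _ => M'.Clean := by
  obtain ⟨hverts, hinc, hw, hd, hclean⟩ := hM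
  have hlen : (M.verts c).length = (H.edge c).card := by
    rw [← List.toFinset_card_of_nodup (hverts c).1]
    congr 1
    ext v
    simp [(hverts c).2]
  unfold run
  refine runs_read_bind (by omega) ?_
  rw [hw]
  split_ifs with hlt
  · refine runs_bind ((h0 (N - 1) (N - 1 - K) (by omega)).mono ?_)
    rintro _ M₁ N₁ ⟨h1, h2, h3⟩
    have hcost : ∀ z, roundCost a M₁ A z = roundCost a M A z := fun z => by
      unfold roundCost
      rw [h1.scanCost_eq]
      cases a <;> rfl
    obtain ⟨pq, ew, rfl⟩ := h1
    refine runs_weightDecrease_rest ?_ h2 ?_ ?_ hlt.le hA ?_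
    · exact (hverts c).2
    · exact hd.1
    · exact hclean
    · simp only [hcost]
      omega
  · refine runs_bind ((h0 (N - 1) (N - 1 - K) (by omega)).mono ?_)
    rintro _ M₁ N₁ ⟨h1, h2, h3⟩
    have hcost : ∀ z, roundCost a M₁ A z = roundCost a M A z := fun z => by
      unfold roundCost
      rw [h1.scanCost_eq]
      cases a <;> rfl
    obtain ⟨pq, ew, rfl⟩ := h1
    refine runs_weightIncrease_rest ?_ h2 ?_ ?_ (lt_of_le_of_ne (not_lt.1 hlt) hx.symm) hA ?_
    · exact (hverts c).1
    · exact hd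
    · exact hclean
    · simp only [hcost]
      omega

theorem runs_step0_HE {M : Mem n m} (hM : M.RepresentsHE H s) {N R : ℕ} (hN : 1 + R ≤ N) :
    Runs (step0 Variant.HE c x) M N fun _ M' N' =>
      SamePart M' { M with weight := (H.setWeight c x).weight } ∧
        VisitsOK Variant.HE M' (H.setWeight c x) ∧ R ≤ N' := by
  obtain ⟨hverts, hinc, hw, -, -⟩ := hM
  refine runs_write_bind (by omega) (runs_pure ⟨⟨M.pairQueue, M.edgeWeight, ?_⟩, ⟨?_, ?_⟩,
    by omega⟩)
  · rw [hw]
    rfl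
  · intro z v e y hv
    simp only [visits, List.mem_flatMap, List.mem_map, hw] at hv
    obtain ⟨e', h1, v', h2, h3⟩ := hv
    obtain ⟨rfl, rfl, rfl⟩ : v' = v ∧ e' = e ∧ Function.update H.weight c x e' = y := by
      simpa using h3
    exact ⟨((hinc z).2 e').1 h1, ((hverts e').2 v').1 h2, rfl⟩
  · intro z q f _ hq hz
    refine ⟨f, Function.update H.weight c x f, ?_, le_rfl⟩
    simp only [visits, List.mem_flatMap, List.mem_map, hw]
    exact ⟨f, ((hinc z).2 f).2 hz, q, ((hverts f).2 q).2 hq, rfl⟩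

theorem runs_step0_DR {M : Mem n m} (hM : M.RepresentsDR H s) {N R : ℕ}
    (hN : (H.edge c).card * ((H.edge c).card * (2 * Nat.clog 2 m + 4) + 2) + 3 + R ≤ N) :
    Runs (step0 Variant.DR c x) M N fun _ M' N' =>
      SamePart M' { M with weight := (H.setWeight c x).weight } ∧
        VisitsOK Variant.DR M' (H.setWeight c x) ∧ R ≤ N' := by
  obtain ⟨⟨hverts, hinc, hw, -, -⟩, hadj, hpq⟩ := hM
  have hlen : (M.verts c).length = (H.edge c).card := by
    rw [← List.toFinset_card_of_nodup (hverts c).1]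
    congr 1
    ext v
    simp [(hverts c).2]
  have hT : ∀ u v, u ≠ v →
      Tournament (fun e => u ∈ H.edge e ∧ v ∈ H.edge e) H.weight (M.pairQueue u v) := by
    intro u v huv
    obtain ⟨h1, h2, h3, -⟩ := hpq u v huv
    exact ⟨fun e => (h1 e).1, fun e => (h1 e).2, h2, h3⟩
  refine runs_write_bind (by omega) ?_
  refine (runs_graphUpdate (H := H) (R := R) (M := { M with
    weight := Function.update M.weight c x }) (hverts c).1 (hverts c).2
    ⟨fun u v huv _ => hT u v huv, ?_⟩ ?_).mono ?_
  · intro u v huv hS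
    -- A pair not contained in `c` has no entry for `c`, so its tree is already valid for the new
    -- weights.
    refine ⟨(hpq u v huv).2.2.2, (hT u v huv).congr_weight fun e he => ?_⟩
    have hec : e ≠ c := by rintro rfl; exact hS he
    simp [WeightedHypergraph.setWeight, hec]
  · dsimp only
    rw [hlen]
    omega
  · rintro _ M' N' ⟨⟨pq, ew, rfl⟩, hP, hN'⟩
    refine ⟨⟨pq, ew, ?_⟩, ⟨?_, ?_⟩, hN'⟩
    · rw [hw]
      rfl
    · have hpos : 1 < 2 * leafCount m := by
        have : 0 < leafCount m := Nat.pow_pos (by norm_num)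
        omega
      intro z v e y hv
      simp only [visits, List.mem_flatMap] at hv
      obtain ⟨v', h1, h2⟩ := hv
      have hne := (((hadj z).2 v').1 h1).1
      obtain ⟨h3, h4⟩ := hP.new z v' hne (by simp)
      dsimp only at h3 h4
      rw [h3] at h2
      cases hroot : pq z v' 1 with
      | none => simp [hroot] at h2
      | some t =>
        simp only [hroot, Option.map_some, Option.toList_some, List.mem_singleton] at h2
        obtain ⟨rfl, rfl⟩ := Prod.mk.inj h2
        obtain ⟨h5, h6⟩ := h4.sound le_rfl hpos hroot
        exact ⟨h5.1, h5.2, h6⟩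
    · intro z q f hqz hq hz
      obtain ⟨h3, h4⟩ := hP.new z q hqz.symm (by simp)
      dsimp only at h3 h4
      obtain ⟨e, y, h5, h6⟩ := h4.exists_root_le ⟨hz, hq⟩
      refine ⟨e, y, ?_, h6⟩
      simp only [visits, List.mem_flatMap]
      refine ⟨q, ((hadj z).2 q).2 ⟨hqz.symm, f, hz, hq⟩, ?_⟩
      rw [h3, h5]
      simp

end DSP

/-! ### Summing the scans and fixing the constant -/

namespace DSP

open Prog

variable {n m : ℕ} {H : WeightedHypergraph n m} {s : Fin n}

/-- A vertex in no hyperedge has distance 0 or `∞` before and after, and no parent. This lets the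
constant overhead of a scan be charged to a hyperedge. -/
theorem exists_edge_of_mem_affected {D : Fin n → ℝ≥0∞} {P : Fin n → Option (Fin n)}
    {E : Fin n → Option (Fin m)} (hd : H.IsShortestPathData s D P E) {c : Fin m} {x : ℝ≥0∞}
    {z : Fin n} (hz : z ∈ H.affected (H.setWeight c x) s P E) : ∃ e, z ∈ H.edge e := by
  rcases WeightedHypergraph.mem_affected.1 hz with h1 | ⟨p, e, h1, -, -⟩
  · by_contra! hcon
    refine h1 ?_
    by_cases hzs : z = s
    · rw [hzs, WeightedHypergraph.dist_self, WeightedHypergraph.dist_self]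
    have h2 : H.dist s z = ∞ := by
      by_contra h2
      obtain ⟨_, f, -, -, h3, -⟩ := H.exists_pred hzs h2
      exact hcon f h3
    have h3 : (H.setWeight c x).dist s z = ∞ := by
      by_contra h3
      obtain ⟨_, f, -, -, h4, -⟩ := (H.setWeight c x).exists_pred hzs h3
      exact hcon f h4
    rw [h2, h3]
  · obtain ⟨-, -, e', -, -, h2, -⟩ := hd.of_parent h1
    exact ⟨e', h2⟩

/-- Double counting of incidences: f is traversed from at most |f| vertices of `A`, at cost |f|
each. Of the factor 3, two come from 1 + |f| ≤ 2|f| and one from the leading 1 of `scanCost`. -/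
theorem sum_scanCost_HE_le {M : Mem n m} (hM : M.RepresentsHE H s) {A : Finset (Fin n)}
    (hA : ∀ z ∈ A, ∃ e, z ∈ H.edge e) :
    ∑ z ∈ A, scanCost Variant.HE M z ≤ 3 * H.affectedPhi A := by
  classical
  obtain ⟨hverts, hinc, -, -, -⟩ := hM
  have h1 : ∀ z ∈ A, scanCost Variant.HE M z ≤
      3 * ∑ e ∈ Finset.univ.filter (fun e => z ∈ H.edge e), (H.edge e).card := by
    intro z hz
    obtain ⟨e₀, he₀⟩ := hA z hz
    have h2 : (M.inc z).toFinset = Finset.univ.filter fun e => z ∈ H.edge e := by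
      ext e
      simp [(hinc z).2]
    have h3 : ∀ e, (M.verts e).length = (H.edge e).card := by
      intro e
      rw [← List.toFinset_card_of_nodup (hverts e).1]
      congr 1
      ext v
      simp [(hverts e).2]
    simp only [scanCost]
    rw [← List.sum_toFinset _ (hinc z).1, h2]
    simp only [h3]
    have h4 : ∑ e ∈ Finset.univ.filter (fun e => z ∈ H.edge e), (1 + (H.edge e).card) ≤
        2 * ∑ e ∈ Finset.univ.filter (fun e => z ∈ H.edge e), (H.edge e).card := by
      rw [Finset.mul_sum]
      refine Finset.sum_le_sum fun e _ => ?_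
      have := (H.edge_nonempty e).card_pos
      omega
    have h5 : (H.edge e₀).card ≤
        ∑ e ∈ Finset.univ.filter (fun e => z ∈ H.edge e), (H.edge e).card :=
      Finset.single_le_sum (f := fun e => (H.edge e).card) (fun _ _ => Nat.zero_le _)
        (by simpa using he₀)
    have h6 := (H.edge_nonempty e₀).card_pos
    omega
  refine (Finset.sum_le_sum h1).trans ?_
  rw [← Finset.mul_sum, WeightedHypergraph.affectedPhi]
  refine Nat.mul_le_mul_left _ ?_
  rw [Finset.sum_comm' (s' := fun e => A.filter fun z => z ∈ H.edge e)
    (t' := Finset.univ.filter fun e => ∃ v ∈ A, v ∈ H.edge e)]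
  · refine Finset.sum_le_sum fun e _ => ?_
    rw [Finset.sum_const, smul_eq_mul, sq]
    exact Nat.mul_le_mul_right _ (Finset.card_le_card fun z hz => (Finset.mem_filter.1 hz).2)
  · intro z e
    simp only [Finset.mem_filter, Finset.mem_univ, true_and]
    constructor
    · rintro ⟨h2, h3⟩
      exact ⟨⟨h2, h3⟩, z, h2, h3⟩
    · rintro ⟨⟨h2, h3⟩, -⟩
      exact ⟨h2, h3⟩

/-- Handshake: each edge meeting `A` is counted from at most two endpoints. -/
theorem sum_scanCost_DR_le {M : Mem n m} (hM : M.RepresentsDR H s) (A : Finset (Fin n)) :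
    ∑ z ∈ A, scanCost Variant.DR M z ≤ 2 * H.affectedGraphSize A := by
  classical
  obtain ⟨-, hadj, -⟩ := hM
  have hfin : {a ∈ H.underlyingGraph.edgeSet | ∃ v ∈ A, v ∈ a}.Finite := Set.toFinite _
  let F := hfin.toFinset
  have hF : ∀ a, a ∈ F ↔ a ∈ H.underlyingGraph.edgeSet ∧ ∃ v ∈ A, v ∈ a := fun a => by
    simp [F]
  have h1 : ∀ z ∈ A, (M.adj z).length ≤ (F.filter fun a => z ∈ a).card := by
    intro z hz
    rw [← List.toFinset_card_of_nodup (hadj z).1]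
    refine Finset.card_le_card_of_injOn (fun v => s(z, v)) (fun v hv => ?_) fun v _ w _ hvw => ?_
    · have hv' := ((hadj z).2 v).1 (by simpa using hv)
      simp only [Finset.coe_filter, hF, Set.mem_ofPred_eq]
      exact ⟨⟨hv', z, hz, by simp⟩, by simp⟩
    · have h2 : v = w ∨ z = w ∧ v = z := by simpa using hvw
      exact h2.elim id fun h => h.2.trans h.1
  have h2 : ∑ z ∈ A, (F.filter fun a => z ∈ a).card ≤ 2 * F.card := by
    have h3 : ∑ z ∈ A, (F.filter fun a => z ∈ a).card =
        ∑ a ∈ F, (A.filter fun z => z ∈ a).card :=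
      Finset.sum_card_bipartiteAbove_eq_sum_card_bipartiteBelow (fun z a => z ∈ a)
    rw [h3, mul_comm, ← smul_eq_mul]
    refine Finset.sum_le_card_nsmul _ _ _ fun a _ => ?_
    induction a using Sym2.ind with
    | _ u v =>
      refine (Finset.card_le_card (t := {u, v}) fun z hz => ?_).trans Finset.card_le_two
      simpa using (Finset.mem_filter.1 hz).2
  have h4 : ∑ z ∈ A, scanCost Variant.DR M z = A.card + ∑ z ∈ A, (M.adj z).length := by
    simp [scanCost, Finset.sum_add_distrib]
  have h5 := Finset.sum_le_sum h1
  have h6 : Set.ncard {a ∈ H.underlyingGraph.edgeSet | ∃ v ∈ A, v ∈ a} = F.card :=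
    Set.ncard_eq_toFinset_card _ hfin
  rw [h4, WeightedHypergraph.affectedGraphSize, h6]
  omega

theorem sum_roundCost (a : Variant) (M : Mem n m) (A : Finset (Fin n)) :
    ∑ z ∈ A, roundCost a M A z =
      70 * (A.card * Nat.log 2 A.card + A.card) + 200 * ∑ z ∈ A, scanCost a M z := by
  simp only [roundCost, Finset.sum_add_distrib, ← Finset.mul_sum, Finset.sum_const, smul_eq_mul]
  ring

theorem card_le_sum_scanCost (a : Variant) (M : Mem n m) (A : Finset (Fin n)) :
    A.card ≤ ∑ z ∈ A, scanCost a M z := by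
  rw [Finset.card_eq_sum_ones]
  exact Finset.sum_le_sum fun z _ => one_le_scanCost a M z

/-- The factor 2 comes from log 2 > 1/2. For `k = 0` both sides vanish, as `Real.log 0 = 0`. -/
theorem natLog_le (k : ℕ) : (Nat.log 2 k : ℝ) ≤ 2 * Real.log k := by
  have h1 := Real.natLog_le_logb k 2
  have h2 := Real.log_two_gt_d9
  have h3 := Real.log_natCast_nonneg k
  refine h1.trans ?_
  rw [Real.logb, Nat.cast_ofNat, div_le_iff₀ (by linarith)]
  nlinarith

theorem heDSP_steps {M : Mem n m} (hM : M.RepresentsHE H s) {c : Fin m} {x : ℝ≥0∞}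
    (hx : x ≠ H.weight c) {A : Finset (Fin n)}
    (hA : A = H.affected (H.setWeight c x) s M.P M.E) :
    ∃ (M' : Mem n m) (t : ℕ), heDSP c x M = some ((), M', t) ∧ M'.Clean ∧
      (A.Nonempty → (t : ℝ) ≤ 4000 * (A.card * Real.log A.card + H.affectedPhi A)) ∧
      (A = ∅ → (t : ℝ) ≤ 4000 * (H.edge c).card) := by
  obtain ⟨⟨⟩, M', t, h1, h2, h3⟩ := runs_run hM hx hA (K := 1)
    (fun N R hN => runs_step0_HE hM hN) le_rfl
  refine ⟨M', t, h1, h3, fun hne => ?_, fun hempty => ?_⟩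
  · have h4 := sum_roundCost Variant.HE M A
    have h5 := card_le_sum_scanCost Variant.HE M A
    have h6 := sum_scanCost_HE_le hM (A := A) fun z hz =>
      exists_edge_of_mem_affected hM.2.2.2.1 (hA ▸ hz)
    -- Some vertex of `c` is affected, so |c|² is one of the summands and absorbs the linear work on
    -- `c`.
    have h7 : (H.edge c).card ≤ H.affectedPhi A := by
      obtain ⟨v, hv, hvA⟩ := hM.2.2.2.1.exists_affected_mem (hA ▸ hne)
      rw [← hA] at hvA
      refine le_trans ?_ (Finset.single_le_sum (f := fun e => (H.edge e).card ^ 2)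
        (fun _ _ => Nat.zero_le _) (a := c) ?_)
      · exact Nat.le_self_pow (by norm_num) _
      · simpa using ⟨v, hvA, hv⟩
    have h8 : 1 ≤ A.card := hne.card_pos
    have h9 : Nat.log 2 A.card ≤ A.card * Nat.log 2 A.card := Nat.le_mul_of_pos_left _ h8
    have h10 : t ≤ 420 * (A.card * Nat.log 2 A.card) + 3800 * H.affectedPhi A := by omega
    have h11 : (t : ℝ) ≤ 420 * (A.card * Nat.log 2 A.card) + 3800 * H.affectedPhi A := by
      exact_mod_cast h10
    have h12 := mul_le_mul_of_nonneg_left (natLog_le A.card) (Nat.cast_nonneg (α := ℝ) A.card)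
    have h13 : (0 : ℝ) ≤ A.card * Real.log A.card :=
      mul_nonneg (Nat.cast_nonneg _) (Real.log_natCast_nonneg _)
    have h14 : (0 : ℝ) ≤ H.affectedPhi A := Nat.cast_nonneg _
    linarith
  · rw [hempty] at h2
    -- Without affected vertices only the work on `c` and a constant remain, and the constant is
    -- absorbed because |c| ≥ 1.
    simp only [Finset.sum_empty, Finset.card_empty, Nat.log_zero_right] at h2
    have h4 := (H.edge_nonempty c).card_pos
    have h5 : t ≤ 4000 * (H.edge c).card := by omega
    exact_mod_cast h5

theorem drDSP_steps {M : Mem n m} (hM : M.RepresentsDR H s) {c : Fin m} {x : ℝ≥0∞}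
    (hx : x ≠ H.weight c) {A : Finset (Fin n)}
    (hA : A = H.affected (H.setWeight c x) s M.P M.E) :
    ∃ (M' : Mem n m) (t : ℕ), drDSP c x M = some ((), M', t) ∧ M'.Clean ∧
      (t : ℝ) ≤ 4000 * (A.card * Real.log A.card + H.affectedGraphSize A +
        (H.edge c).card ^ 2 * Real.log (m + 1)) := by
  obtain ⟨⟨⟩, M', t, h1, h2, h3⟩ := runs_run hM.1 hx hA
    (K := (H.edge c).card * ((H.edge c).card * (2 * Nat.clog 2 m + 4) + 2) + 3)
    (fun N R hN => runs_step0_DR hM hN) le_rfl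
  refine ⟨M', t, h1, h3, ?_⟩
  have h4 := sum_roundCost Variant.DR M A
  have h5 := card_le_sum_scanCost Variant.DR M A
  have h6 := sum_scanCost_DR_le hM A
  have h7 := (H.edge_nonempty c).card_pos
  have h8 : (H.edge c).card ≤ (H.edge c).card ^ 2 := Nat.le_self_pow (by norm_num) _
  have h9 : Nat.log 2 A.card ≤ A.card * Nat.log 2 A.card := by
    rcases Nat.eq_zero_or_pos A.card with h | h
    · simp [h]
    · exact Nat.le_mul_of_pos_left _ h
  have h10 : Nat.clog 2 m ≤ Nat.log 2 m + 1 :=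
    Nat.clog_le_of_le_pow (Nat.lt_pow_succ_log_self (by norm_num) m).le
  have h11 : (H.edge c).card * ((H.edge c).card * (2 * Nat.clog 2 m + 4) + 2) ≤
      2 * ((H.edge c).card ^ 2 * Nat.log 2 m) + 6 * (H.edge c).card ^ 2 +
        2 * (H.edge c).card := by
    have := Nat.mul_le_mul_left ((H.edge c).card ^ 2) h10
    nlinarith
  have h12 : t ≤ 420 * (A.card * Nat.log 2 A.card) + 2400 * H.affectedGraphSize A +
      2 * ((H.edge c).card ^ 2 * Nat.log 2 m) + 300 * (H.edge c).card ^ 2 := by omega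
  have h13 : (t : ℝ) ≤ 420 * (A.card * Nat.log 2 A.card) + 2400 * H.affectedGraphSize A +
      2 * ((H.edge c).card ^ 2 * Nat.log 2 m) + 300 * (H.edge c).card ^ 2 := by
    exact_mod_cast h12
  have h14 := mul_le_mul_of_nonneg_left (natLog_le A.card) (Nat.cast_nonneg (α := ℝ) A.card)
  have h15 : (0 : ℝ) ≤ A.card * Real.log A.card :=
    mul_nonneg (Nat.cast_nonneg _) (Real.log_natCast_nonneg _)
  have h16 : (0 : ℝ) ≤ H.affectedGraphSize A := Nat.cast_nonneg _
  -- The existence of `c` gives m ≥ 1. Then log(m + 1) ≥ log 2 > 1/2 absorbs the constant work per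
  -- pair, which log m could not do for m = 1.
  have hm : (1 : ℝ) ≤ m := by
    have := c.isLt
    exact_mod_cast (by omega : 1 ≤ m)
  have h17 : Real.log m ≤ Real.log (m + 1) := Real.log_le_log (by linarith) (by linarith)
  have h18 : Real.log 2 ≤ Real.log (m + 1) := Real.log_le_log (by norm_num) (by linarith)
  have h19 := Real.log_two_gt_d9
  have h20 : (0 : ℝ) ≤ ((H.edge c).card : ℝ) ^ 2 := sq_nonneg _
  have h21 := mul_le_mul_of_nonneg_left ((natLog_le m).trans
    (mul_le_mul_of_nonneg_left h17 (by norm_num))) h20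
  have h22 : ((H.edge c).card : ℝ) ^ 2 * 1 ≤ ((H.edge c).card : ℝ) ^ 2 * (2 * Real.log (m + 1)) :=
    mul_le_mul_of_nonneg_left (by linarith) h20
  linarith

end DSP

theorem mainTheorem4 :
    ∃ C : ℝ, 0 < C ∧ ∀ (n m : ℕ) (H : WeightedHypergraph n m) (s : Fin n) (M : Mem n m)
      (c : Fin m) (wNew : ℝ≥0∞), wNew ≠ H.weight c →
      ∀ A : Finset (Fin n), A = H.affected (H.setWeight c wNew) s M.P M.E →
      (M.RepresentsHE H s → ∃ (M' : Mem n m) (t : ℕ), heDSP c wNew M = some ((), M', t) ∧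
        M'.Clean ∧
        (A.Nonempty → (t : ℝ) ≤ C * (A.card * Real.log A.card + H.affectedPhi A)) ∧
        (A = ∅ → (t : ℝ) ≤ C * (H.edge c).card)) ∧
      (M.RepresentsDR H s → ∃ (M' : Mem n m) (t : ℕ), drDSP c wNew M = some ((), M', t) ∧
        M'.Clean ∧
        (t : ℝ) ≤ C * (A.card * Real.log A.card + H.affectedGraphSize A +
          (H.edge c).card ^ 2 * Real.log (m + 1))) :=
  ⟨4000, by norm_num, fun _ _ _ _ _ _ _ hw _ hA =>
    ⟨fun hM => DSP.heDSP_steps hM hw hA, fun hM => DSP.drDSP_steps hM hw hA⟩⟩
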